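/- **Setting.** Let $f:\mathbb R^2\to[0,\infty)$ be a probability density and $X_1,X_2,\dots$ i.i.d. with density $f$. For a function $g$ on $\mathbb R^2$ write $g^{(i,j)}=\partial_1^i\partial_2^j g$, $d^2g=(g^{(2,0)},g^{(1,1)},g^{(0,2)})^T$, and let $$G(u,v,w)=\begin{pmatrix}2u-2w+2v-2\sqrt{(w-u)^2+4v^2}\\ w-u+4v-\sqrt{(w-u)^2+4v^2}\end{pmatrix},\qquad J(u,v,w)=\frac{u+w-\sqrt{(u-w)^2+4v^2}}2 .$$ Put $V=G(d^2f)$ and $\lambda_2=J(d^2f)$ (so $\nabla^2f\,V=\lambda_2V$, with $\lambda_2$ the smaller eigenvalue), let $\mathfrak X_{x_0}:\mathbb R\to\mathbb R^2$ solve $\mathfrak X_{x_0}'(t)=V(\mathfrak X_{x_0}(t))$, $\mathfrak X_{x_0}(0)=x_0$, and let $$\Theta_{x_0}=\{t\in\mathbb R:\langle\nabla f,V\rangle(\mathfrak X_{x_0}(t))=0,\ \lambda_2(\mathfrak X_{x_0}(t))<0\},\qquad \theta_{x_0}=\operatorname{argmin}\{|t|:t\in\Theta_{x_0}\}.$$ For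 a kernel $K$ and bandwidths $h=h_n>0$ let $\hat f(x)=\frac1{nh^2}\sum_{i=1}^nK\big(\frac{x-X_i}h\big)$, and let $\hat V,\hat\lambda_2,\hat{\mathfrak X}_{x_0},\hat\Theta_{x_0}$ be defined as above with $\hat f$ in place of $f$. Let $\hat\theta_{x_0}$ be a minimizer of $|t|$ over $\hat\Theta_{x_0}$ (any one, if there are several), and $\hat\theta_{x_0}=0$ if $\hat\Theta_{x_0}=\emptyset$ (if $\hat\Theta_{x_0}\ne\emptyset$ has no minimizer, $\hat\theta_{x_0}$ is arbitrary). For $a^*>0$ and $\mathcal L\subset\mathbb R^2$ let $\mathcal G=\{\mathfrak X_{x_0}(t):x_0\in\mathcal L,\ |t|\le a^*\}$. With $\nabla V$ the Jacobian matrix of $V$ and $\tilde G(x)=\nabla G(d^2f(x))\in\mathbb R^{2\times3}$, put $$\tilde a'(x)=\nabla f(x)^T\,\nabla V(x)\,V(x)+\lambda_2(x)\|V(x)\|^2,\qquad \hat\varphi_{1n}(x)=\frac{\nabla f(x)^T\,\tilde G(x)\,\big(d^2\hat f(x)-\mathbb E\,d^2\hat f(x)\big)}{\tilde a'(x)},$$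 and, for $x=\mathfrak X_{x_0}(\theta_{x_0})$ and $y=\hat{\mathfrak X}_{x_0}(\theta_{x_0})$, $$\hat\varphi_{2n}(x)=\frac{V(x)^T\,\nabla^2f(x)\,(y-x)+\big\langle(\mathbb E\nabla\hat f-\nabla f)(y),V(x)\big\rangle}{\tilde a'(x)},$$ where $\mathbb E\nabla\hat f$ is the function $z\mapsto\mathbb E[\nabla\hat f(z)]$, evaluated at $y$. **Assumptions.** - (F1) $f$ is four times continuously differentiable, with bounded partial derivatives of orders one to four. - (F2) $\mathcal H\subset\mathbb R^2$ is compact, $f>0$ on the open $\varepsilon_0$-neighbourhood of $\mathcal H$ for some $\varepsilon_0>0$, and $\nabla^2f(x)$ has two distinct eigenvalues for every $x\in\mathcal H$. - (F3) $\mathcal L\subset\mathcal H$ is compact, $a^*>0$, $\mathcal G\subset\mathcal H$, for every $x_0\in\mathcal G$ the minimizer $\theta_{x_0}$ exists and is unique, and $\mathcal L=\{\mathfrak X_{x_0}(\theta_{x_0}):x_0\in\mathcal G\}$. - (F4) There is $\gamma>0$ with $\big\|\frac1{u-s}\int_s^uV(\mathfrak X_{x_0}(r))\,dr\big\|\ge\gamma$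 for all $x_0\in\mathcal L$ and $-a^*\le s<u\le a^*$. - (F5) $\big\langle\nabla\langle\nabla f,V\rangle(x),V(x)\big\rangle\ne0$ for all $x\in\mathcal L$. - (F6) $\lambda_2(x)$ and $\langle\nabla f(x),V(x)\rangle$ do not both vanish at any point $x\in\mathcal H$, nor at any point $x=\mathfrak X_{x_0}(t)$ with $x_0\in\mathcal G$ and $|t|\le|\theta_{x_0}|$. - (K1) $K$ is a four times differentiable probability density with $K(-x)=K(x)$, its support is the closed unit ball, its partial derivatives of orders one to four are bounded, and $\int K(x)xx^T\,dx=\mu_2(K)\,I_{2\times2}$ with $\mu_2(K)<\infty$. - (K2) $\int d^2K(x)\,d^2K(x)^T\,dx$ is finite. - (H1) As $n\to\infty$: $h_n\to0$, $nh_n^8/(\log n)^3\to\infty$, and $nh_n^9\to\beta$ for some $\beta\ge0$. **Lemma.** Under (F1)–(F6), (K1)–(K2) and (H1), $$\sup_{x_0\in\mathcal G}\big|(\hat\theta_{x_0}-\theta_{x_0})+\hat\varphi_{1n}(\mathfrak X_{x_0}(\theta_{x_0}))\big|=O_p\Big(\frac{\log n}{nh^7}\Big).$$ If in addition $\nabla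 f(\mathfrak X_{x_0}(\theta_{x_0}))=0$ for all $x_0\in\mathcal G$, then $$\sup_{x_0\in\mathcal G}\big|(\hat\theta_{x_0}-\theta_{x_0})+\hat\varphi_{2n}(\mathfrak X_{x_0}(\theta_{x_0}))\big|=O_p\Big(\frac{\log n}{nh^{13/2}}\Big).$$ (Suprema need not be measurable; $O_p$ is understood with outer probabilities.) -/

import Mathlib

open MeasureTheory ProbabilityTheory Filter Topology
open scoped ENNReal

noncomputable section

namespace Filament

/-- The plane with its Euclidean norm. -/
abbrev Plane : Type := EuclideanSpace ℝ (Fin 2)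

/-- Three-dimensional Euclidean space, in which the triple of second derivatives lives. -/
abbrev Space3 : Type := EuclideanSpace ℝ (Fin 3)

/-! ### Differential operators and the second eigenpair of the Hessian -/

/-- The partial derivative `∂g/∂xᵢ`. -/
def pderiv (i : Fin 2) (g : Plane → ℝ) (x : Plane) : ℝ :=
  fderiv ℝ g x (EuclideanSpace.single i 1)

/-- The Hessian matrix `∇²g(x)`. -/
def hessian (g : Plane → ℝ) (x : Plane) : Matrix (Fin 2) (Fin 2) ℝ :=
  Matrix.of fun i j => pderiv i (pderiv j g) x

/-- `d²g(x) = (g^{(2,0)}(x), g^{(1,1)}(x), g^{(0,2)}(x))`. -/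
def d2 (g : Plane → ℝ) (x : Plane) : Space3 :=
  !₂[pderiv 0 (pderiv 0 g) x, pderiv 0 (pderiv 1 g) x, pderiv 1 (pderiv 1 g) x]

/-- The map `G(u,v,w)` which selects an eigenvector for the smaller eigenvalue of
`[[u, v], [v, w]]`. -/
def eigvecMap (p : Space3) : Plane :=
  !₂[2 * p 0 - 2 * p 2 + 2 * p 1 - 2 * √((p 2 - p 0) ^ 2 + 4 * p 1 ^ 2),
     p 2 - p 0 + 4 * p 1 - √((p 2 - p 0) ^ 2 + 4 * p 1 ^ 2)]

/-- The map `J(u,v,w)`: the smaller eigenvalue of `[[u, v], [v, w]]`. -/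
def eigvalMap (p : Space3) : ℝ :=
  (p 0 + p 2 - √((p 0 - p 2) ^ 2 + 4 * p 1 ^ 2)) / 2

/-- The vector field `V = G(d²g)`. -/
def eigvec (g : Plane → ℝ) (x : Plane) : Plane := eigvecMap (d2 g x)

/-- The second eigenvalue `λ₂ = J(d²g)`. -/
def eigval (g : Plane → ℝ) (x : Plane) : ℝ := eigvalMap (d2 g x)

/-- `⟨∇g(x), V(x)⟩`. -/
def slope (g : Plane → ℝ) (x : Plane) : ℝ := inner ℝ (gradient g x) (eigvec g x)

/-- `ã'(x) = ∇g(x)ᵀ ∇V(x) V(x) + λ₂(x) ‖V(x)‖²`, where `∇V` is the Jacobian matrix of `V`. -/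
def slopeDeriv (g : Plane → ℝ) (x : Plane) : ℝ :=
  inner ℝ (gradient g x) (fderiv ℝ (eigvec g) x (eigvec g x))
    + eigval g x * ‖eigvec g x‖ ^ 2

/-! ### Integral curves and times at which they meet filament points -/

open Classical in
/-- The solution `γ : ℝ → ℝ²` of `γ' = W(γ)`, `γ(0) = x₀` (the constant `x₀` if there is none).
For the vector fields used below, which are globally Lipschitz, it exists and is unique. -/
def integralCurve (W : Plane → Plane) (x₀ : Plane) : ℝ → Plane :=
  if hex : ∃ γ : ℝ → Plane, γ 0 = x₀ ∧ ∀ t, HasDerivAt γ (W (γ t)) t then hex.choose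
  else fun _ => x₀

/-- The integral curve `𝔛_{x₀}` driven by the second eigenvector field of `∇²g`. -/
def path (g : Plane → ℝ) (x₀ : Plane) : ℝ → Plane := integralCurve (eigvec g) x₀

/-- `Θ_{x₀}`: the times at which the integral curve started in `x₀` is at a filament point. -/
def filamentTimes (g : Plane → ℝ) (x₀ : Plane) : Set ℝ :=
  {t | slope g (path g x₀ t) = 0 ∧ eigval g (path g x₀ t) < 0}

/-- `t` minimizes `|·|` over `S`. -/
def IsArgminAbs (S : Set ℝ) (t : ℝ) : Prop := t ∈ S ∧ ∀ s ∈ S, |t| ≤ |s|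

open Classical in
/-- `θ_{x₀} = argmin {|t| : t ∈ Θ_{x₀}}`. -/
def hitTime (g : Plane → ℝ) (x₀ : Plane) : ℝ :=
  if hex : ∃ t, IsArgminAbs (filamentTimes g x₀) t then hex.choose else 0

/-- `t` is an admissible value of `θ̂_{x₀}`, computed from the density estimate `g`: it is `0` if
there are no filament times, and one of the minimizers of `|·|`, no matter which, whenever there
is a minimizer. -/
def IsHitTime (g : Plane → ℝ) (x₀ : Plane) (t : ℝ) : Prop :=
  (filamentTimes g x₀ = ∅ → t = 0) ∧
    ((∃ s, IsArgminAbs (filamentTimes g x₀) s) → IsArgminAbs (filamentTimes g x₀) t)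

/-- The filament point `𝔛_{x₀}(θ_{x₀})`. -/
def hitPoint (g : Plane → ℝ) (x₀ : Plane) : Plane := path g x₀ (hitTime g x₀)

/-- Admissible values always exist. -/
theorem isHitTime_hitTime (g : Plane → ℝ) (x₀ : Plane) : IsHitTime g x₀ (hitTime g x₀) := by
  constructor
  · intro hS
    have hno : ¬ ∃ t, IsArgminAbs (filamentTimes g x₀) t := by
      rintro ⟨t, ht, -⟩
      rw [hS] at ht
      exact ht
    unfold hitTime
    rw [dif_neg hno]
  · intro hex
    unfold hitTime
    rw [dif_pos hex]
    exact hex.choose_spec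

/-- `𝒢(ℒ, a) = {𝔛_{x₀}(t) : x₀ ∈ ℒ, -a ≤ t ≤ a}`. -/
def startSet (f : Plane → ℝ) (L : Set Plane) (a : ℝ) : Set Plane :=
  {y | ∃ x₀ ∈ L, ∃ t ∈ Set.Icc (-a) a, y = path f x₀ t}

/-! ### The kernel density estimator -/

/-- `f̂(x) = (n h²)⁻¹ ∑_{i < n} K((x - Xᵢ)/h)`. -/
def kde (K : Plane → ℝ) (h : ℝ) (n : ℕ) (X : ℕ → Plane) (x : Plane) : ℝ :=
  ((n : ℝ) * h ^ 2)⁻¹ * ∑ i ∈ Finset.range n, K (h⁻¹ • (x - X i))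

/-- The random density estimate `f̂ₙ`, computed from the first `n` observations with bandwidth
`hₙ`. -/
def fHat {Ω : Type*} (K : Plane → ℝ) (h : ℕ → ℝ) (X : ℕ → Ω → Plane) (n : ℕ) (ω : Ω) :
    Plane → ℝ :=
  kde K (h n) n (fun i => X i ω)

/-- `𝔼 d²f̂ₙ(x)`. -/
def meanD2 {Ω : Type*} [MeasurableSpace Ω] (P : Measure Ω) (K : Plane → ℝ) (h : ℕ → ℝ)
    (X : ℕ → Ω → Plane) (n : ℕ) (x : Plane) : Space3 :=
  ∫ ω, d2 (fHat K h X n ω) x ∂P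

/-- `𝔼 ∇f̂ₙ(x)`, for a deterministic point `x`. -/
def meanGrad {Ω : Type*} [MeasurableSpace Ω] (P : Measure Ω) (K : Plane → ℝ) (h : ℕ → ℝ)
    (X : ℕ → Ω → Plane) (n : ℕ) (x : Plane) : Plane :=
  ∫ ω, gradient (fHat K h X n ω) x ∂P

/-- `φ̂₁ₙ(x) = ã'(x)⁻¹ ∇f(x)ᵀ G̃(x) (d²f̂(x) - 𝔼 d²f̂(x))`, where `G̃(x) = ∇G(d²f(x))` is the
Jacobian matrix of `G` at `d²f(x)`. -/
def phi1 {Ω : Type*} [MeasurableSpace Ω] (P : Measure Ω) (f K : Plane → ℝ) (h : ℕ → ℝ)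
    (X : ℕ → Ω → Plane) (n : ℕ) (ω : Ω) (x : Plane) : ℝ :=
  (slopeDeriv f x)⁻¹ *
    inner ℝ (gradient f x)
      (fderiv ℝ eigvecMap (d2 f x) (d2 (fHat K h X n ω) x - meanD2 P K h X n x))

/-- `φ̂₂ₙ(x) = ã'(x)⁻¹ [V(x)ᵀ ∇²f(x) (y - x) + ⟨(𝔼∇f̂ - ∇f)(y), V(x)⟩]` with
`y = 𝔛̂_{x₀}(θ_{x₀})`. -/
def phi2 {Ω : Type*} [MeasurableSpace Ω] (P : Measure Ω) (f K : Plane → ℝ) (h : ℕ → ℝ)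
    (X : ℕ → Ω → Plane) (n : ℕ) (ω : Ω) (x₀ x : Plane) : ℝ :=
  let y : Plane := path (fHat K h X n ω) x₀ (hitTime f x₀)
  (slopeDeriv f x)⁻¹ *
    ((eigvec f x).ofLp ⬝ᵥ (hessian f x).mulVec (y - x).ofLp
      + inner ℝ (meanGrad P K h X n y - gradient f y) (eigvec f x))

/-! ### Assumptions -/

/-- `f` is a four times continuously differentiable probability density whose partial derivatives
of orders one to four are bounded. -/
structure SmoothDensity (f : Plane → ℝ) : Prop where
  nonneg : ∀ x, 0 ≤ f x
  integrable : Integrable f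
  integral_eq_one : ∫ x, f x = 1
  contDiff : ContDiff ℝ 4 f
  bounded : ∀ k : ℕ, 1 ≤ k → k ≤ 4 → ∃ C : ℝ, ∀ x, ‖iteratedFDeriv ℝ k f x‖ ≤ C

/-- `H` is compact, `f` is positive on an open enlargement of `H`, and `∇²f` has two distinct
eigenvalues at every point of `H`. -/
structure RegularRegion (f : Plane → ℝ) (H : Set Plane) : Prop where
  isCompact : IsCompact H
  pos : ∃ ε₀ : ℝ, 0 < ε₀ ∧ ∀ x ∈ Metric.thickening ε₀ H, 0 < f x
  distinct : ∀ x ∈ H, ∃ μ ν : ℝ, μ ≠ ν ∧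
    Module.End.HasEigenvalue (Matrix.toLin' (hessian f x)) μ ∧
    Module.End.HasEigenvalue (Matrix.toLin' (hessian f x)) ν

/-- `L` is a compact filament in `H`, `𝒢(L, a) ⊆ H`, the time `θ_{x₀}` is well defined (and
unique) for all `x₀ ∈ 𝒢(L, a)`, and `L = {𝔛_{x₀}(θ_{x₀}) : x₀ ∈ 𝒢(L, a)}`. -/
structure IsFilament (f : Plane → ℝ) (H L : Set Plane) (a : ℝ) : Prop where
  pos : 0 < a
  isCompact : IsCompact L
  subset : L ⊆ H
  startSet_subset : startSet f L a ⊆ H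
  existsUnique : ∀ x₀ ∈ startSet f L a, ∃! t, IsArgminAbs (filamentTimes f x₀) t
  eq_hitPoints : L = {y | ∃ x₀ ∈ startSet f L a, y = hitPoint f x₀}

/-- Averages of `V` along the integral curves through `L` are bounded away from zero. -/
def AverageNondegenerate (f : Plane → ℝ) (L : Set Plane) (a : ℝ) : Prop :=
  ∃ γ : ℝ, 0 < γ ∧ ∀ x₀ ∈ L, ∀ s u : ℝ, -a ≤ s → s < u → u ≤ a →
    γ ≤ ‖(u - s)⁻¹ • ∫ r in s..u, eigvec f (path f x₀ r)‖

/-- `⟨∇⟨∇f, V⟩(x), V(x)⟩ ≠ 0` on `L`. -/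
def Transversal (f : Plane → ℝ) (L : Set Plane) : Prop :=
  ∀ x ∈ L, inner ℝ (gradient (slope f) x) (eigvec f x) ≠ 0

/-- `λ₂` and `⟨∇f, V⟩` have no common zero in `S`. -/
def NoDegenerate (f : Plane → ℝ) (S : Set Plane) : Prop :=
  {x ∈ S | eigval f x = 0 ∧ slope f x = 0} = ∅

/-- The points which the integral curves started in `𝒢(L, a)` visit, in either direction of time,
not later than they reach `L`: `{𝔛_{x₀}(t) : x₀ ∈ 𝒢(L, a), |t| ≤ |θ_{x₀}|}`. -/
def searchedSet (f : Plane → ℝ) (L : Set Plane) (a : ℝ) : Set Plane :=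
  {y | ∃ x₀ ∈ startSet f L a, ∃ t : ℝ, |t| ≤ |hitTime f x₀| ∧ y = path f x₀ t}

/-- `K` is a symmetric, four times differentiable probability density, its support is the unit
ball, its partial derivatives of orders one to four are bounded, and `∫ K(x) x xᵀ dx` is a
multiple of the identity matrix. -/
structure IsKernel (K : Plane → ℝ) : Prop where
  nonneg : ∀ x, 0 ≤ K x
  integrable : Integrable K
  integral_eq_one : ∫ x, K x = 1
  symm : ∀ x, K (-x) = K x
  support_eq : tsupport K = Metric.closedBall 0 1
  contDiff : ContDiff ℝ 3 K
  differentiable : Differentiable ℝ (iteratedFDeriv ℝ 3 K)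
  bounded : ∀ k : ℕ, 1 ≤ k → k ≤ 4 → ∃ C : ℝ, ∀ x, ‖iteratedFDeriv ℝ k K x‖ ≤ C
  moments : ∃ m : ℝ, ∀ i j : Fin 2,
    Integrable (fun x : Plane => K x * (x i * x j)) ∧
      ∫ x : Plane, K x * (x i * x j) = if i = j then m else 0

/-- The matrix `∫ d²K(x) d²K(x)ᵀ dx` is finite. -/
def FiniteRoughness (K : Plane → ℝ) : Prop :=
  ∀ i j : Fin 3, Integrable (fun x : Plane => d2 K x i * d2 K x j)

/-- `hₙ > 0`, `hₙ → 0`, `n hₙ⁸ / (log n)³ → ∞` and `n hₙ⁹ → β` for some `β ≥ 0`. -/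
structure IsBandwidth (h : ℕ → ℝ) : Prop where
  pos : ∀ n, 0 < h n
  tendsto_zero : Tendsto h atTop (𝓝 0)
  tendsto_atTop : Tendsto (fun n : ℕ => (n : ℝ) * h n ^ 8 / Real.log n ^ 3) atTop atTop
  tendsto_beta : ∃ β : ℝ, 0 ≤ β ∧ Tendsto (fun n : ℕ => (n : ℝ) * h n ^ 9) atTop (𝓝 β)

/-- `X₀, X₁, …` are independent random points of the plane with density `f`. -/
structure IsSample {Ω : Type*} [MeasurableSpace Ω] (P : Measure Ω) (f : Plane → ℝ)
    (X : ℕ → Ω → Plane) : Prop where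
  measurable : ∀ i, Measurable (X i)
  indep : iIndepFun X P
  law : ∀ i, P.map (X i) = volume.withDensity (fun x => ENNReal.ofReal (f x))

/-- `Zₙ = O_p(rₙ)`. The variables need not be measurable; probabilities are outer ones. -/
def IsBigOp {Ω : Type*} [MeasurableSpace Ω] (P : Measure Ω) (Z : ℕ → Ω → ℝ≥0∞) (r : ℕ → ℝ) :
    Prop :=
  ∀ ε : ℝ, 0 < ε → ∃ M : ℝ, 0 < M ∧ ∀ᶠ n in atTop,
    P {ω | ENNReal.ofReal (M * r n) < Z n ω} ≤ ENNReal.ofReal ε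

end Filament

end

noncomputable section

namespace Filament

/-! ### The maps `G` and `J` -/

/-! Along the curve through x₀ the slope s(t) = ⟨∇f, V⟩(𝔛(t)) has derivative ã'(𝔛(t)), because ∇²f V
= λ₂V, and θ is a simple zero of s by transversality. The result is thus an implicit function
argument in one real variable. If ŝ is the slope of the estimate along its own curve, the mean value
theorem between θ and θ̂ gives θ̂ − θ = −ŝ(θ)/D, where D is a value of the derivative of ŝ near θ
and is close to ã'(x), x = 𝔛(θ). It remains to localize θ̂, to expand ŝ(θ), and to bound D − ã'(x).

Localization: a first transversal zero with λ₂ < 0 survives small perturbations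
(`exists_argmin_of_perturbation`), and compactness makes this uniform in the starting point
(`Setup.consistency`).

Expansion: let e₁, e₂, e₃ be the errors of the first three derivatives of the estimate. In D − ã'(x)
the error e₃ occurs only multiplied by ‖∇f(x)‖ (`abs_slopeDeriv_sub_le`). The displacement of the
curve at time θ is bounded by Grönwall's inequality in a form where the error of the field enters
through its integral along the true curve (`norm_sub_le_of_integral_field_sub`, `Setup.path_error`).
Together with the Taylor expansion of G at points with positive eigenvalue gap, this gives
`Setup.hitTime_expansion`, and `Setup.hitTime_expansion_critical` at critical points.

Probability: Bernstein's inequality on a net of polynomial size (`tendsto_measure_exists_empDev`)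
shows that derivatives of order k fluctuate by √(log n / (n h^(2+2k))). Integration along a curve
improves h⁶ to h⁵ for second derivatives: the averages of V are nondegenerate, so a curve spends
time O(h) in a ball of radius h (`abs_pathKernel_le`, `tendsto_measure_pathIntegral`).

Rates: put A = √(log n / (n h⁸)) and c = √h. Since n h⁹ is bounded, c = O(A). The remainder of the
first expansion is of order e₂e₃ ~ A²c² = log n / (n h⁷); the bias c⁴ and the curve error Ac³ are
absorbed. At critical points e₃ disappears, and all terms are O(A²c³) = O(log n / (n h^(13/2))), the
fluctuation Ac⁴ of the gradient included. -/

/-- The linear map whose norm is the gap between the two eigenvalues. -/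
def gapMap : Space3 →L[ℝ] Plane :=
  LinearMap.toContinuousLinearMap
    { toFun := fun p => !₂[p 2 - p 0, 2 * p 1]
      map_add' := by intro p q; ext i; fin_cases i <;> simp <;> ring
      map_smul' := by intro c p; ext i; fin_cases i <;> simp <;> ring }

/-- The linear part of `G`. -/
def linPart : Space3 →L[ℝ] Plane :=
  LinearMap.toContinuousLinearMap
    { toFun := fun p => !₂[2 * p 0 - 2 * p 2 + 2 * p 1, p 2 - p 0 + 4 * p 1]
      map_add' := by intro p q; ext i; fin_cases i <;> simp <;> ring
      map_smul' := by intro c p; ext i; fin_cases i <;> simp <;> ring }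

/-- The direction along which the eigenvalue gap enters `G`. -/
def dirVec : Plane := !₂[2, 1]

lemma gapMap_apply (p : Space3) : gapMap p = !₂[p 2 - p 0, 2 * p 1] := rfl

lemma linPart_apply (p : Space3) :
    linPart p = !₂[2 * p 0 - 2 * p 2 + 2 * p 1, p 2 - p 0 + 4 * p 1] := rfl

lemma norm_sq_plane (v : Plane) : ‖v‖ ^ 2 = v 0 ^ 2 + v 1 ^ 2 := by
  rw [EuclideanSpace.norm_sq_eq]; simp [Fin.sum_univ_two]

lemma norm_sq_space3 (v : Space3) : ‖v‖ ^ 2 = v 0 ^ 2 + v 1 ^ 2 + v 2 ^ 2 := by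
  rw [EuclideanSpace.norm_sq_eq]; simp [Fin.sum_univ_three]

lemma inner_plane (v w : Plane) : inner ℝ v w = v 0 * w 0 + v 1 * w 1 := by
  simp [PiLp.inner_apply, Fin.sum_univ_two, mul_comm]

lemma norm_gapMap (p : Space3) : ‖gapMap p‖ = √((p 2 - p 0) ^ 2 + 4 * p 1 ^ 2) := by
  symm
  rw [Real.sqrt_eq_iff_mul_self_eq (by positivity) (norm_nonneg _), ← pow_two, norm_sq_plane,
    gapMap_apply]
  simp; ring

/-- The only nonlinearity of G is the norm of a linear image, times a fixed vector. Lipschitz and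
Taylor bounds for G therefore reduce to those of the Euclidean norm, and G is differentiable
wherever the eigenvalue gap is nonzero. -/
lemma eigvecMap_eq (p : Space3) : eigvecMap p = linPart p - ‖gapMap p‖ • dirVec := by
  rw [norm_gapMap]
  ext i; fin_cases i <;> simp [eigvecMap, linPart_apply, dirVec] <;> ring

lemma eigvalMap_eq (p : Space3) : eigvalMap p = (p 0 + p 2 - ‖gapMap p‖) / 2 := by
  rw [norm_gapMap, eigvalMap]
  congr 3; ring

lemma norm_gapMap_le (p : Space3) : ‖gapMap p‖ ≤ 2 * ‖p‖ := by
  apply le_of_sq_le_sq _ (by positivity)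
  rw [mul_pow, norm_sq_plane, norm_sq_space3, gapMap_apply]
  simp
  nlinarith [sq_nonneg (p 2 + p 0), sq_nonneg (p 2), sq_nonneg (p 0)]

lemma norm_linPart_le (p : Space3) : ‖linPart p‖ ≤ 6 * ‖p‖ := by
  apply le_of_sq_le_sq _ (by positivity)
  rw [mul_pow, norm_sq_plane, norm_sq_space3, linPart_apply]
  simp
  nlinarith [sq_nonneg (p 0 + p 2), sq_nonneg (p 0 - p 1), sq_nonneg (p 2 + p 1),
    sq_nonneg (p 0 + p 1), sq_nonneg (p 2 - p 1), sq_nonneg (p 0), sq_nonneg (p 1),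
    sq_nonneg (p 2)]

lemma norm_dirVec_le : ‖dirVec‖ ≤ 3 := by
  apply le_of_sq_le_sq _ (by positivity)
  rw [norm_sq_plane, dirVec]; simp; norm_num

/-- No gap is needed, since the norm is 1-Lipschitz. The constant is 6 from the linear part plus 2 ·
3 from the gap times the length of `dirVec`. -/
lemma norm_eigvecMap_sub_le (p q : Space3) : ‖eigvecMap p - eigvecMap q‖ ≤ 12 * ‖p - q‖ := by
  have h1 : eigvecMap p - eigvecMap q
      = linPart (p - q) - (‖gapMap p‖ - ‖gapMap q‖) • dirVec := by
    rw [eigvecMap_eq, eigvecMap_eq, map_sub, sub_smul]; abel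
  have h2 : |‖gapMap p‖ - ‖gapMap q‖| ≤ 2 * ‖p - q‖ := by
    refine (abs_norm_sub_norm_le _ _).trans ?_
    rw [← map_sub]; exact norm_gapMap_le _
  rw [h1]
  refine (norm_sub_le _ _).trans ?_
  rw [norm_smul, Real.norm_eq_abs]
  have := norm_linPart_le (p - q)
  nlinarith [norm_dirVec_le, norm_nonneg dirVec, abs_nonneg (‖gapMap p‖ - ‖gapMap q‖),
    norm_nonneg (p - q)]

lemma norm_eigvecMap_le (p : Space3) : ‖eigvecMap p‖ ≤ 12 * ‖p‖ := by
  have h0 : eigvecMap 0 = 0 := by rw [eigvecMap_eq]; simp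
  simpa [h0] using norm_eigvecMap_sub_le p 0

lemma abs_apply_le_norm (v : Space3) (i : Fin 3) : |v i| ≤ ‖v‖ := by
  simpa using PiLp.norm_apply_le v i

lemma abs_apply_le_norm_plane (v : Plane) (i : Fin 2) : |v i| ≤ ‖v‖ := by
  simpa using PiLp.norm_apply_le v i

lemma abs_eigvalMap_sub_le (p q : Space3) : |eigvalMap p - eigvalMap q| ≤ 2 * ‖p - q‖ := by
  have h2 : |‖gapMap p‖ - ‖gapMap q‖| ≤ 2 * ‖p - q‖ := by
    refine (abs_norm_sub_norm_le _ _).trans ?_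
    rw [← map_sub]; exact norm_gapMap_le _
  have h3 := abs_apply_le_norm (p - q) 0
  have h4 := abs_apply_le_norm (p - q) 2
  simp only [PiLp.sub_apply] at h3 h4
  rw [eigvalMap_eq, eigvalMap_eq]
  rw [abs_le] at *
  constructor <;> linarith

lemma abs_eigvalMap_le (p : Space3) : |eigvalMap p| ≤ 2 * ‖p‖ := by
  have h0 : eigvalMap 0 = 0 := by rw [eigvalMap_eq]; simp
  simpa [h0] using abs_eigvalMap_sub_le p 0

lemma continuous_eigvecMap : Continuous eigvecMap := by
  have : eigvecMap = fun p => linPart p - ‖gapMap p‖ • dirVec := funext eigvecMap_eq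
  rw [this]; fun_prop

lemma continuous_eigvalMap : Continuous eigvalMap := by
  have : eigvalMap = fun p => (p 0 + p 2 - ‖gapMap p‖) / 2 := funext eigvalMap_eq
  rw [this]; fun_prop

/-- The derivative of `G` at a point with positive eigenvalue gap. -/
def eigvecDeriv (p : Space3) : Space3 →L[ℝ] Plane :=
  linPart - (‖gapMap p‖⁻¹ • (innerSL ℝ (gapMap p)).comp gapMap).smulRight dirVec

lemma eigvecDeriv_apply (p q : Space3) : eigvecDeriv p q
    = linPart q - (‖gapMap p‖⁻¹ * inner ℝ (gapMap p) (gapMap q)) • dirVec := by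
  simp [eigvecDeriv]

lemma hasFDerivAt_norm_of_ne {v : Plane} (hv : v ≠ 0) :
    HasFDerivAt (fun w : Plane => ‖w‖) (‖v‖⁻¹ • innerSL ℝ v) v := by
  have h := (hasStrictFDerivAt_norm_sq v).hasFDerivAt.sqrt (by positivity)
  have h2 : (fun w : Plane => √(‖w‖ ^ 2)) = fun w => ‖w‖ := by
    funext w; exact Real.sqrt_sq (norm_nonneg _)
  rw [h2] at h
  refine h.congr_fderiv ?_
  rw [Real.sqrt_sq (norm_nonneg _)]
  ext w
  simp
  have : ‖v‖ ≠ 0 := norm_ne_zero_iff.mpr hv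
  field_simp

lemma hasFDerivAt_eigvecMap {p : Space3} (hp : gapMap p ≠ 0) :
    HasFDerivAt eigvecMap (eigvecDeriv p) p := by
  have h1 : HasFDerivAt (fun p => ‖gapMap p‖)
      (‖gapMap p‖⁻¹ • (innerSL ℝ (gapMap p)).comp gapMap) p := by
    exact ((hasFDerivAt_norm_of_ne hp).comp p gapMap.hasFDerivAt).congr_fderiv (by ext; simp)
  have h2 : eigvecMap = fun p => linPart p - ‖gapMap p‖ • dirVec := funext eigvecMap_eq
  rw [h2]
  exact linPart.hasFDerivAt.sub (h1.smul_const dirVec)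

/-- Cauchy–Schwarz cancels the inverse of the gap, so the bound is uniform in p. It includes zero
gap, where the inverse is 0. -/
lemma norm_eigvecDeriv_apply_le (p q : Space3) : ‖eigvecDeriv p q‖ ≤ 12 * ‖q‖ := by
  rw [eigvecDeriv_apply]
  refine (norm_sub_le _ _).trans ?_
  rw [norm_smul, Real.norm_eq_abs]
  have h1 : |‖gapMap p‖⁻¹ * inner ℝ (gapMap p) (gapMap q)| ≤ ‖gapMap q‖ := by
    rw [abs_mul, abs_inv, abs_norm]
    rcases eq_or_ne (gapMap p) 0 with h0 | h0
    · simp [h0]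
    · rw [inv_mul_le_iff₀ (norm_pos_iff.mpr h0)]
      exact abs_real_inner_le_norm _ _
  have := norm_linPart_le q
  have h2 := norm_gapMap_le q
  nlinarith [norm_dirVec_le, norm_nonneg dirVec, norm_nonneg (gapMap q), norm_nonneg q,
    abs_nonneg (‖gapMap p‖⁻¹ * inner ℝ (gapMap p) (gapMap q))]

/-- With t = ‖v + w‖, expanding t² shows that the Taylor remainder is exactly (‖w‖² − (t − ‖v‖)²) /
(2‖v‖), and |t − ‖v‖| ≤ ‖w‖. Hence w need not be small. -/
lemma abs_norm_add_sub_le {v : Plane} (hv : v ≠ 0) (w : Plane) :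
    |‖v + w‖ - ‖v‖ - ‖v‖⁻¹ * inner ℝ v w| ≤ 2 * ‖w‖ ^ 2 / ‖v‖ := by
  have hv' : 0 < ‖v‖ := norm_pos_iff.mpr hv
  set t := ‖v + w‖ with ht
  have ht0 : 0 ≤ t := norm_nonneg _
  have h1 : t ^ 2 = ‖v‖ ^ 2 + 2 * inner ℝ v w + ‖w‖ ^ 2 := norm_add_sq_real v w
  have h2 : |t - ‖v‖| ≤ ‖w‖ := by
    have := abs_norm_sub_norm_le (v + w) v
    simpa using this
  have h3 : |t - ‖v‖ - ‖v‖⁻¹ * inner ℝ v w|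
      = |(‖w‖ ^ 2 - (t - ‖v‖) ^ 2)| / (2 * ‖v‖) := by
    rw [eq_div_iff (by positivity), ← abs_of_pos (show 0 < 2 * ‖v‖ by positivity), ← abs_mul]
    congr 1
    field_simp
    linarith
  rw [h3, div_le_div_iff₀ (by positivity) hv']
  have h4 : (t - ‖v‖) ^ 2 ≤ ‖w‖ ^ 2 := sq_le_sq.mpr (by rwa [abs_norm])
  have h5 : |‖w‖ ^ 2 - (t - ‖v‖) ^ 2| ≤ ‖w‖ ^ 2 := by
    rw [abs_le]; constructor <;> nlinarith [sq_nonneg (t - ‖v‖), sq_nonneg ‖w‖]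
  nlinarith [sq_nonneg ‖w‖]

/-- Only the gap at the base point p matters: the segment to p + q may cross points with zero gap.
So p can be the Hessian of f and p + q that of the estimate. -/
lemma norm_eigvecMap_add_sub_le {p : Space3} (hp : gapMap p ≠ 0) (q : Space3) :
    ‖eigvecMap (p + q) - eigvecMap p - eigvecDeriv p q‖ ≤ 24 * ‖q‖ ^ 2 / ‖gapMap p‖ := by
  have h1 : eigvecMap (p + q) - eigvecMap p - eigvecDeriv p q
      = -((‖gapMap p + gapMap q‖ - ‖gapMap p‖
          - ‖gapMap p‖⁻¹ * inner ℝ (gapMap p) (gapMap q)) • dirVec) := by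
    rw [eigvecMap_eq, eigvecMap_eq, eigvecDeriv_apply, map_add, map_add]
    module
  rw [h1, norm_neg, norm_smul, Real.norm_eq_abs]
  have h2 := abs_norm_add_sub_le hp (gapMap q)
  have h3 : 2 * ‖gapMap q‖ ^ 2 / ‖gapMap p‖ ≤ 8 * ‖q‖ ^ 2 / ‖gapMap p‖ := by
    gcongr ?_ / _
    nlinarith [norm_gapMap_le q, norm_nonneg (gapMap q), norm_nonneg q]
  have h4 : 0 ≤ 8 * ‖q‖ ^ 2 / ‖gapMap p‖ := by positivity
  calc _ ≤ (8 * ‖q‖ ^ 2 / ‖gapMap p‖) * 3 :=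
        mul_le_mul (h2.trans h3) norm_dirVec_le (norm_nonneg _) h4
    _ = _ := by ring

lemma norm_normalize_sub_le {v w : Plane} (hv : v ≠ 0) (hw : w ≠ 0) :
    ‖‖v‖⁻¹ • v - ‖w‖⁻¹ • w‖ ≤ 2 * ‖v - w‖ / ‖v‖ := by
  have hv' : 0 < ‖v‖ := norm_pos_iff.mpr hv
  have hw' : 0 < ‖w‖ := norm_pos_iff.mpr hw
  have h1 : ‖v‖⁻¹ • v - ‖w‖⁻¹ • w
      = ‖v‖⁻¹ • (v - w) + (‖v‖⁻¹ * (‖w‖ - ‖v‖) * ‖w‖⁻¹) • w := by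
    rw [smul_sub]
    have : ‖v‖⁻¹ * (‖w‖ - ‖v‖) * ‖w‖⁻¹ = ‖v‖⁻¹ - ‖w‖⁻¹ := by field_simp
    rw [this]; module
  rw [h1]
  refine (norm_add_le _ _).trans ?_
  have h2 : |‖w‖ - ‖v‖| ≤ ‖v - w‖ := by
    rw [abs_sub_comm]; exact abs_norm_sub_norm_le v w
  rw [norm_smul, norm_smul, norm_mul, norm_mul, norm_inv, norm_inv, norm_norm, norm_norm,
    Real.norm_eq_abs]
  have h3 : ‖v‖⁻¹ * |‖w‖ - ‖v‖| * ‖w‖⁻¹ * ‖w‖ = ‖v‖⁻¹ * |‖w‖ - ‖v‖| := by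
    field_simp
  rw [h3, div_eq_inv_mul]
  have h4 : ‖v‖⁻¹ * |‖w‖ - ‖v‖| ≤ ‖v‖⁻¹ * ‖v - w‖ := by gcongr
  linarith

/-- The linear part cancels, and what remains is the difference of the unit vectors along the two
gaps. A quantitative lower bound is needed at p alone; at p' the gap only has to be nonzero. -/
lemma norm_eigvecDeriv_sub_le {p p' : Space3} (hp : gapMap p ≠ 0) (hp' : gapMap p' ≠ 0) :
    ‖eigvecDeriv p - eigvecDeriv p'‖ ≤ 24 * ‖p - p'‖ / ‖gapMap p‖ := by
  refine ContinuousLinearMap.opNorm_le_bound _ (by positivity) fun q => ?_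
  have h1 : (eigvecDeriv p - eigvecDeriv p') q
      = -(inner ℝ (‖gapMap p‖⁻¹ • gapMap p - ‖gapMap p'‖⁻¹ • gapMap p') (gapMap q)) • dirVec := by
    rw [sub_apply, eigvecDeriv_apply, eigvecDeriv_apply, inner_sub_left,
      real_inner_smul_left, real_inner_smul_left]
    module
  rw [h1, norm_smul, norm_neg, Real.norm_eq_abs]
  have h2 : |inner ℝ (‖gapMap p‖⁻¹ • gapMap p - ‖gapMap p'‖⁻¹ • gapMap p') (gapMap q)|
      ≤ (4 * ‖p - p'‖ / ‖gapMap p‖) * (2 * ‖q‖) := by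
    refine (abs_real_inner_le_norm _ _).trans ?_
    refine mul_le_mul ((norm_normalize_sub_le hp hp').trans ?_) (norm_gapMap_le q)
      (norm_nonneg _) (by positivity)
    rw [← map_sub]
    gcongr ?_ / _
    linarith [norm_gapMap_le (p - p')]
  calc _ ≤ (4 * ‖p - p'‖ / ‖gapMap p‖) * (2 * ‖q‖) * 3 :=
        mul_le_mul h2 norm_dirVec_le (norm_nonneg _) (by positivity)
    _ = _ := by ring

/-- `G` selects an eigenvector for the eigenvalue `J`. -/
lemma eigvecMap_eigen (p : Space3) :
    p 0 * eigvecMap p 0 + p 1 * eigvecMap p 1 = eigvalMap p * eigvecMap p 0 ∧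
    p 1 * eigvecMap p 0 + p 2 * eigvecMap p 1 = eigvalMap p * eigvecMap p 1 := by
  have hs : √((p 2 - p 0) ^ 2 + 4 * p 1 ^ 2) ^ 2 = (p 2 - p 0) ^ 2 + 4 * p 1 ^ 2 :=
    Real.sq_sqrt (by positivity)
  rw [eigvalMap_eq, norm_gapMap]
  simp only [eigvecMap]
  set s := √((p 2 - p 0) ^ 2 + 4 * p 1 ^ 2)
  simp
  constructor
  · linear_combination (-1) * hs
  · linear_combination (-1/2) * hs

/-! ### Integral curves of bounded Lipschitz fields -/

section ODE

variable {E : Type*} [NormedAddCommGroup E] [NormedSpace ℝ E]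

/-- A bounded Lipschitz vector field is complete. -/
lemma exists_hasDerivAt_of_bounded_lipschitz [CompleteSpace E] {W : E → E} {K : NNReal}
    (hW : LipschitzWith K W) {C : ℝ} (hC : ∀ x, ‖W x‖ ≤ C) (x₀ : E) :
    ∃ γ : ℝ → E, γ 0 = x₀ ∧ ∀ t, HasDerivAt γ (W (γ t)) t := by
  have hC0 : 0 ≤ C := (norm_nonneg _).trans (hC x₀)
  have key : ∀ N : ℕ, ∃ α : ℝ → E, α 0 = x₀ ∧
      ∀ t ∈ Set.Ioo (-((N : ℝ) + 1)) ((N : ℝ) + 1), HasDerivAt α (W (α t)) t := by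
    intro N
    have hN : (0 : ℝ) < (N : ℝ) + 1 := by positivity
    have hmem : (0 : ℝ) ∈ Set.Icc (-((N : ℝ) + 1)) ((N : ℝ) + 1) := ⟨by linarith, hN.le⟩
    -- At speed at most C the ball of radius C(N + 1) is not left before time N + 1, so
    -- Picard–Lindelöf applies to the whole interval at once.
    have hPL : IsPicardLindelof (fun _ : ℝ => W) (⟨0, hmem⟩ : Set.Icc (-((N : ℝ) + 1)) ((N : ℝ) + 1))
        x₀ (C * (N + 1)).toNNReal 0 C.toNNReal K :=
      { lipschitzOnWith := fun t _ => hW.lipschitzOnWith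
        continuousOn := fun x _ => continuousOn_const
        norm_le := fun t _ x _ => by rw [Real.coe_toNNReal _ hC0]; exact hC x
        mul_max_le := by
          rw [Real.coe_toNNReal _ hC0, Real.coe_toNNReal _ (by positivity)]
          simp }
    obtain ⟨α, h0, hα⟩ := hPL.exists_eq_forall_mem_Icc_hasDerivWithinAt (x := x₀) (by simp)
    exact ⟨α, h0, fun t ht => (hα t (Set.Ioo_subset_Icc_self ht)).hasDerivAt
      (Icc_mem_nhds ht.1 ht.2)⟩
  choose α h0 hα using key
  have hcons : ∀ (M N : ℕ) (t : ℝ), M ≤ N → |t| < (M : ℝ) + 1 → α M t = α N t := by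
    intro M N t hMN ht
    have hMN' : (M : ℝ) ≤ N := by exact_mod_cast hMN
    have hM : (0 : ℝ) < (M : ℝ) + 1 := by positivity
    exact ODE_solution_unique_of_mem_Ioo (v := fun _ => W) (s := fun _ => Set.univ) (K := K)
      (a := -((M : ℝ) + 1)) (b := (M : ℝ) + 1) (t₀ := 0)
      (fun _ _ => hW.lipschitzOnWith) ⟨by linarith, hM⟩
      (fun s hs => ⟨hα M s hs, trivial⟩)
      (fun s hs => ⟨hα N s ⟨by linarith [hs.1], by linarith [hs.2]⟩, trivial⟩)
      ((h0 M).trans (h0 N).symm) (abs_lt.mp ht)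
  have hcons' : ∀ (M N : ℕ) (t : ℝ), |t| < (M : ℝ) + 1 → |t| < (N : ℝ) + 1 →
      α M t = α N t := by
    intro M N t hM hN
    rcases le_total M N with h | h
    · exact hcons M N t h hM
    · exact (hcons N M t h hN).symm
  have hceil : ∀ t : ℝ, |t| < (⌈|t|⌉₊ : ℝ) + 1 := fun t => by
    linarith [Nat.le_ceil |t|]
  -- The local solutions are glued: time t uses the window of half-length ⌈|t|⌉ + 1, which exceeds
  -- |t| strictly, so the glued curve agrees with one solution near t.
  refine ⟨fun t => α ⌈|t|⌉₊ t, h0 _, fun t => ?_⟩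
  have heq : (fun s => α ⌈|s|⌉₊ s) =ᶠ[𝓝 t] α ⌈|t|⌉₊ := by
    have hopen : {s : ℝ | |s| < (⌈|t|⌉₊ : ℝ) + 1} ∈ 𝓝 t :=
      (isOpen_lt continuous_abs continuous_const).mem_nhds (hceil t)
    filter_upwards [hopen] with s hs
    exact hcons' _ _ s (hceil s) hs
  exact (hα _ t (abs_lt.mp (hceil t))).congr_of_eventuallyEq heq

/-- Rescaling time by τ lets forward estimates on [0, 1] treat positive and negative τ alike. -/
lemma hasDerivAt_comp_mul {γ : ℝ → E} {W : E → E} (hγ : ∀ t, HasDerivAt γ (W (γ t)) t)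
    (τ s : ℝ) : HasDerivAt (fun s => γ (s * τ)) (τ • W (γ (s * τ))) s := by
  have h1 : HasDerivAt (fun s : ℝ => s * τ) τ s := by simpa using (hasDerivAt_id s).mul_const τ
  exact (hγ (s * τ)).scomp s h1

/-- An integral curve moves at most at the speed which the field has on a large ball. -/
lemma norm_sub_le_of_norm_field_lt {γ : ℝ → E} {W : E → E}
    (hγ : ∀ t, HasDerivAt γ (W (γ t)) t) {C τ : ℝ} (hC0 : 0 ≤ C)
    (hC : ∀ x ∈ Metric.closedBall (γ 0) (C * |τ|), ‖W x‖ < C) :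
    ‖γ τ - γ 0‖ ≤ C * |τ| := by
  rcases eq_or_ne τ 0 with rfl | hτ
  · simp
  have hτ' : 0 < |τ| := abs_pos.mpr hτ
  have hd : ∀ s, HasDerivAt (fun s => γ (s * τ) - γ 0) (τ • W (γ (s * τ))) s := fun s =>
    (hasDerivAt_comp_mul hγ τ s).sub_const _
  -- Barrier argument: the strict speed bound is used only when the displacement equals C|τ|s, and
  -- such points lie in the ball where the bound is assumed.
  have h := image_norm_le_of_norm_deriv_right_lt_deriv_boundary (a := 0) (b := 1)
    (f := fun s => γ (s * τ) - γ 0) (f' := fun s => τ • W (γ (s * τ)))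
    (fun s _ => (hd s).continuousAt.continuousWithinAt)
    (fun s _ => (hd s).hasDerivWithinAt)
    (B := fun s => C * |τ| * s) (B' := fun _ => C * |τ|) (by simp)
    (fun s => by simpa using (hasDerivAt_id s).const_mul (C * |τ|))
    (fun s hs hs' => by
      rw [norm_smul, Real.norm_eq_abs, mul_comm]
      refine mul_lt_mul_of_pos_right (hC _ ?_) hτ'
      rw [Metric.mem_closedBall, dist_eq_norm]
      rw [hs']
      exact mul_le_of_le_one_right (by positivity) hs.2.le)
  simpa using h (x := 1) (by simp)

/-- Grönwall's inequality for integral curves of two fields, in terms of the integrated difference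
of the fields along one of the curves. -/
lemma norm_sub_le_of_integral_field_sub {γ γ' : ℝ → E} {W W' : E → E}
    (hγ : ∀ t, HasDerivAt γ (W (γ t)) t) (hγ' : ∀ t, HasDerivAt γ' (W' (γ' t)) t)
    (hW : Continuous W) (hW' : Continuous W') [CompleteSpace E]
    {K τ d m : ℝ} (hK : 0 < K) (hd : ‖γ' 0 - γ 0‖ ≤ d)
    (hLip : ∀ s ∈ Set.Icc (0 : ℝ) 1, ‖W' (γ' (s * τ)) - W' (γ (s * τ))‖
      ≤ K * ‖γ' (s * τ) - γ (s * τ)‖)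
    (hm : ∀ s ∈ Set.Icc (0 : ℝ) 1, ‖∫ r in (0 : ℝ)..(s * τ), (W' (γ r) - W (γ r))‖ ≤ m) :
    ‖γ' τ - γ τ‖ ≤ (d + m) * Real.exp (K * |τ|) := by
  have hm0 : 0 ≤ m := (norm_nonneg _).trans (hm 0 (by simp))
  rcases eq_or_ne τ 0 with rfl | hτ
  · simpa using hd.trans (by linarith)
  have hτ' : 0 < |τ| := abs_pos.mpr hτ
  have hKτ : 0 < K * |τ| := by positivity
  have hcγ : Continuous γ := continuous_iff_continuousAt.mpr fun t => (hγ t).continuousAt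
  have hcw : Continuous fun r => W' (γ r) - W (γ r) := by fun_prop
  set I : ℝ → E := fun t => ∫ r in (0 : ℝ)..t, (W' (γ r) - W (γ r)) with hI
  have hId : ∀ t, HasDerivAt I (W' (γ t) - W (γ t)) t := fun t =>
    hcw.integral_hasStrictDerivAt 0 t |>.hasDerivAt
  -- Subtracting I leaves a curve with derivative W'(γ') − W'(γ). The Lipschitz bound controls it by
  -- ‖D‖ + m, so W' − W enters through its integral and not through its size.
  set D : ℝ → E := fun t => γ' t - γ t - I t with hD
  have hDd : ∀ t, HasDerivAt D (W' (γ' t) - W' (γ t)) t := fun t => by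
    have := ((hγ' t).sub (hγ t)).sub (hId t)
    refine this.congr_deriv ?_
    abel
  have hDs : ∀ s, HasDerivAt (fun s => D (s * τ))
      (τ • (W' (γ' (s * τ)) - W' (γ (s * τ)))) s := by
    intro s
    have h1 : HasDerivAt (fun s : ℝ => s * τ) τ s := by simpa using (hasDerivAt_id s).mul_const τ
    exact (hDd (s * τ)).scomp s h1
  have hI0 : I 0 = 0 := by simp [hI]
  have hg := norm_le_gronwallBound_of_norm_deriv_right_le (f := fun s => D (s * τ))
    (f' := fun s => τ • (W' (γ' (s * τ)) - W' (γ (s * τ))))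
    (a := 0) (b := 1) (δ := d) (K := K * |τ|) (ε := K * |τ| * m)
    (fun s _ => (hDs s).continuousAt.continuousWithinAt)
    (fun s _ => (hDs s).hasDerivWithinAt)
    (by simpa [hD, hI0] using hd)
    (fun s hs => by
      have hs' : s ∈ Set.Icc (0 : ℝ) 1 := Set.Ico_subset_Icc_self hs
      rw [norm_smul, Real.norm_eq_abs]
      have h1 : ‖γ' (s * τ) - γ (s * τ)‖ ≤ ‖D (s * τ)‖ + m := by
        have : γ' (s * τ) - γ (s * τ) = D (s * τ) + I (s * τ) := by simp [hD]
        rw [this]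
        exact (norm_add_le _ _).trans (add_le_add_right (hm s hs') _)
      calc |τ| * ‖W' (γ' (s * τ)) - W' (γ (s * τ))‖
          ≤ |τ| * (K * (‖D (s * τ)‖ + m)) := by
            gcongr
            exact (hLip s hs').trans (by gcongr)
        _ = _ := by ring) 1 (by simp)
  rw [gronwallBound_of_K_ne_0 hKτ.ne'] at hg
  simp only [sub_zero, mul_one, one_mul] at hg
  have h2 : K * |τ| * m / (K * |τ|) = m := by field_simp
  rw [h2] at hg
  have h3 : γ' τ - γ τ = D τ + I τ := by simp [hD]
  have h4 := hm 1 (by simp)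
  rw [one_mul] at h4
  rw [h3]
  calc _ ≤ ‖D τ‖ + ‖I τ‖ := norm_add_le _ _
    _ ≤ (d * Real.exp (K * |τ|) + m * (Real.exp (K * |τ|) - 1)) + m := add_le_add hg h4
    _ = _ := by ring

end ODE

/-- The fields `V = G(d²g)` considered below are bounded and Lipschitz, because `d²g` is. -/
def Tame (g : Plane → ℝ) : Prop :=
  ∃ C : ℝ, (∀ x, ‖d2 g x‖ ≤ C) ∧ ∀ x y, ‖d2 g x - d2 g y‖ ≤ C * ‖x - y‖

lemma Tame.continuous_d2 {g : Plane → ℝ} (hg : Tame g) : Continuous (d2 g) := by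
  obtain ⟨C, -, hC⟩ := hg
  exact (LipschitzWith.of_dist_le' (K := C) fun x y => by
    rw [dist_eq_norm, dist_eq_norm]; exact hC x y).continuous

lemma Tame.continuous_eigvec {g : Plane → ℝ} (hg : Tame g) : Continuous (eigvec g) :=
  continuous_eigvecMap.comp hg.continuous_d2

lemma Tame.lipschitz_eigvec {g : Plane → ℝ} (hg : Tame g) :
    ∃ K : NNReal, LipschitzWith K (eigvec g) := by
  obtain ⟨C, -, hC⟩ := hg
  refine ⟨(12 * C).toNNReal, LipschitzWith.of_dist_le' fun x y => ?_⟩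
  rw [dist_eq_norm, dist_eq_norm]
  have := norm_eigvecMap_sub_le (d2 g x) (d2 g y)
  have h2 := hC x y
  simp only [eigvec]
  linarith

/-- Bounded Lipschitz fields have global solutions, so the default branch of `integralCurve` does
not occur for tame functions. -/
lemma Tame.path_spec {g : Plane → ℝ} (hg : Tame g) (x₀ : Plane) :
    path g x₀ 0 = x₀ ∧ ∀ t, HasDerivAt (path g x₀) (eigvec g (path g x₀ t)) t := by
  obtain ⟨K, hK⟩ := hg.lipschitz_eigvec
  obtain ⟨C, hC, -⟩ := hg
  have hex := exists_hasDerivAt_of_bounded_lipschitz hK (C := 12 * C)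
    (fun x => (norm_eigvecMap_le _).trans (by linarith [hC x])) x₀
  unfold path integralCurve
  rw [dif_pos hex]
  exact hex.choose_spec

lemma Tame.path_zero {g : Plane → ℝ} (hg : Tame g) (x₀ : Plane) : path g x₀ 0 = x₀ :=
  (hg.path_spec x₀).1

lemma Tame.hasDerivAt_path {g : Plane → ℝ} (hg : Tame g) (x₀ : Plane) (t : ℝ) :
    HasDerivAt (path g x₀) (eigvec g (path g x₀ t)) t :=
  (hg.path_spec x₀).2 t

lemma Tame.continuous_path {g : Plane → ℝ} (hg : Tame g) (x₀ : Plane) :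
    Continuous (path g x₀) :=
  continuous_iff_continuousAt.mpr fun t => (hg.hasDerivAt_path x₀ t).continuousAt

/-- The flow property. -/
lemma Tame.path_path {g : Plane → ℝ} (hg : Tame g) (x₀ : Plane) (s t : ℝ) :
    path g (path g x₀ t) s = path g x₀ (s + t) := by
  obtain ⟨K, hK⟩ := hg.lipschitz_eigvec
  have h := ODE_solution_unique_univ (v := fun _ => eigvec g) (s := fun _ => Set.univ) (K := K)
    (f := path g (path g x₀ t)) (g := fun s => path g x₀ (s + t)) (t₀ := 0)
    (fun _ => hK.lipschitzOnWith) (fun s => ⟨hg.hasDerivAt_path _ s, trivial⟩)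
    (fun s => ⟨by
      simpa using (hg.hasDerivAt_path x₀ (s + t)).comp_add_const s t, trivial⟩)
    (by simp [hg.path_zero])
  exact congrFun h s

/-- The flow is jointly continuous. -/
lemma Tame.continuous_uncurry_path {g : Plane → ℝ} (hg : Tame g) :
    Continuous fun p : Plane × ℝ => path g p.1 p.2 := by
  obtain ⟨K₀, hK₀⟩ := hg.lipschitz_eigvec
  rw [continuous_iff_continuousAt]
  rintro ⟨x, t⟩
  have hdist : ∀ y s, ‖path g y s - path g x s‖ ≤ ‖y - x‖ * Real.exp ((K₀ + 1) * |s|) := by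
    intro y s
    -- Both curves follow the same field, hence m = 0. The constant is K₀ + 1 because it has to be
    -- positive.
    have := norm_sub_le_of_integral_field_sub (hg.hasDerivAt_path x) (hg.hasDerivAt_path y)
      hg.continuous_eigvec hg.continuous_eigvec (K := K₀ + 1) (τ := s) (d := ‖y - x‖) (m := 0)
      (by positivity) (by rw [hg.path_zero, hg.path_zero])
      (fun r _ => by
        have h1 := hK₀.dist_le_mul (path g y (r * s)) (path g x (r * s))
        rw [dist_eq_norm, dist_eq_norm] at h1
        nlinarith [norm_nonneg (path g y (r * s) - path g x (r * s))])
      (by simp)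
    simpa using this
  rw [ContinuousAt, tendsto_iff_norm_sub_tendsto_zero]
  have h1 : Tendsto (fun p : Plane × ℝ => ‖p.1 - x‖ * Real.exp ((K₀ + 1) * |p.2|)
      + ‖path g x p.2 - path g x t‖) (𝓝 (x, t)) (𝓝 0) := by
    have hc : Continuous fun p : Plane × ℝ => ‖p.1 - x‖ * Real.exp ((K₀ + 1) * |p.2|)
        + ‖path g x p.2 - path g x t‖ := by
      have := hg.continuous_path x
      fun_prop
    simpa using hc.tendsto (x, t)
  refine squeeze_zero (fun _ => norm_nonneg _) (fun p => ?_) h1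
  calc ‖path g p.1 p.2 - path g x t‖
      = ‖(path g p.1 p.2 - path g x p.2) + (path g x p.2 - path g x t)‖ := by congr 1; abel
    _ ≤ _ := (norm_add_le _ _).trans (add_le_add_left (hdist _ _) _)

/-! ### Iterated partial derivatives -/

/-- Iterated partial derivatives; the head of the list is the derivative taken last. -/
def pderivs : List (Fin 2) → (Plane → ℝ) → Plane → ℝ
  | [], g => g
  | i :: l, g => pderiv i (pderivs l g)

/-- The multi-indices of the components of `d²g`. -/
def d2Index : Fin 3 → List (Fin 2) := ![[0, 0], [0, 1], [1, 1]]

lemma length_d2Index (j : Fin 3) : (d2Index j).length = 2 := by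
  fin_cases j <;> rfl

lemma d2_apply (g : Plane → ℝ) (x : Plane) (j : Fin 3) :
    d2 g x j = pderivs (d2Index j) g x := by
  fin_cases j <;> rfl

lemma gradient_apply (g : Plane → ℝ) (x : Plane) (i : Fin 2) :
    gradient g x i = pderivs [i] g x := by
  have h : inner ℝ (gradient g x) (EuclideanSpace.single i (1 : ℝ)) = pderiv i g x := by
    simp [gradient, pderiv]
  rw [EuclideanSpace.inner_single_right] at h
  simpa [pderivs] using h

lemma plane_eq_sum (v : Plane) :
    v = v 0 • EuclideanSpace.single 0 (1 : ℝ) + v 1 • EuclideanSpace.single 1 (1 : ℝ) := by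
  ext i; fin_cases i <;> simp

lemma map_plane {F : Type*} [NormedAddCommGroup F] [NormedSpace ℝ F] (T : Plane →L[ℝ] F)
    (v : Plane) :
    T v = v 0 • T (EuclideanSpace.single 0 1) + v 1 • T (EuclideanSpace.single 1 1) := by
  conv_lhs => rw [plane_eq_sum v]
  rw [map_add, map_smul, map_smul]

lemma fderiv_apply_plane (g : Plane → ℝ) (x v : Plane) :
    fderiv ℝ g x v = v 0 * pderiv 0 g x + v 1 * pderiv 1 g x := map_plane _ v

lemma norm_plane_le (v : Plane) : ‖v‖ ≤ |v 0| + |v 1| := by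
  apply le_of_sq_le_sq _ (by positivity)
  rw [norm_sq_plane, ← sq_abs (v 0), ← sq_abs (v 1)]
  nlinarith [abs_nonneg (v 0), abs_nonneg (v 1)]

lemma norm_space3_le (v : Space3) : ‖v‖ ≤ |v 0| + |v 1| + |v 2| := by
  apply le_of_sq_le_sq _ (by positivity)
  rw [norm_sq_space3, ← sq_abs (v 0), ← sq_abs (v 1), ← sq_abs (v 2)]
  nlinarith [abs_nonneg (v 0), abs_nonneg (v 1), abs_nonneg (v 2),
    mul_nonneg (abs_nonneg (v 0)) (abs_nonneg (v 1)),
    mul_nonneg (abs_nonneg (v 0)) (abs_nonneg (v 2)),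
    mul_nonneg (abs_nonneg (v 1)) (abs_nonneg (v 2))]

lemma norm_space3_le_of_forall {v : Space3} {c : ℝ} (h : ∀ j, |v j| ≤ c) : ‖v‖ ≤ 3 * c := by
  linarith [norm_space3_le v, h 0, h 1, h 2]

lemma norm_plane_le_of_forall {v : Plane} {c : ℝ} (h : ∀ j, |v j| ≤ c) : ‖v‖ ≤ 2 * c := by
  linarith [norm_plane_le v, h 0, h 1]

lemma norm_clm_plane_le {F : Type*} [NormedAddCommGroup F] [NormedSpace ℝ F]
    (T : Plane →L[ℝ] F) {c : ℝ} (h : ∀ i, ‖T (EuclideanSpace.single i 1)‖ ≤ c) :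
    ‖T‖ ≤ 2 * c := by
  have hc : 0 ≤ c := (norm_nonneg _).trans (h 0)
  refine ContinuousLinearMap.opNorm_le_bound _ (by positivity) fun v => ?_
  rw [map_plane]
  refine (norm_add_le _ _).trans ?_
  rw [norm_smul, norm_smul, Real.norm_eq_abs, Real.norm_eq_abs]
  have h0 := mul_le_mul (abs_apply_le_norm_plane v 0) (h 0) (norm_nonneg _) (norm_nonneg _)
  have h1 := mul_le_mul (abs_apply_le_norm_plane v 1) (h 1) (norm_nonneg _) (norm_nonneg _)
  linarith

lemma contDiff_pderiv {g : Plane → ℝ} {n : ℕ} (hg : ContDiff ℝ (n + 1 : ℕ) g) (i : Fin 2) :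
    ContDiff ℝ n (pderiv i g) := by
  have : ContDiff ℝ n (fderiv ℝ g) := hg.fderiv_right (by norm_cast)
  exact this.clm_apply contDiff_const

lemma contDiff_pderivs {g : Plane → ℝ} (l : List (Fin 2)) {n : ℕ}
    (hg : ContDiff ℝ (n + l.length : ℕ) g) : ContDiff ℝ n (pderivs l g) := by
  induction l generalizing n with
  | nil => simpa [pderivs] using hg
  | cons i l ih =>
    refine contDiff_pderiv (ih ?_) i
    convert hg using 2
    simp; ring

lemma pderiv_iteratedFDeriv {g : Plane → ℝ} {n : ℕ} {x : Plane}
    (hg : DifferentiableAt ℝ (iteratedFDeriv ℝ n g) x) (m : Fin n → Plane) (i : Fin 2) :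
    pderiv i (fun y => iteratedFDeriv ℝ n g y m) x
      = iteratedFDeriv ℝ (n + 1) g x (Fin.cons (EuclideanSpace.single i 1) m) := by
  rw [iteratedFDeriv_succ_apply_left]
  simp only [Fin.cons_zero, Fin.tail_cons, pderiv]
  have h := ((ContinuousMultilinearMap.apply ℝ (fun _ : Fin n => Plane) ℝ m).hasFDerivAt).comp x
    hg.hasFDerivAt
  have h2 : (⇑(ContinuousMultilinearMap.apply ℝ (fun _ : Fin n => Plane) ℝ m)
      ∘ iteratedFDeriv ℝ n g) = fun y => iteratedFDeriv ℝ n g y m := rfl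
  rw [h2] at h
  rw [h.fderiv]
  rfl

/-- The directions in which `pderivs l` differentiates. -/
def dirs (l : List (Fin 2)) : Fin l.length → Plane :=
  fun k => EuclideanSpace.single (l.get k) 1

/-- Only differentiability at each lower order is assumed. This suits the kernel, whose fourth
derivatives need not be continuous. -/
lemma pderivs_eq_iteratedFDeriv {g : Plane → ℝ} (l : List (Fin 2))
    (hg : ∀ k < l.length, Differentiable ℝ (iteratedFDeriv ℝ k g)) (x : Plane) :
    pderivs l g x = iteratedFDeriv ℝ l.length g x (dirs l) := by
  induction l generalizing x with
  | nil => simp [pderivs]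
  | cons i l ih =>
    have h1 : pderivs l g = fun y => iteratedFDeriv ℝ l.length g y (dirs l) :=
      funext fun y => ih (fun k hk => hg k (by simp; omega)) y
    have h2 : dirs (i :: l) = Fin.cons (EuclideanSpace.single i 1) (dirs l) := by
      funext k
      refine Fin.cases ?_ (fun k => ?_) k <;> simp [dirs]
    rw [pderivs, h1, pderiv_iteratedFDeriv (hg _ (by simp) x), h2]
    rfl

lemma norm_apply_dirs_le (l : List (Fin 2))
    (T : ContinuousMultilinearMap ℝ (fun _ : Fin l.length => Plane) ℝ) :
    |T (dirs l)| ≤ ‖T‖ := by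
  have h := T.le_opNorm (dirs l)
  have : ∏ i, ‖dirs l i‖ = 1 := by
    apply Finset.prod_eq_one
    intro i _
    simp [dirs]
  rwa [this, mul_one] at h

lemma abs_pderivs_le {g : Plane → ℝ} (l : List (Fin 2))
    (hg : ∀ k < l.length, Differentiable ℝ (iteratedFDeriv ℝ k g)) (x : Plane) :
    |pderivs l g x| ≤ ‖iteratedFDeriv ℝ l.length g x‖ := by
  rw [pderivs_eq_iteratedFDeriv l hg]
  exact norm_apply_dirs_le l _

/-- The mean value inequality for the iterated derivative asks for a bound on the next derivative,
not for its continuity. -/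
lemma abs_pderivs_sub_le {g : Plane → ℝ} (l : List (Fin 2))
    (hg : ∀ k ≤ l.length, Differentiable ℝ (iteratedFDeriv ℝ k g)) {C : ℝ}
    (hC : ∀ x, ‖iteratedFDeriv ℝ (l.length + 1) g x‖ ≤ C) (x y : Plane) :
    |pderivs l g x - pderivs l g y| ≤ C * ‖x - y‖ := by
  rw [pderivs_eq_iteratedFDeriv l fun k hk => hg k hk.le,
    pderivs_eq_iteratedFDeriv l fun k hk => hg k hk.le]
  have h1 : ‖iteratedFDeriv ℝ l.length g x - iteratedFDeriv ℝ l.length g y‖ ≤ C * ‖x - y‖ :=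
    Convex.norm_image_sub_le_of_norm_fderiv_le (s := Set.univ) (𝕜 := ℝ)
      (fun z _ => hg l.length le_rfl z)
      (fun z _ => by rw [norm_fderiv_iteratedFDeriv]; exact hC z) convex_univ trivial trivial
  exact (norm_apply_dirs_le l
    (iteratedFDeriv ℝ l.length g x - iteratedFDeriv ℝ l.length g y)).trans h1

/-! ### Differentiating the slope along an integral curve -/

lemma pderiv_comm {g : Plane → ℝ} (hg : ContDiff ℝ 2 g) (x : Plane) (i j : Fin 2) :
    pderiv i (pderiv j g) x = pderiv j (pderiv i g) x := by
  have hd : DifferentiableAt ℝ (fderiv ℝ g) x :=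
    (hg.fderiv_right (m := 1) (by norm_num)).differentiable (by norm_num) x
  have h : ∀ i j : Fin 2, pderiv i (pderiv j g) x
      = fderiv ℝ (fderiv ℝ g) x (EuclideanSpace.single i 1) (EuclideanSpace.single j 1) := by
    intro i j
    have := (hd.hasFDerivAt.clm_apply
      (hasFDerivAt_const (EuclideanSpace.single j (1 : ℝ) : Plane) x)).fderiv
    have h2 : pderiv j g = fun y => fderiv ℝ g y (EuclideanSpace.single j 1) := rfl
    rw [pderiv, h2, this]
    simp
  rw [h, h]
  exact (hg.contDiffAt.isSymmSndFDerivAt (by simp)) _ _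

lemma contDiff_d2 {g : Plane → ℝ} {n : ℕ} (hg : ContDiff ℝ (n + 2 : ℕ) g) :
    ContDiff ℝ n (d2 g) := by
  rw [contDiff_euclidean]
  intro j
  have : (fun x => d2 g x j) = pderivs (d2Index j) g := funext fun x => d2_apply g x j
  rw [this]
  refine contDiff_pderivs _ ?_
  rwa [length_d2Index]

lemma differentiable_d2 {g : Plane → ℝ} (hg : ContDiff ℝ 3 g) : Differentiable ℝ (d2 g) :=
  (contDiff_d2 (n := 1) (by exact_mod_cast hg)).differentiable (by norm_num)

lemma fderiv_d2_apply {g : Plane → ℝ} (hg : ContDiff ℝ 3 g) (x : Plane) (i : Fin 2)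
    (j : Fin 3) :
    fderiv ℝ (d2 g) x (EuclideanSpace.single i 1) j = pderivs (i :: d2Index j) g x := by
  have h := ((EuclideanSpace.proj (𝕜 := ℝ) j).hasFDerivAt (x := d2 g x)).comp x
    (differentiable_d2 hg x).hasFDerivAt
  have h2 : (⇑(EuclideanSpace.proj j : Space3 →L[ℝ] ℝ) ∘ d2 g)
      = pderivs (d2Index j) g := funext fun x => d2_apply g x j
  rw [h2] at h
  rw [pderivs, pderiv, h.fderiv]
  simp

lemma hasFDerivAt_eigvec {g : Plane → ℝ} (hg : ContDiff ℝ 3 g) {x : Plane}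
    (hx : gapMap (d2 g x) ≠ 0) :
    HasFDerivAt (eigvec g) ((eigvecDeriv (d2 g x)).comp (fderiv ℝ (d2 g) x)) x :=
  (hasFDerivAt_eigvecMap hx).comp x (differentiable_d2 hg x).hasFDerivAt

lemma slopeDeriv_eq {g : Plane → ℝ} (hg : ContDiff ℝ 3 g) {x : Plane}
    (hx : gapMap (d2 g x) ≠ 0) :
    slopeDeriv g x = inner ℝ (gradient g x)
      (eigvecDeriv (d2 g x) (fderiv ℝ (d2 g) x (eigvecMap (d2 g x))))
        + eigvalMap (d2 g x) * ‖eigvecMap (d2 g x)‖ ^ 2 := by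
  rw [slopeDeriv, (hasFDerivAt_eigvec hg hx).fderiv]
  rfl

lemma continuous_gradient {g : Plane → ℝ} (hg : ContDiff ℝ 1 g) : Continuous (gradient g) :=
  (InnerProductSpace.toDual ℝ Plane).symm.continuous.comp (hg.continuous_fderiv (by norm_num))

/-- Matrix-free form of `∇²g w`. -/
lemma fderiv_gradient_apply {g : Plane → ℝ} (hg : ContDiff ℝ 2 g) (x w : Plane) :
    HasFDerivAt (gradient g) (fderiv ℝ (gradient g) x) x ∧
      fderiv ℝ (gradient g) x w
        = !₂[d2 g x 0 * w 0 + d2 g x 1 * w 1, d2 g x 1 * w 0 + d2 g x 2 * w 1] := by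
  have hd : HasFDerivAt (gradient g) (fderiv ℝ (gradient g) x) x := by
    apply DifferentiableAt.hasFDerivAt
    refine (InnerProductSpace.toDual ℝ Plane).symm.toContinuousLinearEquiv.differentiableAt.comp
      x ?_
    exact (hg.fderiv_right (m := 1) (by norm_num)).differentiable (by norm_num) x
  refine ⟨hd, ?_⟩
  have hc : ∀ i, fderiv ℝ (gradient g) x w i
      = w 0 * pderiv 0 (pderiv i g) x + w 1 * pderiv 1 (pderiv i g) x := by
    intro i
    have h := ((EuclideanSpace.proj (𝕜 := ℝ) i).hasFDerivAt (x := gradient g x)).comp x hd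
    have h2 : (⇑(EuclideanSpace.proj i : Plane →L[ℝ] ℝ) ∘ gradient g)
        = pderiv i g := funext fun x => gradient_apply g x i
    rw [h2] at h
    rw [← fderiv_apply_plane, h.fderiv]
    simp
  ext i
  rw [hc]
  fin_cases i
  · simp [d2, pderiv_comm hg x 1 0]; ring
  · simp [d2]; ring

/-- This identity is the source of the term λ₂‖V‖² in ã'. -/
lemma fderiv_gradient_eigvec {g : Plane → ℝ} (hg : ContDiff ℝ 2 g) (x : Plane) :
    fderiv ℝ (gradient g) x (eigvec g x) = eigval g x • eigvec g x := by
  rw [(fderiv_gradient_apply hg x _).2]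
  have h := eigvecMap_eigen (d2 g x)
  ext i
  fin_cases i
  · simpa [eigvec, eigval] using h.1
  · simpa [eigvec, eigval] using h.2

/-- By the product rule the derivative in direction V is ⟨∇²g V, V⟩ + ⟨∇g, ∇V V⟩, and the first term
is λ₂‖V‖² by the eigenvector identity. Thus ã' is the derivative of the slope along the flow. -/
lemma hasFDerivAt_slope {g : Plane → ℝ} (hg : ContDiff ℝ 3 g) {x : Plane}
    (hx : gapMap (d2 g x) ≠ 0) :
    ∃ T : Plane →L[ℝ] ℝ, HasFDerivAt (slope g) T x ∧ T (eigvec g x) = slopeDeriv g x := by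
  have hg2 : ContDiff ℝ 2 g := hg.of_le (by norm_num)
  have h := (fderiv_gradient_apply hg2 x 0).1.inner ℝ (hasFDerivAt_eigvec hg hx)
  refine ⟨_, h, ?_⟩
  have h1 := fderiv_gradient_eigvec hg2 x
  rw [slopeDeriv, (hasFDerivAt_eigvec hg hx).fderiv]
  simp only [ContinuousLinearMap.comp_apply, ContinuousLinearMap.prod_apply, fderivInnerCLM_apply]
  rw [h1, real_inner_smul_left, real_inner_self_eq_norm_sq]

lemma hasDerivAt_slope_path {g : Plane → ℝ} (hg : ContDiff ℝ 3 g) (ht : Tame g) {x₀ : Plane}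
    {t : ℝ} (hx : gapMap (d2 g (path g x₀ t)) ≠ 0) :
    HasDerivAt (fun s => slope g (path g x₀ s)) (slopeDeriv g (path g x₀ t)) t := by
  obtain ⟨T, hT, hT'⟩ := hasFDerivAt_slope hg hx
  rw [← hT']
  exact hT.comp_hasDerivAt t (ht.hasDerivAt_path x₀ t)

/-- This turns the transversality assumption into the nonvanishing of the denominators ã' on the
filament. -/
lemma inner_gradient_slope_eigvec {g : Plane → ℝ} (hg : ContDiff ℝ 3 g) {x : Plane}
    (hx : gapMap (d2 g x) ≠ 0) :
    inner ℝ (gradient (slope g) x) (eigvec g x) = slopeDeriv g x := by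
  obtain ⟨T, hT, hT'⟩ := hasFDerivAt_slope hg hx
  rw [← hT', ← hT.fderiv]
  simp [gradient]

/-- If the Hessian has two distinct eigenvalues, then the eigenvalue gap is positive. -/
lemma gapMap_ne_zero {f : Plane → ℝ} (hf : ContDiff ℝ 2 f) {x : Plane}
    (hx : ∃ μ ν : ℝ, μ ≠ ν ∧ Module.End.HasEigenvalue (Matrix.toLin' (hessian f x)) μ ∧
      Module.End.HasEigenvalue (Matrix.toLin' (hessian f x)) ν) : gapMap (d2 f x) ≠ 0 := by
  intro h0
  obtain ⟨μ, ν, hne, hμ, hν⟩ := hx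
  have h1 : d2 f x 2 = d2 f x 0 := by
    have := congrArg (fun v : Plane => v 0) h0
    simp [gapMap_apply] at this
    linarith
  have h2 : d2 f x 1 = 0 := by
    have := congrArg (fun v : Plane => v 1) h0
    simpa [gapMap_apply] using this
  have hmat : hessian f x = Matrix.of ![![d2 f x 0, 0], ![0, d2 f x 0]] := by
    ext i j
    fin_cases i <;> fin_cases j
    · simp [hessian, d2]
    · simpa [hessian, d2] using h2
    · rw [d2] at h2
      simp only [hessian, Matrix.of_apply]
      simpa [pderiv_comm hf x 1 0] using h2
    · rw [← h1]; simp [hessian, d2]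
  have key : ∀ c : ℝ, Module.End.HasEigenvalue (Matrix.toLin' (hessian f x)) c → c = d2 f x 0 := by
    intro c hc
    obtain ⟨v, hv⟩ := hc.exists_hasEigenvector
    have h3 := hv.apply_eq_smul
    have h4 : Matrix.toLin' (hessian f x) v = d2 f x 0 • v := by
      rw [hmat, Matrix.toLin'_apply]
      ext i; fin_cases i <;> simp [Matrix.mulVec, dotProduct, Fin.sum_univ_two]
    rw [h4] at h3
    have h5 : (d2 f x 0 - c) • v = 0 := by rw [sub_smul, h3, sub_self]
    rcases smul_eq_zero.mp h5 with h6 | h6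
    · linarith
    · exact absurd h6 hv.2
  exact hne ((key μ hμ).trans (key ν hν).symm)

lemma tame_of_pderivs {g : Plane → ℝ} {C : ℝ} (h1 : ∀ j x, |pderivs (d2Index j) g x| ≤ C)
    (h2 : ∀ j x y, |pderivs (d2Index j) g x - pderivs (d2Index j) g y| ≤ C * ‖x - y‖) :
    Tame g := by
  refine ⟨3 * C, fun x => norm_space3_le_of_forall fun j => ?_, fun x y => ?_⟩
  · rw [d2_apply]; exact h1 j x
  · have := norm_space3_le_of_forall (v := d2 g x - d2 g y) (c := C * ‖x - y‖) fun j => by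
      rw [PiLp.sub_apply, d2_apply, d2_apply]; exact h2 j x y
    linarith

lemma norm_fderiv_d2_sub_le {f g : Plane → ℝ} (hf : ContDiff ℝ 3 f) (hg : ContDiff ℝ 3 g)
    {x : Plane} {c : ℝ}
    (h : ∀ i j, |pderivs (i :: d2Index j) g x - pderivs (i :: d2Index j) f x| ≤ c) :
    ‖fderiv ℝ (d2 g) x - fderiv ℝ (d2 f) x‖ ≤ 6 * c := by
  have := norm_clm_plane_le (fderiv ℝ (d2 g) x - fderiv ℝ (d2 f) x) (c := 3 * c) fun i => by
    refine norm_space3_le_of_forall fun j => ?_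
    rw [sub_apply, PiLp.sub_apply, fderiv_d2_apply hg, fderiv_d2_apply hf]
    exact h i j
  linarith

lemma SmoothDensity.differentiable_iteratedFDeriv {f : Plane → ℝ} (hf : SmoothDensity f)
    {k : ℕ} (hk : k < 4) : Differentiable ℝ (iteratedFDeriv ℝ k f) :=
  hf.contDiff.differentiable_iteratedFDeriv (by exact_mod_cast hk)

lemma SmoothDensity.exists_bound {f : Plane → ℝ} (hf : SmoothDensity f) :
    ∃ C : ℝ, 0 < C ∧ ∀ k : ℕ, 1 ≤ k → k ≤ 4 → ∀ x, ‖iteratedFDeriv ℝ k f x‖ ≤ C := by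
  obtain ⟨C1, h1⟩ := hf.bounded 1 (by norm_num) (by norm_num)
  obtain ⟨C2, h2⟩ := hf.bounded 2 (by norm_num) (by norm_num)
  obtain ⟨C3, h3⟩ := hf.bounded 3 (by norm_num) (by norm_num)
  obtain ⟨C4, h4⟩ := hf.bounded 4 (by norm_num) (by norm_num)
  refine ⟨max 1 (max (max C1 C2) (max C3 C4)), by positivity, fun k hk1 hk4 x => ?_⟩
  interval_cases k
  · exact (h1 x).trans (by simp)
  · exact (h2 x).trans (by simp)
  · exact (h3 x).trans (by simp)
  · exact (h4 x).trans (by simp)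

/-! ### Stability of first transversal zeros -/

/-- Stability of the smallest zero of `S` with `Λ < 0` under uniform perturbations. -/
lemma exists_argmin_of_perturbation {S Λ : ℝ → ℝ} (hS : Continuous S) (hΛ : Continuous Λ)
    {T s' ρ : ℝ} (hST : S T = 0) (hΛT : Λ T < 0) (hd : HasDerivAt S s' T) (hs' : s' ≠ 0)
    (huniq : ∀ t, |t| ≤ |T| → S t = 0 → Λ t < 0 → t = T)
    (hnd : ∀ t, |t| ≤ |T| → S t = 0 → Λ t ≠ 0) (hρ : 0 < ρ) :
    ∃ η : ℝ, 0 < η ∧ ∀ S' Λ' : ℝ → ℝ, Continuous S' →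
      (∀ t, |t| ≤ |T| + 1 → |S' t - S t| ≤ η ∧ |Λ' t - Λ t| ≤ η) →
      (∃ t, IsArgminAbs {t | S' t = 0 ∧ Λ' t < 0} t) ∧
        ∀ t, IsArgminAbs {t | S' t = 0 ∧ Λ' t < 0} t → |t - T| ≤ ρ := by
  -- A window around T in which Λ is clearly negative and S has the sign of (t − T)s'.
  obtain ⟨ρ₁, hρ₁, hρ₁1, hρ₁ρ, hloc⟩ : ∃ ρ₁ : ℝ, 0 < ρ₁ ∧ ρ₁ ≤ 1 ∧ ρ₁ ≤ ρ ∧ ∀ t, |t - T| ≤ ρ₁ →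
      Λ t < Λ T / 2 ∧ (t ≠ T → 0 < S t * (t - T) * s') := by
    have h1 : ∀ᶠ t in 𝓝 T, Λ t < Λ T / 2 :=
      hΛ.continuousAt.eventually_lt continuousAt_const (by linarith)
    have h2 : ∀ᶠ t in 𝓝 T, ‖S t - S T - (t - T) • s'‖ ≤ |s'| / 2 * ‖t - T‖ :=
      (hasDerivAt_iff_isLittleO.mp hd).def (by positivity)
    obtain ⟨r, hr, hball⟩ := Metric.eventually_nhds_iff.mp (h1.and h2)
    refine ⟨min (min ρ 1) (r / 2), by positivity, (min_le_left _ _).trans (min_le_right _ _),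
      (min_le_left _ _).trans (min_le_left _ _), fun t ht => ?_⟩
    have ht' : dist t T < r := by
      rw [Real.dist_eq]
      have := ht.trans (min_le_right _ _)
      linarith
    obtain ⟨h3, h4⟩ := hball ht'
    refine ⟨h3, fun hne => ?_⟩
    rw [hST, sub_zero, Real.norm_eq_abs, Real.norm_eq_abs, smul_eq_mul] at h4
    have h5 : 0 < |t - T| := abs_pos.mpr (sub_ne_zero.mpr hne)
    have h6 : |(S t - (t - T) * s') * ((t - T) * s')|
        ≤ |s'| / 2 * |t - T| * (|t - T| * |s'|) := by
      rw [abs_mul, abs_mul (t - T)]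
      gcongr
    have h7 : |t - T| * |s'| * (|t - T| * |s'|) = (t - T) ^ 2 * s' ^ 2 := by
      rw [← sq_abs (t - T), ← sq_abs s']; ring
    have h8 : 0 < (t - T) ^ 2 * s' ^ 2 := by
      have := sub_ne_zero.mpr hne
      positivity
    have h9 := (abs_le.mp h6).1
    nlinarith
  -- m t ≤ 0 means S t = 0 and Λ t ≤ 0. Unlike the condition with Λ t < 0, this is closed, so
  -- compactness applies.
  set m : ℝ → ℝ := fun t => max |S t| (Λ t) with hm
  have hmc : Continuous m := hS.abs.max hΛ
  have hcl : ∀ r : ℝ, IsCompact {t : ℝ | |t| ≤ r ∧ ρ₁ ≤ |t - T|} := by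
    intro r
    refine (isCompact_Icc (a := -r) (b := r)).of_isClosed_subset ?_ fun t ht => abs_le.mp ht.1
    exact (isClosed_le continuous_abs continuous_const).inter
      (isClosed_le continuous_const (continuous_id.sub continuous_const).abs)
  -- Uniqueness and nondegeneracy exclude times with m ≤ 0 and |t| ≤ |T| outside the window. Those
  -- with |T| < |t| ≤ |T| + 1 then have, by compactness, a least modulus strictly above |T|; half of
  -- the excess is a safe choice of ρ₂.
  obtain ⟨ρ₂, hρ₂, hρ₂₁, hmpos⟩ : ∃ ρ₂ : ℝ, 0 < ρ₂ ∧ ρ₂ ≤ ρ₁ ∧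
      ∀ t, |t| ≤ |T| + ρ₂ → ρ₁ ≤ |t - T| → 0 < m t := by
    set N : Set ℝ := {t | |t| ≤ |T| + 1 ∧ ρ₁ ≤ |t - T|} ∩ {t | m t ≤ 0} with hN
    have hNc : IsCompact N := (hcl _).inter_right (isClosed_le hmc continuous_const)
    rcases N.eq_empty_or_nonempty with hemp | hne
    · refine ⟨ρ₁, hρ₁, le_rfl, fun t ht1 ht2 => ?_⟩
      by_contra hneg
      have : t ∈ N := ⟨⟨by linarith, ht2⟩, not_lt.mp hneg⟩
      rw [hemp] at this
      exact this
    · obtain ⟨t₀, ht₀, hmin⟩ := hNc.exists_isMinOn hne continuous_abs.continuousOn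
      have hgt : |T| < |t₀| := by
        by_contra hle
        push Not at hle
        have h1 : |S t₀| ≤ 0 := (le_max_left _ _).trans ht₀.2
        have h2 : Λ t₀ ≤ 0 := (le_max_right _ _).trans ht₀.2
        have h3 : S t₀ = 0 := abs_nonpos_iff.mp h1
        have h4 := huniq t₀ hle h3 (lt_of_le_of_ne h2 (hnd t₀ hle h3))
        have h5 := ht₀.1.2
        rw [h4, sub_self, abs_zero] at h5
        linarith
      refine ⟨min ρ₁ ((|t₀| - |T|) / 2), lt_min hρ₁ (by linarith), min_le_left _ _,
        fun t ht1 ht2 => ?_⟩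
      by_contra hneg
      have h1 : t ∈ N := ⟨⟨by linarith [min_le_left ρ₁ ((|t₀| - |T|) / 2)], ht2⟩, not_lt.mp hneg⟩
      have h2 : |t₀| ≤ |t| := hmin h1
      linarith [min_le_right ρ₁ ((|t₀| - |T|) / 2)]
  obtain ⟨c, hc, hmc'⟩ : ∃ c : ℝ, 0 < c ∧ ∀ t, |t| ≤ |T| + ρ₂ → ρ₁ ≤ |t - T| → c ≤ m t := by
    rcases ({t : ℝ | |t| ≤ |T| + ρ₂ ∧ ρ₁ ≤ |t - T|}).eq_empty_or_nonempty with hemp | hne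
    · refine ⟨1, one_pos, fun t h1 h2 => ?_⟩
      have : t ∈ {t : ℝ | |t| ≤ |T| + ρ₂ ∧ ρ₁ ≤ |t - T|} := ⟨h1, h2⟩
      rw [hemp] at this
      exact this.elim
    · obtain ⟨t₀, ht₀, hmin⟩ := (hcl _).exists_isMinOn hne hmc.continuousOn
      exact ⟨m t₀, hmpos t₀ ht₀.1 ht₀.2, fun t h1 h2 => hmin ⟨h1, h2⟩⟩
  have hplus : 0 < S (T + ρ₂) * s' := by
    have h := (hloc (T + ρ₂) (by simpa [abs_of_pos hρ₂] using hρ₂₁)).2 (by linarith)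
    rw [add_sub_cancel_left, mul_right_comm] at h
    exact pos_of_mul_pos_left h hρ₂.le
  have hminus : S (T - ρ₂) * s' < 0 := by
    have h := (hloc (T - ρ₂) (by simpa [abs_of_pos hρ₂] using hρ₂₁)).2 (by linarith)
    have h2 : S (T - ρ₂) * (T - ρ₂ - T) * s' = -(S (T - ρ₂) * s' * ρ₂) := by ring
    rw [h2] at h
    nlinarith
  -- The four terms have separate tasks: c/2 forbids zeros outside the window, −ΛT/4 keeps Λ'
  -- negative inside it, and the last two preserve the signs of S at T ± ρ₂.
  set η : ℝ := min (min (c / 2) (-Λ T / 4))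
    (min (|S (T + ρ₂)| / 2) (|S (T - ρ₂)| / 2)) with hη
  have hSp : S (T + ρ₂) ≠ 0 := fun h => by rw [h, zero_mul] at hplus; exact lt_irrefl _ hplus
  have hSm : S (T - ρ₂) ≠ 0 := fun h => by rw [h, zero_mul] at hminus; exact lt_irrefl _ hminus
  have hη1 : η ≤ c / 2 := (min_le_left _ _).trans (min_le_left _ _)
  have hη2 : η ≤ -Λ T / 4 := (min_le_left _ _).trans (min_le_right _ _)
  have hη3 : η ≤ |S (T + ρ₂)| / 2 := (min_le_right _ _).trans (min_le_left _ _)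
  have hη4 : η ≤ |S (T - ρ₂)| / 2 := (min_le_right _ _).trans (min_le_right _ _)
  refine ⟨η, ?_, fun S' Λ' hS' hclose => ?_⟩
  · have := abs_pos.mpr hSp
    have := abs_pos.mpr hSm
    have : 0 < -Λ T / 4 := by linarith
    positivity
  have habs : ∀ t, |t - T| ≤ ρ₂ → |t| ≤ |T| + ρ₂ := fun t ht => by
    have := abs_add_le (t - T) T
    rw [sub_add_cancel] at this
    linarith
  -- S' still changes sign between T − ρ₂ and T + ρ₂, so it has a zero there.
  obtain ⟨t₁, ht₁, hz₁⟩ : ∃ t₁, |t₁ - T| ≤ ρ₂ ∧ S' t₁ = 0 := by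
    have hp := (hclose (T + ρ₂) ((habs _ (by simp [abs_of_pos hρ₂])).trans (by linarith))).1
    have hn := (hclose (T - ρ₂) ((habs _ (by simp [abs_of_pos hρ₂])).trans (by linarith))).1
    have h0 : (0 : ℝ) ∈ Set.uIcc (S' (T - ρ₂)) (S' (T + ρ₂)) := by
      rw [Set.mem_uIcc]
      rcases lt_or_gt_of_ne hs' with hneg | hpos
      · have h1 : S (T + ρ₂) < 0 := by nlinarith
        have h2 : 0 < S (T - ρ₂) := by nlinarith
        rw [abs_of_neg h1] at hη3
        rw [abs_of_pos h2] at hη4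
        right
        constructor
        · linarith [(abs_le.mp hp).2]
        · linarith [(abs_le.mp hn).1]
      · have h1 : 0 < S (T + ρ₂) := by nlinarith
        have h2 : S (T - ρ₂) < 0 := by nlinarith
        rw [abs_of_pos h1] at hη3
        rw [abs_of_neg h2] at hη4
        left
        constructor
        · linarith [(abs_le.mp hn).2]
        · linarith [(abs_le.mp hp).1]
    obtain ⟨t₁, ht₁, hz⟩ := intermediate_value_uIcc hS'.continuousOn h0
    rw [Set.uIcc_of_le (by linarith)] at ht₁
    exact ⟨t₁, by rw [abs_le]; constructor <;> linarith [ht₁.1, ht₁.2], hz⟩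
  have hneg : ∀ t, |t| ≤ |T| + 1 → |t - T| ≤ ρ₁ → Λ' t < 0 := fun t h1 h2 => by
    linarith [(hloc t h2).1, (abs_le.mp (hclose t h1).2).2]
  have hnear : ∀ t, |t| ≤ |T| + ρ₂ → S' t = 0 → Λ' t < 0 → |t - T| ≤ ρ₁ := by
    intro t h1 h2 h3
    by_contra hgt
    push Not at hgt
    have h4 := hmc' t h1 hgt.le
    obtain ⟨h5, h6⟩ := hclose t (by linarith)
    rw [h2, zero_sub, abs_neg] at h5
    rcases le_max_iff.mp h4 with h7 | h7
    · linarith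
    · linarith [(abs_le.mp h6).1]
  have hmem₁ : t₁ ∈ {t | S' t = 0 ∧ Λ' t < 0} :=
    ⟨hz₁, hneg t₁ ((habs _ ht₁).trans (by linarith)) (ht₁.trans hρ₂₁)⟩
  constructor
  -- Since |t₁| ≤ |T| + ρ₂, later times cannot do better. The search is confined to a compact subset
  -- of the window, on which Λ' < 0 holds automatically.
  · have hQ : IsCompact ({t : ℝ | |t| ≤ |T| + ρ₂} ∩ {t | |t - T| ≤ ρ₁} ∩ {t | S' t = 0}) := by
      refine (isCompact_Icc (a := -(|T| + ρ₂)) (b := |T| + ρ₂)).of_isClosed_subset ?_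
        fun t ht => abs_le.mp ht.1.1
      exact ((isClosed_le continuous_abs continuous_const).inter
        (isClosed_le (continuous_id.sub continuous_const).abs continuous_const)).inter (isClosed_eq hS' continuous_const)
    obtain ⟨t₂, ht₂, hmin⟩ := hQ.exists_isMinOn ⟨t₁, ⟨habs _ ht₁, ht₁.trans hρ₂₁⟩, hz₁⟩
      continuous_abs.continuousOn
    refine ⟨t₂, ⟨ht₂.2, hneg t₂ (le_trans ht₂.1.1 (by linarith)) ht₂.1.2⟩, fun s hs => ?_⟩
    rcases le_or_gt |s| (|T| + ρ₂) with h | h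
    · exact hmin ⟨⟨h, hnear s h hs.1 hs.2⟩, hs.1⟩
    · exact le_trans ht₂.1.1 h.le
  · intro t ht
    exact (hnear t ((ht.2 t₁ hmem₁).trans (habs _ ht₁)) ht.1.1 ht.1.2).trans hρ₁ρ

/-! ### Quantitative regularity of the density -/

/-- Global bounds and Lipschitz bounds for the first three derivatives of `f`. -/
structure DerivBounds (f : Plane → ℝ) (C : ℝ) : Prop where
  one_le : 1 ≤ C
  contDiff : ContDiff ℝ 3 f
  grad_le : ∀ x, ‖gradient f x‖ ≤ C
  grad_sub_le : ∀ x y, ‖gradient f x - gradient f y‖ ≤ C * ‖x - y‖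
  d2_le : ∀ x, ‖d2 f x‖ ≤ C
  d2_sub_le : ∀ x y, ‖d2 f x - d2 f y‖ ≤ C * ‖x - y‖
  d3_le : ∀ x, ‖fderiv ℝ (d2 f) x‖ ≤ C
  d3_sub_le : ∀ x y, ‖fderiv ℝ (d2 f) x - fderiv ℝ (d2 f) y‖ ≤ C * ‖x - y‖
  grad_taylor : ∀ x y, ‖gradient f y - gradient f x - fderiv ℝ (gradient f) x (y - x)‖
    ≤ C * ‖y - x‖ ^ 2

lemma DerivBounds.tame {f : Plane → ℝ} {C : ℝ} (hf : DerivBounds f C) : Tame f :=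
  ⟨C, hf.d2_le, hf.d2_sub_le⟩

lemma norm_fderiv_gradient_sub_le {f : Plane → ℝ} (hf : ContDiff ℝ 2 f) (x y : Plane) :
    ‖fderiv ℝ (gradient f) x - fderiv ℝ (gradient f) y‖ ≤ 4 * ‖d2 f x - d2 f y‖ := by
  refine ContinuousLinearMap.opNorm_le_bound _ (by positivity) fun w => ?_
  rw [sub_apply, (fderiv_gradient_apply hf x w).2, (fderiv_gradient_apply hf y w).2]
  have h := fun j => abs_apply_le_norm (d2 f x - d2 f y) j
  have hw := abs_apply_le_norm_plane w
  have key : ∀ i j : Fin 3, |(d2 f x - d2 f y) i * w 0 + (d2 f x - d2 f y) j * w 1|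
      ≤ 2 * (‖d2 f x - d2 f y‖ * ‖w‖) := by
    intro i j
    refine (abs_add_le _ _).trans ?_
    rw [abs_mul, abs_mul]
    have h1 := mul_le_mul (h i) (hw 0) (abs_nonneg _) (norm_nonneg _)
    have h2 := mul_le_mul (h j) (hw 1) (abs_nonneg _) (norm_nonneg _)
    linarith
  have h3 := norm_plane_le_of_forall
    (v := (!₂[d2 f x 0 * w 0 + d2 f x 1 * w 1, d2 f x 1 * w 0 + d2 f x 2 * w 1] : Plane)
      - !₂[d2 f y 0 * w 0 + d2 f y 1 * w 1, d2 f y 1 * w 0 + d2 f y 2 * w 1])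
    (c := 2 * (‖d2 f x - d2 f y‖ * ‖w‖)) (fun i => by
      fin_cases i
      · refine le_trans (le_of_eq ?_) (key 0 1)
        congr 1; simp; ring
      · refine le_trans (le_of_eq ?_) (key 1 2)
        congr 1; simp; ring)
  linarith

lemma SmoothDensity.derivBounds {f : Plane → ℝ} (hf : SmoothDensity f) :
    ∃ C, DerivBounds f C := by
  obtain ⟨C, hC0, hC⟩ := hf.exists_bound
  have h3 : ContDiff ℝ 3 f := hf.contDiff.of_le (by norm_num)
  have h2 : ContDiff ℝ 2 f := hf.contDiff.of_le (by norm_num)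
  have hb : ∀ l : List (Fin 2), 1 ≤ l.length → l.length ≤ 4 → ∀ x, |pderivs l f x| ≤ C :=
    fun l h1 h4 x => (abs_pderivs_le l (fun k hk =>
      hf.differentiable_iteratedFDeriv (by omega)) x).trans (hC _ h1 h4 x)
  have hl : ∀ l : List (Fin 2), l.length ≤ 3 → ∀ x y,
      |pderivs l f x - pderivs l f y| ≤ C * ‖x - y‖ :=
    fun l h4 x y => abs_pderivs_sub_le l (fun k hk =>
      hf.differentiable_iteratedFDeriv (by omega)) (fun z => hC _ (by omega) (by omega) z) x y
  have hd2l : ∀ x y, ‖d2 f x - d2 f y‖ ≤ 3 * C * ‖x - y‖ := fun x y => by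
    have := norm_space3_le_of_forall (v := d2 f x - d2 f y) (c := C * ‖x - y‖) fun j => by
      rw [PiLp.sub_apply, d2_apply, d2_apply]
      exact hl _ (by rw [length_d2Index]; omega) x y
    linarith
  refine ⟨12 * C + 1, by linarith, h3, fun x => ?_, fun x y => ?_, fun x => ?_, fun x y => ?_,
    fun x => ?_, fun x y => ?_, fun x y => ?_⟩
  · have := norm_plane_le_of_forall (v := gradient f x) (c := C) fun j => by
      rw [gradient_apply]; exact hb _ (by simp) (by simp) x
    linarith
  · have := norm_plane_le_of_forall (v := gradient f x - gradient f y) (c := C * ‖x - y‖) fun j => by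
      rw [PiLp.sub_apply, gradient_apply, gradient_apply]; exact hl _ (by simp) x y
    nlinarith [norm_nonneg (x - y)]
  · have := norm_space3_le_of_forall (v := d2 f x) (c := C) fun j => by
      rw [d2_apply]; exact hb _ (by rw [length_d2Index]; omega) (by rw [length_d2Index]; omega) x
    linarith
  · nlinarith [norm_nonneg (x - y), hd2l x y]
  · have := norm_clm_plane_le (fderiv ℝ (d2 f) x) (c := 3 * C) fun i => by
      refine norm_space3_le_of_forall fun j => ?_
      rw [fderiv_d2_apply h3]
      exact hb _ (by simp) (by simp [length_d2Index]) x
    linarith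
  · have := norm_clm_plane_le (fderiv ℝ (d2 f) x - fderiv ℝ (d2 f) y) (c := 3 * (C * ‖x - y‖))
      fun i => by
        refine norm_space3_le_of_forall fun j => ?_
        rw [sub_apply, PiLp.sub_apply, fderiv_d2_apply h3, fderiv_d2_apply h3]
        exact hl _ (by simp [length_d2Index]) x y
    nlinarith [norm_nonneg (x - y)]
  -- On the ball of radius ‖y − x‖ the derivative of the gradient stays within 4 · 3C‖y − x‖ of its
  -- value at x, which makes the Taylor remainder quadratic.
  · have h := Convex.norm_image_sub_le_of_norm_hasFDerivWithin_le' (𝕜 := ℝ)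
      (f := gradient f) (f' := fderiv ℝ (gradient f))
      (φ := fderiv ℝ (gradient f) x) (s := Metric.closedBall x ‖y - x‖)
      (C := 12 * C * ‖y - x‖) (x := x) (y := y)
      (fun z _ => (fderiv_gradient_apply h2 z 0).1.hasFDerivWithinAt)
      (fun z hz => (norm_fderiv_gradient_sub_le h2 z x).trans (by
        rw [Metric.mem_closedBall, dist_eq_norm] at hz
        have := hd2l z x
        nlinarith))
      (convex_closedBall _ _) (Metric.mem_closedBall_self (norm_nonneg _))
      (by rw [Metric.mem_closedBall, dist_eq_norm])
    nlinarith [sq_nonneg ‖y - x‖]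

/-! ### Consistency of the hitting times -/

/-- Paths of fields close to that of `f` which start in `S` stay in a fixed ball up to time `T`. -/
def Confining (f : Plane → ℝ) (S : Set Plane) (T R : ℝ) : Prop :=
  ∀ g, Tame g → (∀ x ∈ Metric.closedBall 0 R, ‖d2 g x - d2 f x‖ ≤ 1) →
    ∀ x₀ ∈ S, ∀ t, |t| ≤ T → path g x₀ t ∈ Metric.closedBall 0 R

lemma exists_confining {f : Plane → ℝ} {C : ℝ} (hf : DerivBounds f C) {S : Set Plane}
    (hS : Bornology.IsBounded S) {T : ℝ} (hT : 0 ≤ T) : ∃ R, 0 < R ∧ Confining f S T R := by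
  obtain ⟨R₀, hR₀, hSR⟩ := hS.subset_closedBall_lt 0 0
  have hC := hf.one_le
  -- The fields in question have norm at most 12(C + 1) on the ball; the extra 1 makes the speed
  -- bound strict.
  set v : ℝ := 12 * (C + 1) + 1 with hv
  refine ⟨R₀ + v * T, by positivity, fun g hg hclose x₀ hx₀ t ht => ?_⟩
  have hx : ‖x₀‖ ≤ R₀ := by simpa using hSR hx₀
  have h := norm_sub_le_of_norm_field_lt (hg.hasDerivAt_path x₀) (C := v) (τ := t)
    (by positivity) (fun x hx' => by
      rw [hg.path_zero, Metric.mem_closedBall, dist_eq_norm] at hx'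
      have hxb : x ∈ Metric.closedBall 0 (R₀ + v * T) := by
        rw [mem_closedBall_zero_iff]
        have := norm_le_norm_add_norm_sub' x x₀
        have : v * |t| ≤ v * T := by gcongr
        linarith
      have h1 := hclose x hxb
      have h2 := norm_eigvecMap_le (d2 g x)
      have h3 := norm_le_norm_add_norm_sub' (d2 g x) (d2 f x)
      have h4 := hf.d2_le x
      simp only [eigvec]
      linarith)
  rw [hg.path_zero] at h
  rw [mem_closedBall_zero_iff]
  have h1 := norm_le_norm_add_norm_sub' (path g x₀ t) x₀
  have : v * |t| ≤ v * T := by gcongr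
  linarith

lemma DerivBounds.norm_eigvec_sub_le {f : Plane → ℝ} {C : ℝ} (hf : DerivBounds f C)
    (x y : Plane) : ‖eigvec f x - eigvec f y‖ ≤ 12 * C * ‖x - y‖ := by
  have := norm_eigvecMap_sub_le (d2 f x) (d2 f y)
  have h2 := hf.d2_sub_le x y
  simp only [eigvec]
  linarith

lemma DerivBounds.norm_eigvec_le {f : Plane → ℝ} {C : ℝ} (hf : DerivBounds f C)
    (x : Plane) : ‖eigvec f x‖ ≤ 12 * C := by
  have := norm_eigvecMap_le (d2 f x)
  have h2 := hf.d2_le x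
  simp only [eigvec]
  linarith

/-- Crude stability of the integral curves. -/
lemma exists_path_stability {f : Plane → ℝ} {C : ℝ} (hf : DerivBounds f C) {S : Set Plane}
    {T R : ℝ} (hT : 0 ≤ T) (hR : Confining f S T R) :
    ∃ M, 1 ≤ M ∧ ∀ g, Tame g → ∀ e ≤ 1, (∀ x ∈ Metric.closedBall 0 R, ‖d2 g x - d2 f x‖ ≤ e) →
      ∀ x₀, ∀ x₁ ∈ S, ∀ t, |t| ≤ T →
        ‖path g x₁ t - path f x₀ t‖ ≤ M * (‖x₁ - x₀‖ + e) := by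
  have hC := hf.one_le
  refine ⟨(1 + 12 * T) * Real.exp (12 * C * T), ?_, fun g hg e he hclose x₀ x₁ hx₁ t ht => ?_⟩
  · have : 1 ≤ Real.exp (12 * C * T) := Real.one_le_exp (by positivity)
    nlinarith
  have hconf := hR g hg (fun x hx => (hclose x hx).trans he) x₁ hx₁
  have he0 : 0 ≤ e := (norm_nonneg _).trans (hclose _ (hconf 0 (by simpa using hT)))
  -- The field of f plays the role of W', and the field difference is integrated along the curve of
  -- g. Hence only the Lipschitz constant of f occurs, and no bound on third derivatives of g is
  -- needed.
  have h := norm_sub_le_of_integral_field_sub (hg.hasDerivAt_path x₁) (hf.tame.hasDerivAt_path x₀)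
    hg.continuous_eigvec hf.tame.continuous_eigvec (K := 12 * C) (τ := t) (d := ‖x₁ - x₀‖)
    (m := 12 * e * T) (by linarith)
    (by rw [hg.path_zero, hf.tame.path_zero, norm_sub_rev])
    (fun s _ => hf.norm_eigvec_sub_le _ _)
    (fun s hs => by
      have hst : |s * t| ≤ T := by
        rw [abs_mul, abs_of_nonneg hs.1]
        nlinarith [abs_nonneg t, hs.2, hs.1]
      have hb := intervalIntegral.norm_integral_le_of_norm_le_const (a := 0) (b := s * t)
        (f := fun r => eigvec f (path g x₁ r) - eigvec g (path g x₁ r)) (C := 12 * e)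
        (fun r hr => by
          have hr' : |r| ≤ T := by
            rw [Set.mem_uIoc] at hr
            rw [abs_le] at hst ⊢
            rcases hr with hr | hr <;> constructor <;> linarith [hr.1, hr.2]
          have h1 := norm_eigvecMap_sub_le (d2 f (path g x₁ r)) (d2 g (path g x₁ r))
          have h2 := hclose _ (hconf r hr')
          rw [norm_sub_rev] at h2
          simp only [eigvec]
          linarith)
      refine hb.trans ?_
      rw [sub_zero]
      gcongr)
  rw [norm_sub_rev]
  refine h.trans ?_
  have h1 : Real.exp (12 * C * |t|) ≤ Real.exp (12 * C * T) := by
    apply Real.exp_le_exp.mpr; gcongr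
  have h2 : ‖x₁ - x₀‖ + 12 * e * T ≤ (1 + 12 * T) * (‖x₁ - x₀‖ + e) := by
    nlinarith [norm_nonneg (x₁ - x₀), mul_nonneg hT (norm_nonneg (x₁ - x₀))]
  calc (‖x₁ - x₀‖ + 12 * e * T) * Real.exp (12 * C * |t|)
      ≤ ((1 + 12 * T) * (‖x₁ - x₀‖ + e)) * Real.exp (12 * C * T) := by gcongr
    _ = _ := by ring

lemma abs_slope_sub_le {f g : Plane → ℝ} {C : ℝ} (hf : DerivBounds f C) {x y : Plane}
    {e₁ e₂ : ℝ} (he₂ : e₂ ≤ 1) (h1 : ‖gradient g y - gradient f y‖ ≤ e₁)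
    (h2 : ‖d2 g y - d2 f y‖ ≤ e₂) :
    |slope g y - slope f x| ≤ 24 * (C + 1) ^ 2 * (e₁ + e₂ + ‖y - x‖) := by
  have hC := hf.one_le
  have he₁ : 0 ≤ e₁ := (norm_nonneg _).trans h1
  have he₂' : 0 ≤ e₂ := (norm_nonneg _).trans h2
  have hd := norm_nonneg (y - x)
  have e1 : slope g y - slope f x = inner ℝ (gradient g y - gradient f x) (eigvec g y)
      + inner ℝ (gradient f x) (eigvec g y - eigvec f x) := by
    simp only [slope, inner_sub_left, inner_sub_right]; ring
  have a1 : ‖gradient g y - gradient f x‖ ≤ e₁ + C * ‖y - x‖ := by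
    have := norm_sub_le_norm_sub_add_norm_sub (gradient g y) (gradient f y) (gradient f x)
    linarith [hf.grad_sub_le y x]
  have a2' : ‖d2 g y - d2 f x‖ ≤ e₂ + C * ‖y - x‖ := by
    have := norm_sub_le_norm_sub_add_norm_sub (d2 g y) (d2 f y) (d2 f x)
    linarith [hf.d2_sub_le y x]
  have a2 : ‖eigvec g y - eigvec f x‖ ≤ 12 * (e₂ + C * ‖y - x‖) :=
    (norm_eigvecMap_sub_le _ _).trans (by linarith)
  have a3 : ‖eigvec g y‖ ≤ 12 * (C + 1) := by
    have h3 := norm_le_norm_add_norm_sub' (d2 g y) (d2 f y)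
    have := norm_eigvecMap_le (d2 g y)
    have := hf.d2_le y
    simp only [eigvec]
    linarith
  have b1 := abs_real_inner_le_norm (gradient g y - gradient f x) (eigvec g y)
  have b2 := abs_real_inner_le_norm (gradient f x) (eigvec g y - eigvec f x)
  have c1 : ‖gradient g y - gradient f x‖ * ‖eigvec g y‖
      ≤ (e₁ + C * ‖y - x‖) * (12 * (C + 1)) := by gcongr
  have c2 : ‖gradient f x‖ * ‖eigvec g y - eigvec f x‖
      ≤ C * (12 * (e₂ + C * ‖y - x‖)) := by
    gcongr
    exact hf.grad_le x
  rw [e1]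
  refine (abs_add_le _ _).trans ?_
  have d1 : 0 ≤ C * e₁ := by positivity
  have d2 : 0 ≤ C * e₂ := by positivity
  have d3 : 0 ≤ C * ‖y - x‖ := by positivity
  have d4 : 0 ≤ C ^ 2 * e₁ := by positivity
  have d5 : 0 ≤ C ^ 2 * e₂ := by positivity
  nlinarith

lemma abs_eigval_sub_le {f g : Plane → ℝ} {C : ℝ} (hf : DerivBounds f C) {x y : Plane}
    {e₂ : ℝ} (h2 : ‖d2 g y - d2 f y‖ ≤ e₂) :
    |eigval g y - eigval f x| ≤ 2 * (e₂ + C * ‖y - x‖) := by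
  have a2' : ‖d2 g y - d2 f x‖ ≤ e₂ + C * ‖y - x‖ := by
    have := norm_sub_le_norm_sub_add_norm_sub (d2 g y) (d2 f y) (d2 f x)
    linarith [hf.d2_sub_le y x]
  exact (abs_eigvalMap_sub_le _ _).trans (by linarith)

/-- The deterministic part of the assumptions. -/
structure Setup (f : Plane → ℝ) (H L : Set Plane) (a C : ℝ) : Prop where
  bounds : DerivBounds f C
  region : RegularRegion f H
  filament : IsFilament f H L a
  average : AverageNondegenerate f L a
  transversal : Transversal f L
  nondegenerate : NoDegenerate f (searchedSet f L a)

namespace Setup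

variable {f : Plane → ℝ} {H L : Set Plane} {a C : ℝ}

lemma tame (hs : Setup f H L a C) : Tame f := hs.bounds.tame

lemma isArgminAbs_hitTime (hs : Setup f H L a C) {x₀ : Plane} (hx₀ : x₀ ∈ startSet f L a) :
    IsArgminAbs (filamentTimes f x₀) (hitTime f x₀) := by
  obtain ⟨t, ht, -⟩ := hs.filament.existsUnique x₀ hx₀
  have := (isHitTime_hitTime f x₀).2
  exact this ⟨t, ht⟩

lemma hitPoint_mem (hs : Setup f H L a C) {x₀ : Plane} (hx₀ : x₀ ∈ startSet f L a) :
    hitPoint f x₀ ∈ L := by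
  rw [hs.filament.eq_hitPoints]; exact ⟨x₀, hx₀, rfl⟩

lemma slope_eq_zero (hs : Setup f H L a C) {x : Plane} (hx : x ∈ L) :
    slope f x = 0 ∧ eigval f x < 0 := by
  rw [hs.filament.eq_hitPoints] at hx
  obtain ⟨x₀, hx₀, rfl⟩ := hx
  exact (hs.isArgminAbs_hitTime hx₀).1

/-- A starting point is 𝔛_z(t) with z ∈ L and |t| ≤ a, and the flow returns to z after time −t,
which is therefore a competing filament time. -/
lemma abs_hitTime_le (hs : Setup f H L a C) {x₀ : Plane} (hx₀ : x₀ ∈ startSet f L a) :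
    |hitTime f x₀| ≤ a := by
  have harg := hs.isArgminAbs_hitTime hx₀
  obtain ⟨z, hz, t, ht, rfl⟩ := hx₀
  have hmem : -t ∈ filamentTimes f (path f z t) := by
    simp only [filamentTimes, Set.mem_ofPred_eq]
    rw [hs.tame.path_path, neg_add_cancel, hs.tame.path_zero]
    exact hs.slope_eq_zero hz
  refine (harg.2 _ hmem).trans ?_
  rw [abs_neg]
  exact abs_le.mpr ht

lemma subset_startSet (hs : Setup f H L a C) : L ⊆ startSet f L a := fun x hx =>
  ⟨x, hx, 0, ⟨by linarith [hs.filament.pos], hs.filament.pos.le⟩, (hs.tame.path_zero x).symm⟩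

lemma path_mem_startSet {z : Plane} (hz : z ∈ L) {t : ℝ} (ht : |t| ≤ a) :
    path f z t ∈ startSet f L a :=
  ⟨z, hz, t, abs_le.mp ht, rfl⟩

lemma isCompact_startSet (hs : Setup f H L a C) : IsCompact (startSet f L a) := by
  have h := (hs.filament.isCompact.prod (isCompact_Icc (a := -a) (b := a))).image
    hs.tame.continuous_uncurry_path
  convert h using 1
  ext y
  constructor
  · rintro ⟨x, hx, t, ht, rfl⟩
    exact ⟨(x, t), ⟨hx, ht⟩, rfl⟩
  · rintro ⟨⟨x, t⟩, ⟨hx, ht⟩, rfl⟩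
    exact ⟨x, hx, t, ht, rfl⟩

lemma gap_ne_zero (hs : Setup f H L a C) {x : Plane} (hx : x ∈ H) : gapMap (d2 f x) ≠ 0 :=
  gapMap_ne_zero (hs.bounds.contDiff.of_le (by norm_num)) (hs.region.distinct x hx)

lemma slopeDeriv_ne_zero (hs : Setup f H L a C) {x : Plane} (hx : x ∈ L) :
    slopeDeriv f x ≠ 0 := by
  rw [← inner_gradient_slope_eigvec hs.bounds.contDiff
    (hs.gap_ne_zero (hs.filament.subset hx))]
  exact hs.transversal x hx

lemma path_hitPoint (hs : Setup f H L a C) (x₀ : Plane) (s : ℝ) :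
    path f (hitPoint f x₀) s = path f x₀ (s + hitTime f x₀) := hs.tame.path_path _ _ _

lemma continuous_slope {g : Plane → ℝ} (hg : ContDiff ℝ 1 g) (ht : Tame g) :
    Continuous (slope g) :=
  (continuous_gradient hg).inner ht.continuous_eigvec

lemma continuous_eigval {g : Plane → ℝ} (ht : Tame g) : Continuous (eigval g) :=
  continuous_eigvalMap.comp ht.continuous_d2

/-- `g` is close to `f` in the sense needed for the consistency of hitting times. -/
def _root_.Filament.CloseTo (f : Plane → ℝ) (R η : ℝ) (g : Plane → ℝ) : Prop :=
  Tame g ∧ ContDiff ℝ 1 g ∧ ∀ x ∈ Metric.closedBall 0 R,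
    ‖gradient g x - gradient f x‖ ≤ η ∧ ‖d2 g x - d2 f x‖ ≤ η

lemma _root_.Filament.CloseTo.mono {R η η' : ℝ} {g : Plane → ℝ} (hg : CloseTo f R η g)
    (h : η ≤ η') : CloseTo f R η' g :=
  ⟨hg.1, hg.2.1, fun x hx => ⟨(hg.2.2 x hx).1.trans h, (hg.2.2 x hx).2.trans h⟩⟩

/-- The perturbation lemma is applied to the slope and λ₂ along the curve of f from x₀, compared
with the curve of g from a neighbouring x₁. Moving the starting point as well prepares the
compactness argument. -/
lemma local_consistency (hs : Setup f H L a C) {R : ℝ}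
    (hR : Confining f (startSet f L a) (a + 1) R) {x₀ : Plane} (hx₀ : x₀ ∈ startSet f L a)
    {ρ : ℝ} (hρ : 0 < ρ) :
    ∃ η : ℝ, 0 < η ∧ ∀ g, CloseTo f R η g → ∀ x₁ ∈ startSet f L a, ‖x₁ - x₀‖ ≤ η →
      (∃ t, IsArgminAbs (filamentTimes g x₁) t) ∧
        ∀ t, IsArgminAbs (filamentTimes g x₁) t → |t - hitTime f x₀| ≤ ρ := by
  have ha := hs.filament.pos
  have hC := hs.bounds.one_le
  have hargmin := hs.isArgminAbs_hitTime hx₀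
  have hTa := hs.abs_hitTime_le hx₀
  have hxL := hs.hitPoint_mem hx₀
  have hcs := continuous_slope (hs.bounds.contDiff.of_le (by norm_num)) hs.tame
  have hce := continuous_eigval hs.tame
  obtain ⟨η, hη, hpert⟩ := exists_argmin_of_perturbation
    (hcs.comp (hs.tame.continuous_path x₀)) (hce.comp (hs.tame.continuous_path x₀))
    (T := hitTime f x₀) hargmin.1.1 hargmin.1.2
    (hasDerivAt_slope_path hs.bounds.contDiff hs.tame
      (hs.gap_ne_zero (hs.filament.subset hxL)))
    (hs.slopeDeriv_ne_zero hxL)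
    -- A filament time of modulus at most |θ| is itself a minimizer, hence equal to θ.
    (fun t ht h1 h2 => by
      have h3 : IsArgminAbs (filamentTimes f x₀) t :=
        ⟨⟨h1, h2⟩, fun s hs' => ht.trans (hargmin.2 s hs')⟩
      exact (hs.filament.existsUnique x₀ hx₀).unique h3 hargmin)
    -- A zero of the slope with λ₂ = 0, met no later than |θ|, could become a spurious filament time
    -- after perturbation; nondegeneracy on the searched set rules it out.
    (fun t ht h1 h2 => by
      have : path f x₀ t ∈ {x ∈ searchedSet f L a | eigval f x = 0 ∧ slope f x = 0} :=
        ⟨⟨x₀, hx₀, t, ht, rfl⟩, h2, h1⟩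
      rw [hs.nondegenerate] at this
      exact this) hρ
  obtain ⟨M, hM, hstab⟩ := exists_path_stability hs.bounds (by linarith) hR
  set B : ℝ := 24 * (C + 1) ^ 2 * (2 + 2 * M) with hB
  have hB0 : 0 < B := by positivity
  refine ⟨min 1 (η / B), by positivity, fun g hg x₁ hx₁ hdist => ?_⟩
  set e := min 1 (η / B) with he
  have he1 : e ≤ 1 := min_le_left _ _
  have heB : B * e ≤ η := by
    have : e ≤ η / B := min_le_right _ _
    rw [le_div_iff₀ hB0] at this
    linarith
  have he0 : 0 < e := by positivity
  refine hpert (fun t => slope g (path g x₁ t)) (fun t => eigval g (path g x₁ t))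
    ((continuous_slope hg.2.1 hg.1).comp (hg.1.continuous_path x₁)) fun t ht => ?_
  have ht' : |t| ≤ a + 1 := by linarith
  have hmem : path g x₁ t ∈ Metric.closedBall 0 R :=
    hR g hg.1 (fun x hx => (hg.2.2 x hx).2.trans he1) x₁ hx₁ t ht'
  have hst := hstab g hg.1 e he1 (fun x hx => (hg.2.2 x hx).2) x₀ x₁ hx₁ t ht'
  have hst' : ‖path g x₁ t - path f x₀ t‖ ≤ 2 * M * e := by nlinarith
  constructor
  · have := abs_slope_sub_le hs.bounds (x := path f x₀ t) he1 (hg.2.2 _ hmem).1 (hg.2.2 _ hmem).2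
    refine this.trans (le_trans ?_ heB)
    rw [hB, mul_assoc _ (2 + 2 * M)]
    gcongr
    linarith
  · have := abs_eigval_sub_le hs.bounds (x := path f x₀ t) (hg.2.2 _ hmem).2
    refine this.trans (le_trans ?_ heB)
    calc 2 * (e + C * ‖path g x₁ t - path f x₀ t‖) ≤ 2 * (e + C * (2 * M * e)) := by gcongr
      _ = 2 * (1 + 2 * C * M) * e := by ring
      _ ≤ B * e := by
        gcongr
        rw [hB]
        nlinarith [mul_pos (show 0 < C by linarith) (show 0 < M by linarith)]

/-- The hitting times of estimates close to `f` are uniformly close to those of `f`. -/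
lemma consistency (hs : Setup f H L a C) {R : ℝ}
    (hR : Confining f (startSet f L a) (a + 1) R) {ρ : ℝ} (hρ : 0 < ρ) :
    ∃ η : ℝ, 0 < η ∧ ∀ g, CloseTo f R η g → ∀ x₀ ∈ startSet f L a, ∀ t, IsHitTime g x₀ t →
      t ∈ filamentTimes g x₀ ∧ |t - hitTime f x₀| ≤ ρ := by
  -- Compactness induction runs over arbitrary sets s, so membership in the set of starting points
  -- is carried along separately.
  suffices h : ∃ η : ℝ, 0 < η ∧ ∀ g, CloseTo f R η g → ∀ x₀ ∈ startSet f L a,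
      x₀ ∈ startSet f L a → ∀ t, IsHitTime g x₀ t →
      t ∈ filamentTimes g x₀ ∧ |t - hitTime f x₀| ≤ ρ by
    obtain ⟨η, hη, h⟩ := h
    exact ⟨η, hη, fun g hg x₀ hx₀ => h g hg x₀ hx₀ hx₀⟩
  refine hs.isCompact_startSet.induction_on
    (p := fun s => ∃ η : ℝ, 0 < η ∧ ∀ g, CloseTo f R η g → ∀ x₀ ∈ s, x₀ ∈ startSet f L a →
      ∀ t, IsHitTime g x₀ t → t ∈ filamentTimes g x₀ ∧ |t - hitTime f x₀| ≤ ρ) ?_ ?_ ?_ ?_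
  · exact ⟨1, one_pos, fun g _ x₀ hx₀ => hx₀.elim⟩
  · rintro s t hst ⟨η, hη, h⟩
    exact ⟨η, hη, fun g hg x₀ hx₀ => h g hg x₀ (hst hx₀)⟩
  · rintro s t ⟨η₁, hη₁, h₁⟩ ⟨η₂, hη₂, h₂⟩
    refine ⟨min η₁ η₂, lt_min hη₁ hη₂, fun g hg x₀ hx₀ => ?_⟩
    rcases hx₀ with hx₀ | hx₀
    · exact h₁ g (hg.mono (min_le_left _ _)) x₀ hx₀
    · exact h₂ g (hg.mono (min_le_right _ _)) x₀ hx₀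
  · intro x₀ hx₀
    obtain ⟨η, hη, h⟩ := hs.local_consistency hR hx₀ (half_pos hρ)
    refine ⟨Metric.closedBall x₀ η, mem_nhdsWithin_of_mem_nhds (Metric.closedBall_mem_nhds _ hη),
      η, hη, fun g hg x₁ hx₁ hx₁' t ht => ?_⟩
    rw [Metric.mem_closedBall, dist_eq_norm] at hx₁
    obtain ⟨hex, hall⟩ := h g hg x₁ hx₁' hx₁
    -- Since f is close to itself, the same local statement bounds the change of its own hitting
    -- time between x₀ and x₁. This replaces a separate proof that θ is continuous in the starting
    -- point.
    have hself : CloseTo f R η f := ⟨hs.tame, hs.bounds.contDiff.of_le (by norm_num),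
      fun x _ => by simp [hη.le]⟩
    have h1 := (h f hself x₁ hx₁' hx₁).2 _ (hs.isArgminAbs_hitTime hx₁')
    have h2 := hall t (ht.2 hex)
    refine ⟨(ht.2 hex).1, ?_⟩
    have := abs_sub_le t (hitTime f x₀) (hitTime f x₁)
    rw [abs_sub_comm (hitTime f x₀)] at this
    linarith

end Setup

/-! ### Linearization of the hitting time -/

lemma norm_eigvecDeriv_sub_le_mul {p p' : Space3} {c : ℝ} (hc : 0 < c) (hp : c ≤ ‖gapMap p‖)
    (hp' : gapMap p' ≠ 0) : ‖eigvecDeriv p - eigvecDeriv p'‖ ≤ 24 / c * ‖p - p'‖ := by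
  have h0 : gapMap p ≠ 0 := norm_pos_iff.mp (hc.trans_le hp)
  refine (norm_eigvecDeriv_sub_le h0 hp').trans ?_
  rw [div_mul_eq_mul_div]
  gcongr

/-- The third derivatives occur in ã' only through ⟨∇f, ∇V V⟩. Keeping ‖∇f(x)‖ as a factor of e₃,
instead of bounding it by C, is what yields the better rate at critical points. Of the other factors
only the derivative of G needs the gap. -/
lemma abs_slopeDeriv_sub_le {f : Plane → ℝ} {C c : ℝ} (hf : DerivBounds f C) (hc : 0 < c) :
    ∃ B, 0 < B ∧ ∀ g, ContDiff ℝ 3 g → ∀ x w : Plane, ∀ e₁ e₂ e₃ : ℝ, e₂ ≤ 1 → e₃ ≤ 1 →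
      c ≤ ‖gapMap (d2 f x)‖ → gapMap (d2 g w) ≠ 0 →
      ‖gradient g w - gradient f w‖ ≤ e₁ → ‖d2 g w - d2 f w‖ ≤ e₂ →
      ‖fderiv ℝ (d2 g) w - fderiv ℝ (d2 f) w‖ ≤ e₃ →
      |slopeDeriv g w - slopeDeriv f x|
        ≤ B * (e₁ + e₂ + ‖w - x‖ + ‖gradient f x‖ * e₃) := by
  have hC := hf.one_le
  refine ⟨C * (144 * (C + 1) ^ 2) + (C * (24 / c * C * ((C + 1) * (12 * (C + 1))))
    + (1 + C * C) * (144 * (C + 1)) + C * (144 * C * C)) + (2 * C * (12 * (C + 1)) ^ 2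
    + 2 * C * (12 * C * (24 * (C + 1)))), by positivity, ?_⟩
  intro g hg x w e₁ e₂ e₃ he₂ he₃ hx hw h1 h2 h3
  have hx0 : gapMap (d2 f x) ≠ 0 := norm_pos_iff.mp (hc.trans_le hx)
  have he₁0 : 0 ≤ e₁ := (norm_nonneg _).trans h1
  have he₂0 : 0 ≤ e₂ := (norm_nonneg _).trans h2
  have he₃0 : 0 ≤ e₃ := (norm_nonneg _).trans h3
  have hG := hf.grad_le x
  rw [slopeDeriv_eq hg hw, slopeDeriv_eq hf.contDiff hx0]
  set p := d2 g w
  set p' := d2 f x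
  set T := fderiv ℝ (d2 g) w
  set T' := fderiv ℝ (d2 f) x
  set v := eigvecMap p with hv
  set v' := eigvecMap p' with hv'
  set G := ‖gradient f x‖ with hGdef
  have hG0 : 0 ≤ G := norm_nonneg _
  set d := ‖w - x‖ with hd
  have hd0 : 0 ≤ d := norm_nonneg _
  set s := e₁ + e₂ + d + G * e₃ with hsdef
  have hGe : 0 ≤ G * e₃ := by positivity
  have hs0 : 0 ≤ s := by positivity
  have hCd : C * d ≤ C * s := by gcongr; linarith
  have hpp : ‖p - p'‖ ≤ C * s := by
    have := norm_sub_le_norm_sub_add_norm_sub p (d2 f w) p'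
    have h4 := hf.d2_sub_le w x
    calc ‖p - p'‖ ≤ e₂ + C * d := by linarith
      _ ≤ C * e₂ + C * d := by nlinarith
      _ ≤ C * s := by rw [← mul_add]; gcongr; linarith
  have hTT : ‖T - T'‖ ≤ e₃ + C * d := by
    have := norm_sub_le_norm_sub_add_norm_sub T (fderiv ℝ (d2 f) w) T'
    have h4 := hf.d3_sub_le w x
    linarith
  have hgg : ‖gradient g w - gradient f x‖ ≤ C * s := by
    have := norm_sub_le_norm_sub_add_norm_sub (gradient g w) (gradient f w) (gradient f x)
    have h4 := hf.grad_sub_le w x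
    calc _ ≤ e₁ + C * d := by linarith
      _ ≤ C * e₁ + C * d := by nlinarith
      _ ≤ C * s := by rw [← mul_add]; gcongr; linarith
  have hp : ‖p‖ ≤ C + 1 := by
    have h4 := norm_le_norm_add_norm_sub' p (d2 f w)
    have h5 := hf.d2_le w
    linarith
  have hT : ‖T‖ ≤ C + 1 := by
    have h4 := norm_le_norm_add_norm_sub' T (fderiv ℝ (d2 f) w)
    have h5 := hf.d3_le w
    linarith
  have hT' : ‖T'‖ ≤ C := hf.d3_le x
  have hvb : ‖v‖ ≤ 12 * (C + 1) := (norm_eigvecMap_le p).trans (by gcongr)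
  have hvb' : ‖v'‖ ≤ 12 * C := (norm_eigvecMap_le p').trans (by gcongr; exact hf.d2_le x)
  have hvv : ‖v - v'‖ ≤ 12 * (C * s) := (norm_eigvecMap_sub_le p p').trans (by gcongr)
  have hDD : ‖eigvecDeriv p - eigvecDeriv p'‖ ≤ 24 / c * (C * s) := by
    rw [norm_sub_rev]
    refine (norm_eigvecDeriv_sub_le_mul hc hx hw).trans ?_
    rw [norm_sub_rev]
    gcongr
  have hTv : ‖T v‖ ≤ (C + 1) * (12 * (C + 1)) :=
    (T.le_opNorm v).trans (by gcongr)
  -- Telescoping over the factors, one changed at a time. The error T − T' of the third derivatives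
  -- is tested against ∇f(x), the change of gradient having been split off first.
  have e1 : inner ℝ (gradient g w) (eigvecDeriv p (T v)) + eigvalMap p * ‖v‖ ^ 2
      - (inner ℝ (gradient f x) (eigvecDeriv p' (T' v')) + eigvalMap p' * ‖v'‖ ^ 2)
      = inner ℝ (gradient g w - gradient f x) (eigvecDeriv p (T v))
        + (inner ℝ (gradient f x) ((eigvecDeriv p - eigvecDeriv p') (T v))
          + inner ℝ (gradient f x) (eigvecDeriv p' ((T - T') v))
          + inner ℝ (gradient f x) (eigvecDeriv p' (T' (v - v'))))
        + ((eigvalMap p - eigvalMap p') * ‖v‖ ^ 2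
          + eigvalMap p' * ((‖v‖ - ‖v'‖) * (‖v‖ + ‖v'‖))) := by
    simp only [sub_apply, map_sub, inner_sub_left, inner_sub_right]
    ring
  have t1 : |inner ℝ (gradient g w - gradient f x) (eigvecDeriv p (T v))|
      ≤ C * (144 * (C + 1) ^ 2) * s := by
    refine (abs_real_inner_le_norm _ _).trans ?_
    calc _ ≤ (C * s) * (12 * ((C + 1) * (12 * (C + 1)))) := by
          gcongr
          exact (norm_eigvecDeriv_apply_le _ _).trans (by gcongr)
      _ = _ := by ring
  have t2 : |inner ℝ (gradient f x) ((eigvecDeriv p - eigvecDeriv p') (T v))|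
      ≤ C * (24 / c * C * ((C + 1) * (12 * (C + 1)))) * s := by
    refine (abs_real_inner_le_norm _ _).trans ?_
    calc _ ≤ C * ((24 / c * (C * s)) * ((C + 1) * (12 * (C + 1)))) := by
          refine mul_le_mul hG ?_ (norm_nonneg _) (by positivity)
          exact (ContinuousLinearMap.le_opNorm _ _).trans (by gcongr)
      _ = _ := by ring
  have t3 : |inner ℝ (gradient f x) (eigvecDeriv p' ((T - T') v))|
      ≤ (1 + C * C) * (144 * (C + 1)) * s := by
    refine (abs_real_inner_le_norm _ _).trans ?_
    have h4 : ‖eigvecDeriv p' ((T - T') v)‖ ≤ 12 * ((e₃ + C * d) * (12 * (C + 1))) := by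
      refine (norm_eigvecDeriv_apply_le _ _).trans ?_
      gcongr
      exact (ContinuousLinearMap.le_opNorm _ _).trans (by gcongr)
    calc _ ≤ G * (12 * ((e₃ + C * d) * (12 * (C + 1)))) := by gcongr
      _ = (G * e₃ + G * (C * d)) * (144 * (C + 1)) := by ring
      _ ≤ (s + C * (C * s)) * (144 * (C + 1)) := by
          gcongr
          linarith
      _ = _ := by ring
  have t4 : |inner ℝ (gradient f x) (eigvecDeriv p' (T' (v - v')))|
      ≤ C * (144 * C * C) * s := by
    refine (abs_real_inner_le_norm _ _).trans ?_
    have h4 : ‖eigvecDeriv p' (T' (v - v'))‖ ≤ 12 * (C * (12 * (C * s))) := by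
      refine (norm_eigvecDeriv_apply_le _ _).trans ?_
      gcongr
      exact (ContinuousLinearMap.le_opNorm _ _).trans (by gcongr)
    calc _ ≤ C * (12 * (C * (12 * (C * s)))) := by gcongr
      _ = _ := by ring
  have t5 : |(eigvalMap p - eigvalMap p') * ‖v‖ ^ 2| ≤ 2 * C * (12 * (C + 1)) ^ 2 * s := by
    rw [abs_mul, abs_of_nonneg (sq_nonneg ‖v‖)]
    calc _ ≤ (2 * (C * s)) * (12 * (C + 1)) ^ 2 := by
          gcongr
          exact (abs_eigvalMap_sub_le p p').trans (by gcongr)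
      _ = _ := by ring
  have t6 : |eigvalMap p' * ((‖v‖ - ‖v'‖) * (‖v‖ + ‖v'‖))|
      ≤ 2 * C * (12 * C * (24 * (C + 1))) * s := by
    rw [abs_mul, abs_mul, abs_of_nonneg (show 0 ≤ ‖v‖ + ‖v'‖ by positivity)]
    have h4 : |‖v‖ - ‖v'‖| ≤ 12 * (C * s) := (abs_norm_sub_norm_le _ _).trans hvv
    have h5 : |eigvalMap p'| ≤ 2 * C := (abs_eigvalMap_le p').trans (by gcongr; exact hf.d2_le x)
    have h6 : ‖v‖ + ‖v'‖ ≤ 24 * (C + 1) := by linarith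
    calc _ ≤ (2 * C) * ((12 * (C * s)) * (24 * (C + 1))) := by gcongr
      _ = _ := by ring
  rw [e1]
  refine (abs_add_le _ _).trans ?_
  have a1 := abs_add_le (inner ℝ (gradient g w - gradient f x) (eigvecDeriv p (T v)))
    (inner ℝ (gradient f x) ((eigvecDeriv p - eigvecDeriv p') (T v))
          + inner ℝ (gradient f x) (eigvecDeriv p' ((T - T') v))
          + inner ℝ (gradient f x) (eigvecDeriv p' (T' (v - v'))))
  have a2 := abs_add_three (inner ℝ (gradient f x) ((eigvecDeriv p - eigvecDeriv p') (T v)))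
    (inner ℝ (gradient f x) (eigvecDeriv p' ((T - T') v)))
    (inner ℝ (gradient f x) (eigvecDeriv p' (T' (v - v'))))
  have a3 := abs_add_le ((eigvalMap p - eigvalMap p') * ‖v‖ ^ 2)
    (eigvalMap p' * ((‖v‖ - ‖v'‖) * (‖v‖ + ‖v'‖)))
  rw [add_mul, add_mul, add_mul, add_mul, add_mul]
  linarith

/-- `g` approximates `f` on the ball of radius `R`, with errors `e₁`, `e₂`, `e₃` in the first,
second and third derivatives. -/
structure Approx (f : Plane → ℝ) (R e₁ e₂ e₃ : ℝ) (g : Plane → ℝ) : Prop where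
  tame : Tame g
  contDiff : ContDiff ℝ 3 g
  grad : ∀ x ∈ Metric.closedBall 0 R, ‖gradient g x - gradient f x‖ ≤ e₁
  d2 : ∀ x ∈ Metric.closedBall 0 R, ‖Filament.d2 g x - Filament.d2 f x‖ ≤ e₂
  d3 : ∀ x ∈ Metric.closedBall 0 R,
    ‖fderiv ℝ (Filament.d2 g) x - fderiv ℝ (Filament.d2 f) x‖ ≤ e₃

lemma Approx.norm_eigvec_le {f g : Plane → ℝ} {R e₁ e₂ e₃ C : ℝ} (hf : DerivBounds f C)
    (hg : Approx f R e₁ e₂ e₃ g) (he₂ : e₂ ≤ 1) {x : Plane} (hx : x ∈ Metric.closedBall 0 R) :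
    ‖eigvec g x‖ ≤ 12 * (C + 1) := by
  have h3 := norm_le_norm_add_norm_sub' (Filament.d2 g x) (Filament.d2 f x)
  have := norm_eigvecMap_le (Filament.d2 g x)
  have := hf.d2_le x
  have := hg.d2 x hx
  simp only [eigvec]
  linarith

/-- The constant in `Tame` depends on g. A Lipschitz constant uniform over all approximations comes
from their third derivatives on the ball, which is convex. -/
lemma Approx.norm_eigvec_sub_le {f g : Plane → ℝ} {R e₁ e₂ e₃ C : ℝ} (hf : DerivBounds f C)
    (hg : Approx f R e₁ e₂ e₃ g) (he₃ : e₃ ≤ 1) {x y : Plane}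
    (hx : x ∈ Metric.closedBall 0 R) (hy : y ∈ Metric.closedBall 0 R) :
    ‖eigvec g x - eigvec g y‖ ≤ 12 * (C + 1) * ‖x - y‖ := by
  have h := Convex.norm_image_sub_le_of_norm_fderiv_le (𝕜 := ℝ) (f := Filament.d2 g)
    (s := Metric.closedBall 0 R) (C := C + 1) (x := y) (y := x)
    (fun z _ => differentiable_d2 hg.contDiff z)
    (fun z hz => by
      have h4 := norm_le_norm_add_norm_sub' (fderiv ℝ (Filament.d2 g) z)
        (fderiv ℝ (Filament.d2 f) z)
      have h5 := hf.d3_le z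
      have h6 := hg.d3 z hz
      linarith) (convex_closedBall _ _) hy hx
  have := norm_eigvecMap_sub_le (Filament.d2 g x) (Filament.d2 g y)
  simp only [eigvec]
  linarith

namespace Setup

variable {f : Plane → ℝ} {H L : Set Plane} {a C : ℝ}

lemma exists_gap_lower (hs : Setup f H L a C) :
    ∃ c, 0 < c ∧ ∀ x ∈ H, c ≤ ‖gapMap (d2 f x)‖ := by
  rcases H.eq_empty_or_nonempty with rfl | hne
  · exact ⟨1, one_pos, fun x hx => hx.elim⟩
  · obtain ⟨x₀, hx₀, hmin⟩ := hs.region.isCompact.exists_isMinOn hne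
      (gapMap.continuous.comp hs.tame.continuous_d2).norm.continuousOn
    exact ⟨_, norm_pos_iff.mpr (hs.gap_ne_zero hx₀), fun x hx => hmin hx⟩

/-- Comparing f with itself shows that ã' is Lipschitz on L, so |ã'| attains a positive minimum on
this compact set. -/
lemma exists_slopeDeriv_lower (hs : Setup f H L a C) :
    ∃ c, 0 < c ∧ ∀ x ∈ L, c ≤ |slopeDeriv f x| := by
  rcases L.eq_empty_or_nonempty with h0 | hne
  · exact ⟨1, one_pos, fun x hx => by rw [h0] at hx; exact hx.elim⟩
  obtain ⟨c, hc, hgap⟩ := hs.exists_gap_lower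
  obtain ⟨B, hB, hsub⟩ := abs_slopeDeriv_sub_le hs.bounds hc
  have hcont : ContinuousOn (slopeDeriv f) L := by
    have : LipschitzOnWith B.toNNReal (slopeDeriv f) L := by
      refine LipschitzOnWith.of_dist_le_mul fun w hw x hx => ?_
      rw [Real.coe_toNNReal _ hB.le, Real.dist_eq, dist_eq_norm]
      simpa using hsub f hs.bounds.contDiff x w 0 0 0 zero_le_one zero_le_one
        (hgap x (hs.filament.subset hx)) (hs.gap_ne_zero (hs.filament.subset hw))
        (by simp) (by simp) (by simp)
    exact this.continuousOn
  obtain ⟨x₀, hx₀, hmin⟩ := hs.filament.isCompact.exists_isMinOn hne hcont.abs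
  exact ⟨_, abs_pos.mpr (hs.slopeDeriv_ne_zero hx₀), fun x hx => hmin hx⟩

set_option maxHeartbeats 1000000 in
/-- The hitting time of an estimate, linearized in the slope at time `θ`. -/
lemma residual (hs : Setup f H L a C) {R : ℝ}
    (hR : Confining f (startSet f L a) (a + 1) R) :
    ∃ η B : ℝ, 0 < η ∧ 0 < B ∧ ∀ g e₁ e₂ e₃, Approx f R e₁ e₂ e₃ g →
      e₁ ≤ η → e₂ ≤ η → e₃ ≤ η → ∀ x₀ ∈ startSet f L a, ∀ t, IsHitTime g x₀ t →
      |t - hitTime f x₀ + (slopeDeriv f (hitPoint f x₀))⁻¹ * slope g (path g x₀ (hitTime f x₀))|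
        ≤ B * (|slope g (path g x₀ (hitTime f x₀))| *
          (e₁ + e₂ + ‖path g x₀ (hitTime f x₀) - hitPoint f x₀‖
            + |slope g (path g x₀ (hitTime f x₀))| + ‖gradient f (hitPoint f x₀)‖ * e₃)) := by
  have ha := hs.filament.pos
  have hC := hs.bounds.one_le
  obtain ⟨c, hc, hgap⟩ := hs.exists_gap_lower
  obtain ⟨c', hc', hsd⟩ := hs.exists_slopeDeriv_lower
  obtain ⟨B, hB, hsub⟩ := abs_slopeDeriv_sub_le hs.bounds hc
  obtain ⟨M, hM, hstab⟩ := exists_path_stability hs.bounds (by linarith) hR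
  -- the size of the time window on which the slope is monotone
  set q : ℝ := min (c / (8 * C)) (c' / (16 * B * C)) with hq
  have hq0 : 0 < q := by positivity
  have hq1 : q ≤ c / (8 * C) := min_le_left _ _
  have hq2 : q ≤ c' / (16 * B * C) := min_le_right _ _
  rw [le_div_iff₀ (by positivity)] at hq1 hq2
  -- At speed at most 12(C + 1) the curve moves by at most q/2 during the window. The choice of η'
  -- below bounds the displacement at time θ by q/2 as well, so the whole window stays within q of
  -- the filament point.
  set ρ : ℝ := min 1 (q / (24 * (C + 1))) with hρdef
  have hρ0 : 0 < ρ := by positivity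
  have hρ1 : ρ ≤ 1 := min_le_left _ _
  have hρ2 : ρ ≤ q / (24 * (C + 1)) := min_le_right _ _
  rw [le_div_iff₀ (by positivity)] at hρ2
  obtain ⟨η, hη, hcons⟩ := hs.consistency hR hρ0
  set η' : ℝ := min (min 1 η) (q / (2 * M)) with hη'
  have hη1 : η' ≤ 1 := (min_le_left _ _).trans (min_le_left _ _)
  have hη2 : η' ≤ η := (min_le_left _ _).trans (min_le_right _ _)
  have hη3 : η' ≤ q / (2 * M) := min_le_right _ _
  rw [le_div_iff₀ (by positivity)] at hη3
  have hη0 : 0 < η' := by positivity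
  have hη4 : η' ≤ q := by nlinarith
  refine ⟨η', B * (2 / c' ^ 2) * (1 + 24 * (C + 1) / c'), hη0, by positivity, ?_⟩
  intro g e₁ e₂ e₃ hg he₁ he₂ he₃ x₀ hx₀ t ht
  have hclose : CloseTo f R η' g := ⟨hg.tame, hg.contDiff.of_le (by norm_num),
    fun x hx => ⟨(hg.grad x hx).trans he₁, (hg.d2 x hx).trans he₂⟩⟩
  obtain ⟨htmem, htθ⟩ := hcons g (hclose.mono hη2) x₀ hx₀ t ht
  have hθa := hs.abs_hitTime_le hx₀
  have hxL := hs.hitPoint_mem hx₀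
  have hmem : ∀ τ, |τ| ≤ a + 1 → path g x₀ τ ∈ Metric.closedBall 0 R := fun τ hτ =>
    hR g hg.tame (fun x hx => (hg.d2 x hx).trans (he₂.trans hη1)) x₀ hx₀ τ hτ
  set θ := hitTime f x₀ with hθ
  set x := hitPoint f x₀ with hx
  set y := path g x₀ θ with hy
  have hδ : ‖y - x‖ ≤ q / 2 := by
    have := hstab g hg.tame η' hη1 (fun x hx => (hg.d2 x hx).trans he₂) x₀ x₀ hx₀ θ
      (by linarith)
    rw [sub_self, norm_zero, zero_add] at this
    have h2 : path f x₀ θ = x := rfl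
    rw [h2] at this
    linarith
  have hball := hmem θ (by linarith)
  have he₁0 : 0 ≤ e₁ := (norm_nonneg _).trans (hg.grad _ hball)
  have he₂0 : 0 ≤ e₂ := (norm_nonneg _).trans (hg.d2 _ hball)
  have he₃0 : 0 ≤ e₃ := (norm_nonneg _).trans (hg.d3 _ hball)
  have htime : ∀ τ, |τ - θ| ≤ |t - θ| → |τ| ≤ a + 1 := fun τ hτ => by
    have := abs_add_le (τ - θ) θ
    rw [sub_add_cancel] at this
    linarith
  -- along the window the curve stays near the filament point
  have hdist : ∀ τ, |τ - θ| ≤ |t - θ| →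
      ‖path g x₀ τ - x‖ ≤ ‖y - x‖ + 12 * (C + 1) * |t - θ| := by
    intro τ hτ
    have h1 := Convex.norm_image_sub_le_of_norm_hasDerivWithin_le (𝕜 := ℝ)
      (f := path g x₀) (f' := fun s => eigvec g (path g x₀ s))
      (s := Metric.closedBall θ |t - θ|) (C := 12 * (C + 1)) (x := θ) (y := τ)
      (fun s _ => (hg.tame.hasDerivAt_path x₀ s).hasDerivWithinAt)
      (fun s hs' => hg.norm_eigvec_le hs.bounds (he₂.trans hη1) (hmem s (htime s (by
        rwa [Metric.mem_closedBall, Real.dist_eq] at hs'))))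
      (convex_closedBall _ _) (Metric.mem_closedBall_self (abs_nonneg _))
      (by rwa [Metric.mem_closedBall, Real.dist_eq])
    have h2 := norm_sub_le_norm_sub_add_norm_sub (path g x₀ τ) y x
    rw [Real.norm_eq_abs] at h1
    have h3 : 12 * (C + 1) * |τ - θ| ≤ 12 * (C + 1) * |t - θ| := by gcongr
    linarith
  have hwin : 12 * (C + 1) * |t - θ| ≤ q / 2 := by
    have : 12 * (C + 1) * |t - θ| ≤ 12 * (C + 1) * ρ := by gcongr
    linarith
  have hgapx : c ≤ ‖gapMap (d2 f x)‖ := hgap x (hs.filament.subset hxL)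
  -- A zero gap of g in the window would give a gap of f at x of at most 2(η' + Cq) ≤ 4Cq ≤ c/2.
  have hgapw : ∀ τ, |τ - θ| ≤ |t - θ| → gapMap (d2 g (path g x₀ τ)) ≠ 0 := by
    intro τ hτ h0
    set w := path g x₀ τ
    have h1 := hdist τ hτ
    have h2 : ‖d2 g w - d2 f x‖ ≤ η' + C * q := by
      have h3 := norm_sub_le_norm_sub_add_norm_sub (d2 g w) (d2 f w) (d2 f x)
      have h4 := hg.d2 w (hmem τ (htime τ hτ))
      have h5 := hs.bounds.d2_sub_le w x
      have h6 : C * ‖w - x‖ ≤ C * q := by gcongr; linarith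
      linarith
    have h3 := norm_gapMap_le (d2 g w - d2 f x)
    rw [map_sub, h0, zero_sub, norm_neg] at h3
    nlinarith
  set G := ‖gradient f x‖ with hG
  have hG0 : 0 ≤ G := norm_nonneg _
  have hGC : G ≤ C := hs.bounds.grad_le x
  have hderiv : ∀ τ, |τ - θ| ≤ |t - θ| → |slopeDeriv g (path g x₀ τ) - slopeDeriv f x|
      ≤ B * (e₁ + e₂ + (‖y - x‖ + 12 * (C + 1) * |t - θ|) + G * e₃) := by
    intro τ hτ
    have hw := hmem τ (htime τ hτ)
    refine (hsub g hg.contDiff x (path g x₀ τ) e₁ e₂ e₃ (he₂.trans hη1) (he₃.trans hη1) hgapx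
      (hgapw τ hτ) (hg.grad _ hw) (hg.d2 _ hw) (hg.d3 _ hw)).trans ?_
    gcongr
    exact hdist τ hτ
  -- The bracket is at most 8Cq, and q ≤ c'/(16BC); so the derivative of the slope keeps at least
  -- half the size of ã'(x) throughout the window.
  have hsmall : B * (e₁ + e₂ + (‖y - x‖ + 12 * (C + 1) * |t - θ|) + G * e₃) ≤ c' / 2 := by
    have h1 : G * e₃ ≤ C * q := by
      refine mul_le_mul hGC (by linarith) he₃0 (by linarith)
    have h2 : q ≤ C * q := by nlinarith
    calc _ ≤ B * (8 * (C * q)) := by gcongr; linarith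
      _ = q * (16 * B * C) / 2 := by ring
      _ ≤ c' / 2 := by gcongr
  set S := slope g y with hS
  have hsdx := hsd x hxL
  have hsd0 : slopeDeriv f x ≠ 0 := hs.slopeDeriv_ne_zero hxL
  -- mean value theorem
  obtain ⟨D, hD, hDeq⟩ : ∃ D, |D - slopeDeriv f x|
      ≤ B * (e₁ + e₂ + (‖y - x‖ + 12 * (C + 1) * |t - θ|) + G * e₃) ∧ -S = D * (t - θ) := by
    have hzero : slope g (path g x₀ t) = 0 := htmem.1
    have hF : ∀ τ, |τ - θ| ≤ |t - θ| → HasDerivAt (fun s => slope g (path g x₀ s))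
        (slopeDeriv g (path g x₀ τ)) τ := fun τ hτ =>
      hasDerivAt_slope_path hg.contDiff hg.tame (hgapw τ hτ)
    rcases lt_trichotomy t θ with hlt | heq | hgt
    · have hin : ∀ τ, t ≤ τ → τ ≤ θ → |τ - θ| ≤ |t - θ| := fun τ h1 h2 => by
        rw [abs_of_nonpos (by linarith), abs_of_nonpos (by linarith)]; linarith
      obtain ⟨τ, hτ, hτeq⟩ := exists_hasDerivAt_eq_slope (fun s => slope g (path g x₀ s))
        (fun τ => slopeDeriv g (path g x₀ τ)) hlt
        (fun τ hτ => (hF τ (hin τ hτ.1 hτ.2)).continuousAt.continuousWithinAt)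
        (fun τ hτ => hF τ (hin τ hτ.1.le hτ.2.le))
      refine ⟨_, hderiv τ (hin τ hτ.1.le hτ.2.le), ?_⟩
      rw [hτeq, hzero]
      have : θ - t ≠ 0 := by linarith
      field_simp
      ring
    · refine ⟨slopeDeriv f x, by rw [sub_self, abs_zero]; positivity, ?_⟩
      rw [heq] at hzero ⊢
      rw [hS, hy, hzero]; simp
    · have hin : ∀ τ, θ ≤ τ → τ ≤ t → |τ - θ| ≤ |t - θ| := fun τ h1 h2 => by
        rw [abs_of_nonneg (by linarith), abs_of_nonneg (by linarith)]; linarith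
      obtain ⟨τ, hτ, hτeq⟩ := exists_hasDerivAt_eq_slope (fun s => slope g (path g x₀ s))
        (fun τ => slopeDeriv g (path g x₀ τ)) hgt
        (fun τ hτ => (hF τ (hin τ hτ.1 hτ.2)).continuousAt.continuousWithinAt)
        (fun τ hτ => hF τ (hin τ hτ.1.le hτ.2.le))
      refine ⟨_, hderiv τ (hin τ hτ.1.le hτ.2.le), ?_⟩
      rw [hτeq, hzero]
      have : t - θ ≠ 0 := by linarith
      field_simp
      simp [hS, hy]
  have hDlow : c' / 2 ≤ |D| := by
    have h1 := abs_sub_abs_le_abs_sub (slopeDeriv f x) D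
    rw [abs_sub_comm] at h1
    linarith
  have hD0 : D ≠ 0 := abs_pos.mp (by linarith)
  have htS : |t - θ| ≤ 2 / c' * |S| := by
    have h1 : |S| = |D| * |t - θ| := by rw [← abs_mul, ← hDeq, abs_neg]
    rw [h1]
    have h2 : c' / 2 * |t - θ| ≤ |D| * |t - θ| := by gcongr
    calc |t - θ| = 2 / c' * (c' / 2 * |t - θ|) := by field_simp
      _ ≤ _ := by gcongr
  -- The product structure is the point: replacing D by ã'(x) costs |S| times |D − ã'(x)|, a second
  -- order quantity.
  have heq : t - θ + (slopeDeriv f x)⁻¹ * S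
      = S * (D - slopeDeriv f x) * ((slopeDeriv f x)⁻¹ * D⁻¹) := by
    have h1 : t - θ = -S * D⁻¹ := by rw [hDeq]; field_simp
    rw [h1]
    field_simp
    ring
  have hinv : |(slopeDeriv f x)⁻¹ * D⁻¹| ≤ 2 / c' ^ 2 := by
    rw [abs_mul, abs_inv, abs_inv]
    calc _ ≤ c'⁻¹ * (c' / 2)⁻¹ := by gcongr
      _ = _ := by field_simp
  rw [heq, abs_mul, abs_mul]
  have hS0 := abs_nonneg S
  set δ := ‖y - x‖ with hδdef
  have hδ0 : 0 ≤ δ := norm_nonneg _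
  have hGe : 0 ≤ G * e₃ := by positivity
  calc |S| * |D - slopeDeriv f x| * |(slopeDeriv f x)⁻¹ * D⁻¹|
      ≤ |S| * (B * (e₁ + e₂ + (δ + 12 * (C + 1) * (2 / c' * |S|)) + G * e₃)) * (2 / c' ^ 2) := by
        gcongr
        refine hD.trans ?_
        gcongr
    _ = B * (2 / c' ^ 2) * (|S| * (e₁ + e₂ + δ + 24 * (C + 1) / c' * |S| + G * e₃)) := by ring
    _ ≤ B * (2 / c' ^ 2) * (|S| * ((1 + 24 * (C + 1) / c') * (e₁ + e₂ + δ + |S| + G * e₃))) := by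
        gcongr
        have h1 : 0 ≤ 24 * (C + 1) / c' := by positivity
        nlinarith [mul_nonneg h1 he₁0, mul_nonneg h1 he₂0, mul_nonneg h1 hδ0, mul_nonneg h1 hGe]
    _ = _ := by ring

end Setup

/-! ### Expansion of the slope at time `θ` -/

/-- Since e₁, e₂, e₃ and I are at most 1, every product involving I or e₁ is absorbed by I + e₁, and
only e₂² and e₂e₃ remain as genuine products. -/
lemma mul_self_sum_le {e₁ e₂ e₃ I b : ℝ} (h₁ : 0 ≤ e₁) (h₂ : 0 ≤ e₂) (h₃ : 0 ≤ e₃) (hI : 0 ≤ I)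
    (hb : 0 ≤ b) (h₁' : e₁ ≤ 1) (h₂' : e₂ ≤ 1) (h₃' : e₃ ≤ 1) (hI' : I ≤ 1) :
    (e₁ + e₂ + I + e₂ ^ 2) * (e₁ + e₂ + I + e₂ ^ 2) ≤ 10 * (I + e₁ + b + e₂ ^ 2 + e₂ * e₃) ∧
      (e₁ + e₂ + I + e₂ ^ 2) * e₃ ≤ 10 * (I + e₁ + b + e₂ ^ 2 + e₂ * e₃) := by
  have hee : 0 ≤ e₂ * e₃ := by positivity
  have he2s : 0 ≤ e₂ ^ 2 := sq_nonneg _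
  constructor
  · have c1 : (e₁ + I) * (e₁ + I) ≤ 2 * (e₁ + I) := by gcongr; linarith
    have c2 : e₂ + e₂ ^ 2 ≤ 2 * e₂ := by nlinarith
    have c3 : (e₂ + e₂ ^ 2) * (e₂ + e₂ ^ 2) ≤ (2 * e₂) * (2 * e₂) := by gcongr
    nlinarith [sq_nonneg ((e₁ + I) - (e₂ + e₂ ^ 2))]
  · have c1 : (e₁ + I + e₂ ^ 2) * e₃ ≤ e₁ + I + e₂ ^ 2 :=
      mul_le_of_le_one_right (by positivity) h₃'
    linarith

lemma quadratic_bound {N s e ε : ℝ} (hN : 1 ≤ N) (hs : 0 ≤ s) (he : 0 ≤ e) (hε : 0 ≤ ε) :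
    ε + (N * s) * (e + N * s) + (N * s) ^ 2 ≤ (1 + 2 * N * N) * (ε + s * (s + e)) := by
  have h1 : N ≤ N * N := le_mul_of_one_le_right (by linarith) hN
  have h2 : 0 ≤ s * e := by positivity
  have h3 : 0 ≤ N * N * ε := by positivity
  have h4 : N * (s * e) ≤ N * N * (s * e) := by gcongr
  have h5 : 0 ≤ N * N * (s * e) := by positivity
  have h6 : 0 ≤ s * s := by positivity
  linarith

/-- sθ is a time between 0 and θ seen from the starting point, and sθ − θ is the same instant seen
from the filament point. -/
lemma abs_mul_le_and_sub {s θ a : ℝ} (hs : s ∈ Set.Icc (0 : ℝ) 1) (hθ : |θ| ≤ a) :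
    |s * θ| ≤ a ∧ |s * θ - θ| ≤ a := by
  have h2 : s * θ - θ = -((1 - s) * θ) := by ring
  rw [h2, abs_neg, abs_mul, abs_mul, abs_of_nonneg hs.1,
    abs_of_nonneg (show 0 ≤ 1 - s by linarith [hs.2])]
  exact ⟨(mul_le_of_le_one_left (abs_nonneg _) hs.2).trans hθ,
    (mul_le_of_le_one_left (abs_nonneg _) (by linarith [hs.1])).trans hθ⟩

namespace Setup

variable {f : Plane → ℝ} {H L : Set Plane} {a C : ℝ}

lemma continuousOn_eigvecDeriv (hs : Setup f H L a C) :
    ContinuousOn (fun x => eigvecDeriv (d2 f x)) H := by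
  obtain ⟨c, hc, hgap⟩ := hs.exists_gap_lower
  have hC := hs.bounds.one_le
  have : LipschitzOnWith (24 / c * C).toNNReal (fun x => eigvecDeriv (d2 f x)) H := by
    refine LipschitzOnWith.of_dist_le_mul fun w hw x hx => ?_
    rw [Real.coe_toNNReal _ (by positivity), dist_eq_norm, dist_eq_norm]
    refine (norm_eigvecDeriv_sub_le_mul hc (hgap w hw) (hs.gap_ne_zero hx)).trans ?_
    rw [mul_assoc]
    gcongr
    exact hs.bounds.d2_sub_le w x
  exact this.continuousOn

lemma path_mem_region (hs : Setup f H L a C) {z : Plane} (hz : z ∈ L) {t : ℝ} (ht : |t| ≤ a) :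
    path f z t ∈ H :=
  hs.filament.startSet_subset (path_mem_startSet hz ht)

lemma path_mem_ball (hs : Setup f H L a C) {R : ℝ}
    (hR : Confining f (startSet f L a) (a + 1) R) {x₀ : Plane} (hx₀ : x₀ ∈ startSet f L a) {t : ℝ}
    (ht : |t| ≤ a + 1) : path f x₀ t ∈ Metric.closedBall 0 R :=
  hR f hs.tame (by simp) x₀ hx₀ t ht

lemma abs_le_of_mem_uIoc {u r : ℝ} (hu : |u| ≤ a) (hr : r ∈ Set.uIoc 0 u) : |r| ≤ a := by
  rw [Set.mem_uIoc] at hr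
  rw [abs_le] at hu ⊢
  rcases hr with hr | hr <;> constructor <;> linarith [hr.1, hr.2]

lemma abs_le_of_mem_uIcc {u r : ℝ} (hu : |u| ≤ a) (hr : r ∈ Set.uIcc 0 u) : |r| ≤ a := by
  rw [Set.mem_uIcc] at hr
  rw [abs_le] at hu ⊢
  rcases hr with hr | hr <;> constructor <;> linarith [hr.1, hr.2]

/-- The error of an estimated integral curve at time `θ` is controlled by integrals of the
linearized error of the vector field. -/
lemma path_error (hs : Setup f H L a C) {R : ℝ}
    (hR : Confining f (startSet f L a) (a + 1) R) :
    ∃ B : ℝ, 0 < B ∧ ∀ g e₁ e₂ e₃, Approx f R e₁ e₂ e₃ g → e₂ ≤ 1 → e₃ ≤ 1 → ∀ I : ℝ,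
      (∀ z ∈ L, ∀ u, |u| ≤ a → ‖∫ r in (0 : ℝ)..u, eigvecDeriv (d2 f (path f z r))
        (d2 g (path f z r) - d2 f (path f z r))‖ ≤ I) →
      ∀ x₀ ∈ startSet f L a,
        ‖path g x₀ (hitTime f x₀) - hitPoint f x₀‖ ≤ B * (I + e₂ ^ 2) := by
  have ha := hs.filament.pos
  have hC := hs.bounds.one_le
  obtain ⟨c, hc, hgap⟩ := hs.exists_gap_lower
  refine ⟨2 * (1 + 24 / c * a) * Real.exp (12 * (C + 1) * a), by positivity,
    fun g e₁ e₂ e₃ hg he₂ he₃ I hI x₀ hx₀ => ?_⟩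
  have hθa := hs.abs_hitTime_le hx₀
  have hxL := hs.hitPoint_mem hx₀
  have hI0 : 0 ≤ I := (norm_nonneg _).trans (hI _ hxL 0 (by simpa using ha.le))
  have hcV := hs.tame.continuous_eigvec
  have hcV' := hg.tame.continuous_eigvec
  -- The true curve stays in H, where the gap is at least c. Linearizing G along it therefore costs
  -- only 24e₂²/c per unit of time.
  have hlin : ∀ z ∈ L, ∀ u, |u| ≤ a →
      ‖∫ r in (0 : ℝ)..u, (eigvec g (path f z r) - eigvec f (path f z r))‖
        ≤ I + 24 / c * a * e₂ ^ 2 := by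
    intro z hz u hu
    have hcp := hs.tame.continuous_path z
    have hint1 : IntervalIntegrable
        (fun r => eigvec g (path f z r) - eigvec f (path f z r)) volume 0 u :=
      ((hcV'.comp hcp).sub (hcV.comp hcp)).intervalIntegrable _ _
    have hint2 : IntervalIntegrable (fun r => eigvecDeriv (d2 f (path f z r))
        (d2 g (path f z r) - d2 f (path f z r))) volume 0 u := by
      refine ContinuousOn.intervalIntegrable ?_
      refine ContinuousOn.clm_apply ?_ ?_
      · exact hs.continuousOn_eigvecDeriv.comp hcp.continuousOn fun r hr =>
          hs.path_mem_region hz (abs_le_of_mem_uIcc hu hr)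
      · exact ((hg.tame.continuous_d2.comp hcp).sub
          (hs.tame.continuous_d2.comp hcp)).continuousOn
    have hrem : ‖∫ r in (0 : ℝ)..u, ((eigvec g (path f z r) - eigvec f (path f z r))
        - eigvecDeriv (d2 f (path f z r)) (d2 g (path f z r) - d2 f (path f z r)))‖
        ≤ 24 / c * e₂ ^ 2 * |u - 0| := by
      refine intervalIntegral.norm_integral_le_of_norm_le_const fun r hr => ?_
      have hra := abs_le_of_mem_uIoc hu hr
      set w := path f z r
      have hw : w ∈ H := hs.path_mem_region hz hra
      have h1 := norm_eigvecMap_add_sub_le (hs.gap_ne_zero hw) (d2 g w - d2 f w)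
      rw [add_sub_cancel] at h1
      refine h1.trans ?_
      rw [div_mul_eq_mul_div]
      gcongr
      · exact hg.d2 w (hs.path_mem_ball hR (hs.subset_startSet hz) (by linarith))
      · exact hgap w hw
    rw [intervalIntegral.integral_sub hint1 hint2, sub_zero] at hrem
    have h2 := norm_le_norm_add_norm_sub'
      (∫ r in (0 : ℝ)..u, (eigvec g (path f z r) - eigvec f (path f z r)))
      (∫ r in (0 : ℝ)..u, eigvecDeriv (d2 f (path f z r))
        (d2 g (path f z r) - d2 f (path f z r)))
    have h3 : 24 / c * e₂ ^ 2 * |u| ≤ 24 / c * e₂ ^ 2 * a := by gcongr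
    have h4 := hI z hz u hu
    linarith
  set θ := hitTime f x₀ with hθ
  set z := hitPoint f x₀ with hz
  have hsθ : ∀ s ∈ Set.Icc (0 : ℝ) 1, |s * θ| ≤ a ∧ |s * θ - θ| ≤ a := fun s hs' =>
    abs_mul_le_and_sub hs' hθa
  have hmemg : ∀ τ, |τ| ≤ a + 1 → path g x₀ τ ∈ Metric.closedBall 0 R := fun τ hτ =>
    hR g hg.tame (fun x hx => (hg.d2 x hx).trans he₂) x₀ hx₀ τ hτ
  -- Here the field difference is integrated along the deterministic curve of f, so that its linear
  -- part becomes an empirical mean. The price is a Lipschitz bound for the estimated field, whence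
  -- e₃ ≤ 1.
  have hfin := norm_sub_le_of_integral_field_sub (hs.tame.hasDerivAt_path x₀)
    (hg.tame.hasDerivAt_path x₀) hcV hcV' (K := 12 * (C + 1)) (τ := θ) (d := 0)
    (m := 2 * (I + 24 / c * a * e₂ ^ 2)) (by linarith)
    (by rw [hg.tame.path_zero, hs.tame.path_zero, sub_self, norm_zero])
    (fun s hs' => hg.norm_eigvec_sub_le hs.bounds he₃
      (hmemg _ (by linarith [(hsθ s hs').1]))
      (hs.path_mem_ball hR hx₀ (by linarith [(hsθ s hs').1])))
    (fun s hs' => by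
      -- The curve is recentred at the filament point z, because the bounds hold for curves started
      -- in L. The integral becomes a difference of two integrals from 0 to times in [−a, a], which
      -- accounts for the factor 2.
      have h1 : ∀ r, path f x₀ r = path f z (r - θ) := fun r => by
        rw [hz, hs.path_hitPoint, sub_add_cancel]
      have h2 : (∫ r in (0 : ℝ)..(s * θ), (eigvec g (path f x₀ r) - eigvec f (path f x₀ r)))
          = ∫ r in (-θ)..(s * θ - θ), (eigvec g (path f z r) - eigvec f (path f z r)) := by
        simp_rw [h1]
        have := intervalIntegral.integral_comp_sub_right (a := 0) (b := s * θ)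
          (fun r => eigvec g (path f z r) - eigvec f (path f z r)) θ
        rw [this, zero_sub]
      have hcz : Continuous fun r => eigvec g (path f z r) - eigvec f (path f z r) :=
        (hcV'.comp (hs.tame.continuous_path z)).sub (hcV.comp (hs.tame.continuous_path z))
      rw [h2, ← intervalIntegral.integral_interval_sub_left (a := 0)
        (hcz.intervalIntegrable _ _) (hcz.intervalIntegrable _ _)]
      refine (norm_sub_le _ _).trans ?_
      have h3 := hlin z hxL (s * θ - θ) (hsθ s hs').2
      have h4 := hlin z hxL (-θ) (by rwa [abs_neg])
      linarith)
  have h5 : path f x₀ θ = z := rfl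
  rw [h5] at hfin
  refine hfin.trans ?_
  rw [zero_add]
  have h6 : Real.exp (12 * (C + 1) * |θ|) ≤ Real.exp (12 * (C + 1) * a) := by
    apply Real.exp_le_exp.mpr; gcongr
  have h7 : I + 24 / c * a * e₂ ^ 2 ≤ (1 + 24 / c * a) * (I + e₂ ^ 2) := by
    have h8 : 0 ≤ 24 / c * a * I := by positivity
    have h9 := sq_nonneg e₂
    linarith
  calc 2 * (I + 24 / c * a * e₂ ^ 2) * Real.exp (12 * (C + 1) * |θ|)
      ≤ 2 * ((1 + 24 / c * a) * (I + e₂ ^ 2)) * Real.exp (12 * (C + 1) * a) := by gcongr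
    _ = _ := by ring

/-- First order expansion of the slope of the estimate. -/
lemma slope_expansion (hs : Setup f H L a C) {R : ℝ} :
    ∃ B : ℝ, 0 < B ∧ ∀ g e₁ e₂ e₃, Approx f R e₁ e₂ e₃ g → e₂ ≤ 1 → e₃ ≤ 1 →
      ∀ x ∈ L, x ∈ Metric.closedBall 0 R → ∀ y ∈ Metric.closedBall 0 R, ∀ m : Space3, ∀ b : ℝ,
      ‖m - d2 f x‖ ≤ b →
      |slope g y - inner ℝ (gradient f x) (eigvecDeriv (d2 f x) (d2 g x - m))|
        ≤ B * (‖y - x‖ + e₁ + e₂ ^ 2 + b) := by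
  have hC := hs.bounds.one_le
  obtain ⟨c, hc, hgap⟩ := hs.exists_gap_lower
  refine ⟨(2 + C) * (12 * (C + 1)) + 2 * C * (12 * (C + 1)) + 3 * (12 * (C + 1)) + C * (24 / c)
    + C * 12, by positivity, ?_⟩
  intro g e₁ e₂ e₃ hg he₂ he₃ x hxL hxR y hyR m b hm
  have hxH := hs.filament.subset hxL
  have he₁0 : 0 ≤ e₁ := (norm_nonneg _).trans (hg.grad _ hxR)
  have he₂0 : 0 ≤ e₂ := (norm_nonneg _).trans (hg.d2 _ hxR)
  have hb0 : 0 ≤ b := (norm_nonneg _).trans hm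
  have hsx : slope f x = 0 := (hs.slope_eq_zero hxL).1
  set δ := ‖y - x‖ with hδ
  have hδ0 : 0 ≤ δ := norm_nonneg _
  set v := eigvec f x with hv
  set q := d2 g x - d2 f x with hq
  have hqe : ‖q‖ ≤ e₂ := hg.d2 x hxR
  have hvx := hg.norm_eigvec_le hs.bounds he₂ hxR
  have hvy := hg.norm_eigvec_le hs.bounds he₂ hyR
  have hG := hs.bounds.grad_le x
  -- Since ⟨∇f(x), V(x)⟩ = 0 on L, the linear term in G is the only one not controlled by ‖y − x‖,
  -- e₁, e₂² and b. Replacing 𝔼d²ĝ(x), in the role of m, by d²f(x) costs the bias b.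
  have e1 : slope g y - inner ℝ (gradient f x) (eigvecDeriv (d2 f x) (d2 g x - m))
      = inner ℝ (gradient g y - gradient f x) (eigvec g y)
        + inner ℝ (gradient f x) (eigvec g y - eigvec g x)
        + inner ℝ (gradient f x) (eigvec g x - v - eigvecDeriv (d2 f x) q)
        + inner ℝ (gradient f x) (eigvecDeriv (d2 f x) (m - d2 f x)) := by
    have h1 : inner ℝ (gradient f x) v = 0 := hsx
    have h2 : eigvecDeriv (d2 f x) (d2 g x - m)
        = eigvecDeriv (d2 f x) q - eigvecDeriv (d2 f x) (m - d2 f x) := by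
      rw [← map_sub]; congr 1; rw [hq]; abel
    rw [h2]
    simp only [slope, inner_sub_left, inner_sub_right, h1]
    ring
  have t1 : |inner ℝ (gradient g y - gradient f x) (eigvec g y)|
      ≤ (e₁ + C * δ) * (12 * (C + 1)) := by
    refine (abs_real_inner_le_norm _ _).trans ?_
    have h1 := norm_sub_le_norm_sub_add_norm_sub (gradient g y) (gradient f y) (gradient f x)
    have h2 := hg.grad y hyR
    have h3 := hs.bounds.grad_sub_le y x
    gcongr
    linarith
  have t2 : |inner ℝ (gradient f x) (eigvec g y - eigvec g x)| ≤ C * (12 * (C + 1) * δ) := by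
    refine (abs_real_inner_le_norm _ _).trans ?_
    gcongr
    exact hg.norm_eigvec_sub_le hs.bounds he₃ hyR hxR
  have t3 : |inner ℝ (gradient f x) (eigvec g x - v - eigvecDeriv (d2 f x) q)|
      ≤ C * (24 / c * e₂ ^ 2) := by
    refine (abs_real_inner_le_norm _ _).trans ?_
    gcongr
    have h1 := norm_eigvecMap_add_sub_le (hs.gap_ne_zero hxH) q
    have h2 : d2 f x + q = d2 g x := by rw [hq]; abel
    rw [h2] at h1
    refine h1.trans ?_
    rw [div_mul_eq_mul_div]
    gcongr
    exact hgap x hxH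
  have t4 : |inner ℝ (gradient f x) (eigvecDeriv (d2 f x) (m - d2 f x))| ≤ C * (12 * b) := by
    refine (abs_real_inner_le_norm _ _).trans ?_
    gcongr
    exact (norm_eigvecDeriv_apply_le _ _).trans (by gcongr)
  rw [e1]
  refine (abs_add_le _ _).trans ?_
  refine (add_le_add (abs_add_three _ _ _) t4).trans ?_
  have k1 : 0 ≤ C * δ := by positivity
  have k2 : 0 ≤ C ^ 2 * δ := by positivity
  set s := δ + e₁ + e₂ ^ 2 + b with hsd
  have he2s : 0 ≤ e₂ ^ 2 := sq_nonneg _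
  have u1 : (e₁ + C * δ) * (12 * (C + 1)) ≤ (2 + C) * (12 * (C + 1)) * s := by
    rw [mul_right_comm]
    gcongr
    have : C * δ ≤ C * s := by gcongr; linarith
    linarith
  have u2 : C * (12 * (C + 1) * δ) ≤ 2 * C * (12 * (C + 1)) * s := by
    have : C * (12 * (C + 1) * δ) ≤ C * (12 * (C + 1) * s) := by gcongr; linarith
    have h0 : 0 ≤ C * (12 * (C + 1) * s) := by positivity
    linarith
  have u3 : C * (24 / c * e₂ ^ 2) ≤ C * (24 / c) * s := by
    rw [mul_assoc]; gcongr; linarith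
  have u4 : C * (12 * b) ≤ C * 12 * s := by
    rw [mul_assoc]; gcongr; linarith
  have u5 : 0 ≤ 3 * (12 * (C + 1)) * s := by positivity
  rw [add_mul, add_mul, add_mul, add_mul]
  linarith

/-- Expansion of the slope of the estimate at points near critical points of `f`. -/
lemma slope_expansion_critical (hs : Setup f H L a C) {R : ℝ} :
    ∃ B : ℝ, 0 < B ∧ ∀ g e₁ e₂ e₃, Approx f R e₁ e₂ e₃ g → e₂ ≤ 1 → e₃ ≤ 1 →
      ∀ x, gradient f x = 0 → x ∈ Metric.closedBall 0 R → ∀ y ∈ Metric.closedBall 0 R,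
      ∀ m : Plane, ∀ b ε : ℝ, ‖m - gradient f y‖ ≤ b → ‖gradient g y - m‖ ≤ ε →
      |slope g y| ≤ B * (ε + b + ‖y - x‖) ∧
      |slope g y - ((eigvec f x).ofLp ⬝ᵥ (hessian f x).mulVec (y - x).ofLp
          + inner ℝ (m - gradient f y) (eigvec f x))|
        ≤ B * (ε + (ε + b + ‖y - x‖) * (e₂ + ‖y - x‖) + ‖y - x‖ ^ 2) := by
  have hC := hs.bounds.one_le
  refine ⟨C * (12 * (C + 1)) + 12 * C + C * (12 * C) + C * (12 * C), by positivity, ?_⟩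
  intro g e₁ e₂ e₃ hg he₂ he₃ x hgx hxR y hyR m b ε hm hε
  have hf2 : ContDiff ℝ 2 f := hs.bounds.contDiff.of_le (by norm_num)
  have he₂0 : 0 ≤ e₂ := (norm_nonneg _).trans (hg.d2 _ hxR)
  have hb0 : 0 ≤ b := (norm_nonneg _).trans hm
  have hε0 : 0 ≤ ε := (norm_nonneg _).trans hε
  set δ := ‖y - x‖ with hδ
  have hδ0 : 0 ≤ δ := norm_nonneg _
  set v := eigvec f x with hv
  have hvb : ‖v‖ ≤ 12 * C := hs.bounds.norm_eigvec_le x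
  have hvy := hg.norm_eigvec_le hs.bounds he₂ hyR
  -- At a critical point the estimated gradient is itself small: fluctuation, bias and displacement
  -- are its three parts.
  have hgrad : ‖gradient g y‖ ≤ C * (ε + b + δ) := by
    have h1 : gradient g y = (gradient g y - m) + (m - gradient f y)
        + (gradient f y - gradient f x) := by rw [hgx]; abel
    have h2 := hs.bounds.grad_sub_le y x
    rw [h1]
    refine (norm_add₃_le).trans ?_
    have h3 : ε + b ≤ C * (ε + b) := le_mul_of_one_le_left (by linarith) hC
    linarith
  have hvv : ‖eigvec g y - v‖ ≤ 12 * (e₂ + C * δ) := by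
    refine (norm_eigvecMap_sub_le _ _).trans ?_
    have h1 := norm_sub_le_norm_sub_add_norm_sub (d2 g y) (d2 f y) (d2 f x)
    have h2 := hg.d2 y hyR
    have h3 := hs.bounds.d2_sub_le y x
    linarith
  set s := ε + b + δ with hsdef
  have hs0 : 0 ≤ s := by positivity
  constructor
  · refine (abs_real_inner_le_norm _ _).trans ?_
    calc ‖gradient g y‖ * ‖eigvec g y‖ ≤ (C * s) * (12 * (C + 1)) := by gcongr
      _ = C * (12 * (C + 1)) * s := by ring
      _ ≤ _ := by
        gcongr
        have : 0 ≤ C * (12 * C) := by positivity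
        linarith
  · have hhess : (eigvec f x).ofLp ⬝ᵥ (hessian f x).mulVec (y - x).ofLp
        = inner ℝ (fderiv ℝ (gradient f) x (y - x)) v := by
      rw [inner_plane, (fderiv_gradient_apply hf2 x (y - x)).2]
      simp [dotProduct, Matrix.mulVec, Fin.sum_univ_two, hessian, d2, hv,
        pderiv_comm hf2 x 1 0]
      ring
    rw [hhess]
    -- Replacing the estimated eigenvector by V(x) has second order cost, since it is multiplied by
    -- the small gradient. What remains besides the leading terms is the fluctuation and the Taylor
    -- remainder of ∇f.
    have e1 : slope g y - (inner ℝ (fderiv ℝ (gradient f) x (y - x)) v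
        + inner ℝ (m - gradient f y) v)
        = inner ℝ (gradient g y) (eigvec g y - v) + inner ℝ (gradient g y - m) v
          + inner ℝ (gradient f y - gradient f x - fderiv ℝ (gradient f) x (y - x)) v := by
      simp only [slope, hgx, inner_sub_left, inner_sub_right, inner_zero_left]
      ring
    rw [e1]
    refine (abs_add_three _ _ _).trans ?_
    have t1 : |inner ℝ (gradient g y) (eigvec g y - v)| ≤ (C * s) * (12 * (e₂ + C * δ)) := by
      refine (abs_real_inner_le_norm _ _).trans ?_
      gcongr
    have t2 : |inner ℝ (gradient g y - m) v| ≤ ε * (12 * C) := by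
      refine (abs_real_inner_le_norm _ _).trans ?_
      gcongr
    have t3 : |inner ℝ (gradient f y - gradient f x - fderiv ℝ (gradient f) x (y - x)) v|
        ≤ (C * δ ^ 2) * (12 * C) := by
      refine (abs_real_inner_le_norm _ _).trans ?_
      gcongr
      exact hs.bounds.grad_taylor x y
    set r := ε + s * (e₂ + δ) + δ ^ 2 with hr
    have k0 : 0 ≤ s * (e₂ + δ) := by positivity
    have k1 : 0 ≤ δ ^ 2 := sq_nonneg _
    have hr0 : 0 ≤ r := by positivity
    have u1 : (C * s) * (12 * (e₂ + C * δ)) ≤ C * (12 * C) * r := by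
      calc (C * s) * (12 * (e₂ + C * δ)) ≤ (C * s) * (12 * (C * e₂ + C * δ)) := by
            gcongr
            exact le_mul_of_one_le_left he₂0 hC
        _ = C * (12 * C) * (s * (e₂ + δ)) := by ring
        _ ≤ _ := by gcongr; linarith
    have u2 : ε * (12 * C) ≤ 12 * C * r := by
      rw [mul_comm]; gcongr; linarith
    have u3 : (C * δ ^ 2) * (12 * C) ≤ C * (12 * C) * r := by
      calc (C * δ ^ 2) * (12 * C) = C * (12 * C) * δ ^ 2 := by ring
        _ ≤ _ := by gcongr; linarith
    have u4 : 0 ≤ C * (12 * (C + 1)) * r := by positivity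
    rw [add_mul, add_mul, add_mul]
    linarith

set_option maxHeartbeats 1000000 in
/-- The estimation error of the hitting time, up to higher order terms. -/
theorem hitTime_expansion (hs : Setup f H L a C) {R : ℝ}
    (hR : Confining f (startSet f L a) (a + 1) R) :
    ∃ η B : ℝ, 0 < η ∧ 0 < B ∧ ∀ g e₁ e₂ e₃, Approx f R e₁ e₂ e₃ g →
      e₁ ≤ η → e₂ ≤ η → e₃ ≤ η → ∀ I b : ℝ, I ≤ 1 →
      (∀ z ∈ L, ∀ u, |u| ≤ a → ‖∫ r in (0 : ℝ)..u, eigvecDeriv (d2 f (path f z r))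
        (d2 g (path f z r) - d2 f (path f z r))‖ ≤ I) →
      ∀ x₀ ∈ startSet f L a, ∀ m : Space3, ‖m - d2 f (hitPoint f x₀)‖ ≤ b →
      ∀ t, IsHitTime g x₀ t →
      |t - hitTime f x₀ + (slopeDeriv f (hitPoint f x₀))⁻¹ *
          inner ℝ (gradient f (hitPoint f x₀)) (fderiv ℝ eigvecMap (d2 f (hitPoint f x₀))
            (d2 g (hitPoint f x₀) - m))|
        ≤ B * (I + e₁ + b + e₂ ^ 2 + e₂ * e₃) := by
  have ha := hs.filament.pos
  have hC := hs.bounds.one_le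
  obtain ⟨c', hc', hsd⟩ := hs.exists_slopeDeriv_lower
  obtain ⟨η, B₁, hη, hB₁, hres⟩ := hs.residual hR
  obtain ⟨B₂, hB₂, hpath⟩ := hs.path_error hR
  obtain ⟨B₃, hB₃, hexp⟩ := hs.slope_expansion (R := R)
  set k : ℝ := 24 * (C + 1) ^ 2 with hk
  set N : ℝ := 1 + B₂ with hN
  have hk0 : 0 < k := by positivity
  have hN0 : 1 ≤ N := by linarith
  refine ⟨min 1 η, B₁ * (k * N * ((1 + k) * N + C)) * 10 + c'⁻¹ * (B₃ * N),
    by positivity, by positivity, ?_⟩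
  intro g e₁ e₂ e₃ hg he₁ he₂ he₃ I b hI1 hI x₀ hx₀ m hm t ht
  have hη1 : min 1 η ≤ 1 := min_le_left _ _
  have hη2 : min 1 η ≤ η := min_le_right _ _
  have hθa := hs.abs_hitTime_le hx₀
  have hxL := hs.hitPoint_mem hx₀
  have hI0 : 0 ≤ I := (norm_nonneg _).trans (hI _ hxL 0 (by simpa using ha.le))
  have hb0 : 0 ≤ b := (norm_nonneg _).trans hm
  have h1 := hres g e₁ e₂ e₃ hg (he₁.trans hη2) (he₂.trans hη2) (he₃.trans hη2) x₀ hx₀ t ht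
  have h2 := hpath g e₁ e₂ e₃ hg (he₂.trans hη1) (he₃.trans hη1) I hI x₀ hx₀
  set θ := hitTime f x₀ with hθ
  set x := hitPoint f x₀ with hx
  set y := path g x₀ θ with hy
  have hyR : y ∈ Metric.closedBall 0 R :=
    hR g hg.tame (fun x hx => (hg.d2 x hx).trans (he₂.trans hη1)) x₀ hx₀ θ (by linarith)
  have hxR : x ∈ Metric.closedBall 0 R := hs.path_mem_ball hR hx₀ (t := θ) (by linarith)
  have he₁0 : 0 ≤ e₁ := (norm_nonneg _).trans (hg.grad _ hyR)
  have he₂0 : 0 ≤ e₂ := (norm_nonneg _).trans (hg.d2 _ hyR)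
  have he₃0 : 0 ≤ e₃ := (norm_nonneg _).trans (hg.d3 _ hyR)
  have h3 := hexp g e₁ e₂ e₃ hg (he₂.trans hη1) (he₃.trans hη1) x hxL hxR y hyR m b hm
  have h4 := abs_slope_sub_le hs.bounds (x := x) (he₂.trans hη1) (hg.grad y hyR) (hg.d2 y hyR)
  rw [(hs.slope_eq_zero hxL).1, sub_zero] at h4
  rw [(hasFDerivAt_eigvecMap (hs.gap_ne_zero (hs.filament.subset hxL))).fderiv]
  set S := slope g y with hS
  set δ := ‖y - x‖ with hδ
  set A := inner ℝ (gradient f x) (eigvecDeriv (d2 f x) (d2 g x - m)) with hA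
  have hδ0 : 0 ≤ δ := norm_nonneg _
  have hS0 : 0 ≤ |S| := abs_nonneg _
  have hG : ‖gradient f x‖ ≤ C := hs.bounds.grad_le x
  -- The linearization of the hitting time in S and the expansion of S itself are bounded
  -- separately.
  have e1 : t - θ + (slopeDeriv f x)⁻¹ * A
      = (t - θ + (slopeDeriv f x)⁻¹ * S) - (slopeDeriv f x)⁻¹ * (S - A) := by ring
  have hinv : |(slopeDeriv f x)⁻¹| ≤ c'⁻¹ := by
    rw [abs_inv]; exact inv_anti₀ hc' (hsd x hxL)
  set Q := I + e₁ + b + e₂ ^ 2 + e₂ * e₃ with hQ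
  have hee : 0 ≤ e₂ * e₃ := by positivity
  have he2s : 0 ≤ e₂ ^ 2 := sq_nonneg _
  have hQ0 : 0 ≤ Q := by positivity
  have hδN : δ + e₁ + e₂ ^ 2 + b ≤ N * Q := by
    calc δ + e₁ + e₂ ^ 2 + b ≤ B₂ * (I + e₂ ^ 2) + Q := by linarith
      _ ≤ B₂ * Q + Q := by gcongr; linarith
      _ = N * Q := by rw [hN]; ring
  have p2 : |(slopeDeriv f x)⁻¹ * (S - A)| ≤ c'⁻¹ * (B₃ * N) * Q := by
    rw [abs_mul, mul_assoc]
    gcongr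
    refine h3.trans ?_
    rw [mul_assoc]
    gcongr
  -- products of first order quantities
  have hw : e₁ + e₂ + δ ≤ N * (e₁ + e₂ + I + e₂ ^ 2) := by
    have : δ ≤ B₂ * (e₁ + e₂ + I + e₂ ^ 2) := h2.trans (by gcongr; linarith)
    rw [hN, add_mul, one_mul]
    linarith
  set W := e₁ + e₂ + I + e₂ ^ 2 with hW
  have hW0 : 0 ≤ W := by positivity
  obtain ⟨hWW, hWe⟩ := mul_self_sum_le he₁0 he₂0 he₃0 hI0 hb0 (he₁.trans hη1) (he₂.trans hη1)
    (he₃.trans hη1) hI1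
  rw [← hW, ← hQ] at hWW hWe
  have hSW : |S| ≤ k * N * W := by
    rw [mul_assoc]
    exact h4.trans (by gcongr)
  have p1 : |t - θ + (slopeDeriv f x)⁻¹ * S|
      ≤ B₁ * (k * N * ((1 + k) * N + C)) * 10 * Q := by
    refine h1.trans ?_
    -- As |S| is of order W, the residual is quadratic in W up to the mixed term We₃; this is where
    -- e₂e₃ appears.
    have a1 : e₁ + e₂ + δ + |S| + ‖gradient f x‖ * e₃ ≤ (1 + k) * N * W + C * e₃ := by
      have : ‖gradient f x‖ * e₃ ≤ C * e₃ := by gcongr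
      rw [add_mul, add_mul, one_mul]
      linarith
    calc B₁ * (|S| * (e₁ + e₂ + δ + |S| + ‖gradient f x‖ * e₃))
        ≤ B₁ * ((k * N * W) * ((1 + k) * N * W + C * e₃)) := by gcongr
      _ = B₁ * (k * N) * ((1 + k) * N * (W * W) + C * (W * e₃)) := by ring
      _ ≤ B₁ * (k * N) * ((1 + k) * N * (10 * Q) + C * (10 * Q)) := by gcongr
      _ = B₁ * (k * N * ((1 + k) * N + C)) * 10 * Q := by ring
  rw [e1]
  refine (abs_sub _ _).trans ?_
  rw [add_mul]
  linarith

set_option maxHeartbeats 1000000 in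
/-- The estimation error of the hitting time of a critical point, up to higher order terms. -/
theorem hitTime_expansion_critical (hs : Setup f H L a C) {R : ℝ}
    (hR : Confining f (startSet f L a) (a + 1) R) :
    ∃ η B : ℝ, 0 < η ∧ 0 < B ∧ ∀ g e₁ e₂ e₃, Approx f R e₁ e₂ e₃ g →
      e₁ ≤ η → e₂ ≤ η → e₃ ≤ η → ∀ I b ε : ℝ, e₁ ≤ ε + b →
      (∀ z ∈ L, ∀ u, |u| ≤ a → ‖∫ r in (0 : ℝ)..u, eigvecDeriv (d2 f (path f z r))
        (d2 g (path f z r) - d2 f (path f z r))‖ ≤ I) →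
      ∀ M : Plane → Plane, (∀ y ∈ Metric.closedBall 0 R, ‖M y - gradient f y‖ ≤ b ∧
        ‖gradient g y - M y‖ ≤ ε) →
      ∀ x₀ ∈ startSet f L a, gradient f (hitPoint f x₀) = 0 → ∀ t, IsHitTime g x₀ t →
      |t - hitTime f x₀ + (slopeDeriv f (hitPoint f x₀))⁻¹ *
          ((eigvec f (hitPoint f x₀)).ofLp ⬝ᵥ (hessian f (hitPoint f x₀)).mulVec
              (path g x₀ (hitTime f x₀) - hitPoint f x₀).ofLp
            + inner ℝ (M (path g x₀ (hitTime f x₀)) - gradient f (path g x₀ (hitTime f x₀)))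
              (eigvec f (hitPoint f x₀)))|
        ≤ B * (ε + (ε + b + I + e₂ ^ 2) * ((ε + b + I + e₂ ^ 2) + e₂)) := by
  have ha := hs.filament.pos
  have hC := hs.bounds.one_le
  obtain ⟨c', hc', hsd⟩ := hs.exists_slopeDeriv_lower
  obtain ⟨η, B₁, hη, hB₁, hres⟩ := hs.residual hR
  obtain ⟨B₂, hB₂, hpath⟩ := hs.path_error hR
  obtain ⟨B₃, hB₃, hexp⟩ := hs.slope_expansion_critical (R := R)
  set N : ℝ := 1 + B₂ with hN
  have hN0 : 1 ≤ N := by linarith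
  refine ⟨min 1 η, B₁ * (B₃ * N) * (N + B₃ * N + 1) + c'⁻¹ * (B₃ * (1 + 2 * N * N)),
    by positivity, by positivity, ?_⟩
  intro g e₁ e₂ e₃ hg he₁ he₂ he₃ I b ε heb hI M hM x₀ hx₀ hcrit t ht
  have hη1 : min 1 η ≤ 1 := min_le_left _ _
  have hη2 : min 1 η ≤ η := min_le_right _ _
  have hθa := hs.abs_hitTime_le hx₀
  have hxL := hs.hitPoint_mem hx₀
  have hI0 : 0 ≤ I := (norm_nonneg _).trans (hI _ hxL 0 (by simpa using ha.le))
  have h1 := hres g e₁ e₂ e₃ hg (he₁.trans hη2) (he₂.trans hη2) (he₃.trans hη2) x₀ hx₀ t ht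
  have h2 := hpath g e₁ e₂ e₃ hg (he₂.trans hη1) (he₃.trans hη1) I hI x₀ hx₀
  set θ := hitTime f x₀ with hθ
  set x := hitPoint f x₀ with hx
  set y := path g x₀ θ with hy
  have hyR : y ∈ Metric.closedBall 0 R :=
    hR g hg.tame (fun x hx => (hg.d2 x hx).trans (he₂.trans hη1)) x₀ hx₀ θ (by linarith)
  have hxR : x ∈ Metric.closedBall 0 R := hs.path_mem_ball hR hx₀ (t := θ) (by linarith)
  have he₁0 : 0 ≤ e₁ := (norm_nonneg _).trans (hg.grad _ hyR)
  have he₂0 : 0 ≤ e₂ := (norm_nonneg _).trans (hg.d2 _ hyR)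
  have hb0 : 0 ≤ b := (norm_nonneg _).trans (hM y hyR).1
  have hε0 : 0 ≤ ε := (norm_nonneg _).trans (hM y hyR).2
  obtain ⟨h4, h3⟩ := hexp g e₁ e₂ e₃ hg (he₂.trans hη1) (he₃.trans hη1) x hcrit hxR y hyR (M y)
    b ε (hM y hyR).1 (hM y hyR).2
  -- The vanishing gradient removes the third derivative error from the residual.
  rw [hcrit, norm_zero, zero_mul, add_zero] at h1
  set S := slope g y with hS
  set δ := ‖y - x‖ with hδ
  set A := (eigvec f x).ofLp ⬝ᵥ (hessian f x).mulVec (y - x).ofLp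
    + inner ℝ (M y - gradient f y) (eigvec f x) with hA
  have hδ0 : 0 ≤ δ := norm_nonneg _
  have hS0 : 0 ≤ |S| := abs_nonneg _
  have e1 : t - θ + (slopeDeriv f x)⁻¹ * A
      = (t - θ + (slopeDeriv f x)⁻¹ * S) - (slopeDeriv f x)⁻¹ * (S - A) := by ring
  have hinv : |(slopeDeriv f x)⁻¹| ≤ c'⁻¹ := by
    rw [abs_inv]; exact inv_anti₀ hc' (hsd x hxL)
  have he2s : 0 ≤ e₂ ^ 2 := sq_nonneg _
  set s := ε + b + I + e₂ ^ 2 with hsdef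
  have hs0 : 0 ≤ s := by positivity
  have hδs : ε + b + δ ≤ N * s := by
    have : B₂ * (I + e₂ ^ 2) ≤ B₂ * s := by gcongr; linarith
    rw [hN, add_mul, one_mul]; linarith
  have hδN : δ ≤ N * s := by linarith
  set Q := ε + s * (s + e₂) with hQ
  have hse : 0 ≤ s * (s + e₂) := by positivity
  have p2 : |(slopeDeriv f x)⁻¹ * (S - A)| ≤ c'⁻¹ * (B₃ * (1 + 2 * N * N)) * Q := by
    rw [abs_mul, mul_assoc]
    gcongr
    refine h3.trans ?_
    rw [mul_assoc]
    gcongr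
    refine le_trans ?_ (quadratic_bound hN0 hs0 he₂0 hε0)
    gcongr
  have p1 : |t - θ + (slopeDeriv f x)⁻¹ * S| ≤ B₁ * (B₃ * N) * (N + B₃ * N + 1) * Q := by
    refine h1.trans ?_
    have hSs : |S| ≤ B₃ * N * s := by
      rw [mul_assoc]; exact h4.trans (by gcongr)
    have a1 : e₁ + e₂ + δ + |S| ≤ (N + B₃ * N + 1) * (s + e₂) := by
      have : e₁ + δ ≤ N * s := by linarith
      have k1 : 0 ≤ N * e₂ := by positivity
      have k2 : 0 ≤ B₃ * N * e₂ := by positivity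
      linarith
    calc B₁ * (|S| * (e₁ + e₂ + δ + |S|))
        ≤ B₁ * ((B₃ * N * s) * ((N + B₃ * N + 1) * (s + e₂))) := by gcongr
      _ = B₁ * (B₃ * N) * (N + B₃ * N + 1) * (s * (s + e₂)) := by ring
      _ ≤ _ := by gcongr; linarith
  rw [e1]
  refine (abs_sub _ _).trans ?_
  rw [add_mul]
  linarith

end Setup

/-! ### Uniform deviations of empirical means -/

section Deviations

variable {Ω : Type*} [MeasurableSpace Ω] {P : Measure Ω} {E : Type*} [MeasurableSpace E]

/-- The deviation of the empirical mean of `φ` from its expectation. -/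
def empDev (μ : Measure E) (X : ℕ → Ω → E) (φ : E → ℝ) (n : ℕ) (ω : Ω) : ℝ :=
  (n : ℝ)⁻¹ * ∑ i ∈ Finset.range n, φ (X i ω) - ∫ y, φ y ∂μ

lemma exp_le_one_add_add_sq {u : ℝ} (hu : |u| ≤ 1) : Real.exp u ≤ 1 + u + u ^ 2 := by
  have := (abs_le.mp (Real.abs_exp_sub_one_sub_id_le hu)).2
  linarith

lemma integrable_of_abs_le {μ : Measure E} [IsFiniteMeasure μ] {φ : E → ℝ} (hφ : Measurable φ)
    {b : ℝ} (hb : ∀ y, |φ y| ≤ b) : Integrable φ μ :=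
  Integrable.of_bound hφ.aestronglyMeasurable b (ae_of_all _ hb)

lemma abs_integral_le_of_abs_le {μ : Measure E} [IsProbabilityMeasure μ] {φ : E → ℝ}
    {b : ℝ} (hb : ∀ y, |φ y| ≤ b) : |∫ y, φ y ∂μ| ≤ b := by
  simpa using norm_integral_le_of_norm_le_const (μ := μ) (f := φ) (ae_of_all _ hb)

/-- The condition 2bλ ≤ 1 puts the exponent into [−1, 1], where exp u ≤ 1 + u + u². The linear term
has mean zero, and the variance is at most the second moment v. -/
lemma integral_exp_centered_le {μ : Measure E} [IsProbabilityMeasure μ] {φ : E → ℝ}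
    (hφ : Measurable φ) {b v lam : ℝ} (hb : ∀ y, |φ y| ≤ b) (hv : ∫ y, φ y ^ 2 ∂μ ≤ v)
    (hlam : 0 ≤ lam) (hlb : 2 * b * lam ≤ 1) :
    ∫ y, Real.exp (lam * (φ y - ∫ y, φ y ∂μ)) ∂μ ≤ Real.exp (lam ^ 2 * v) := by
  set m := ∫ y, φ y ∂μ with hm
  have hmb : |m| ≤ b := abs_integral_le_of_abs_le hb
  have hint := integrable_of_abs_le (μ := μ) hφ hb
  have hint2 : Integrable (fun y => φ y ^ 2) μ := by
    refine integrable_of_abs_le (b := b ^ 2) (hφ.pow_const 2) fun y => ?_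
    rw [abs_pow]
    gcongr
    exact hb y
  have hu : ∀ y, |lam * (φ y - m)| ≤ 1 := fun y => by
    rw [abs_mul, abs_of_nonneg hlam]
    have : |φ y - m| ≤ 2 * b := (abs_sub _ _).trans (by linarith [hb y])
    calc lam * |φ y - m| ≤ lam * (2 * b) := by gcongr
      _ ≤ 1 := by linarith
  have hc : ∫ y, (φ y - m) ∂μ = 0 := by
    rw [integral_sub hint (integrable_const _)]; simp [hm]
  have hc2 : ∫ y, (φ y - m) ^ 2 ∂μ ≤ v := by
    have h1 : ∀ y, (φ y - m) ^ 2 = φ y ^ 2 - 2 * m * φ y + m ^ 2 := fun y => by ring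
    simp_rw [h1]
    rw [integral_add (f := fun y => φ y ^ 2 - 2 * m * φ y) (hint2.sub (hint.const_mul _))
      (integrable_const _), integral_sub hint2 (hint.const_mul _), integral_const_mul]
    simp only [integral_const, probReal_univ, one_smul, ← hm]
    nlinarith [sq_nonneg m]
  have hi1 : Integrable (fun y => φ y - m) μ := hint.sub (integrable_const _)
  have hi2 : Integrable (fun y => (φ y - m) ^ 2) μ := by
    refine integrable_of_abs_le (b := (2 * b) ^ 2) ((hφ.sub_const m).pow_const 2) fun y => ?_
    rw [abs_pow]
    gcongr
    exact (abs_sub _ _).trans (by linarith [hb y])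
  calc ∫ y, Real.exp (lam * (φ y - m)) ∂μ
      ≤ ∫ y, (1 + lam * (φ y - m) + lam ^ 2 * (φ y - m) ^ 2) ∂μ := by
        refine integral_mono ?_ ?_ fun y => ?_
        · refine integrable_of_abs_le (b := Real.exp 1)
            (Real.measurable_exp.comp ((hφ.sub_const m).const_mul lam)) fun y => ?_
          rw [abs_of_pos (Real.exp_pos _)]
          exact Real.exp_le_exp.mpr ((le_abs_self _).trans (hu y))
        · exact ((integrable_const _).add (hi1.const_mul _)).add (hi2.const_mul _)
        · refine (exp_le_one_add_add_sq (hu y)).trans (le_of_eq ?_)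
          ring
    _ = 1 + lam ^ 2 * ∫ y, (φ y - m) ^ 2 ∂μ := by
        rw [integral_add (f := fun y => 1 + lam * (φ y - m))
          ((integrable_const _).add (hi1.const_mul _)) (hi2.const_mul _),
          integral_add (integrable_const _) (hi1.const_mul _), integral_const_mul,
          integral_const_mul, hc]
        simp
    _ ≤ lam ^ 2 * v + 1 := by
        have : lam ^ 2 * ∫ y, (φ y - m) ^ 2 ∂μ ≤ lam ^ 2 * v := by gcongr
        linarith
    _ ≤ Real.exp (lam ^ 2 * v) := Real.add_one_le_exp _

variable [IsProbabilityMeasure P] {X : ℕ → Ω → E} {μ : Measure E}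

/-- Chernoff's bound with the parameter λ left free; it is chosen later according to v and n. -/
lemma bernstein_upper (hXm : ∀ i, Measurable (X i)) (hXi : iIndepFun X P)
    (hXl : ∀ i, P.map (X i) = μ) {φ : E → ℝ} (hφ : Measurable φ) {b v lam τ : ℝ}
    (hb : ∀ y, |φ y| ≤ b) (hv : ∫ y, φ y ^ 2 ∂μ ≤ v) (hlam : 0 ≤ lam) (hlb : 2 * b * lam ≤ 1)
    {n : ℕ} (hn : 0 < n) :
    P.real {ω | τ ≤ empDev μ X φ n ω} ≤ Real.exp (-(n * lam * τ) + n * (lam ^ 2 * v)) := by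
  have : IsProbabilityMeasure μ := by
    rw [← hXl 0]; exact Measure.isProbabilityMeasure_map (hXm 0).aemeasurable
  set m := ∫ y, φ y ∂μ with hm
  set Y : ℕ → Ω → ℝ := fun i ω => φ (X i ω) - m with hY
  have hYm : ∀ i, Measurable (Y i) := fun i => (hφ.comp (hXm i)).sub_const m
  have hYi : iIndepFun Y P := hXi.comp (fun _ y => φ y - m) fun _ => hφ.sub_const m
  have hmb : |m| ≤ b := abs_integral_le_of_abs_le hb
  have hYb : ∀ i ω, |Y i ω| ≤ 2 * b := fun i ω =>
    (abs_sub _ _).trans (by linarith [hb (X i ω)])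
  have hn' : (0 : ℝ) < n := by exact_mod_cast hn
  have hset : {ω | τ ≤ empDev μ X φ n ω} = {ω | n * τ ≤ (∑ i ∈ Finset.range n, Y i) ω} := by
    ext ω
    have h1 : (∑ i ∈ Finset.range n, Y i) ω = n * empDev μ X φ n ω := by
      rw [Finset.sum_apply]
      simp only [hY, empDev, Finset.sum_sub_distrib, Finset.sum_const, Finset.card_range,
        nsmul_eq_mul]
      field_simp
      ring
    change τ ≤ empDev μ X φ n ω ↔ n * τ ≤ (∑ i ∈ Finset.range n, Y i) ω
    rw [h1, mul_le_mul_iff_right₀ hn']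
  have hmgf : ∀ i, mgf (Y i) P lam ≤ Real.exp (lam ^ 2 * v) := by
    intro i
    have h1 : mgf (Y i) P lam = ∫ y, Real.exp (lam * (φ y - m)) ∂μ := by
      rw [← hXl i, integral_map (hXm i).aemeasurable]
      · rfl
      · exact (Real.measurable_exp.comp ((hφ.sub_const m).const_mul lam)).aestronglyMeasurable
    rw [h1]
    exact integral_exp_centered_le hφ hb hv hlam hlb
  have hint : Integrable (fun ω => Real.exp (lam * (∑ i ∈ Finset.range n, Y i) ω)) P := by
    refine integrable_of_abs_le (b := Real.exp (lam * (n * (2 * b)))) ?_ fun ω => ?_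
    · simp_rw [Finset.sum_apply]
      exact Real.measurable_exp.comp ((Finset.measurable_sum _ fun i _ => hYm i).const_mul lam)
    · rw [abs_of_pos (Real.exp_pos _), Finset.sum_apply]
      refine Real.exp_le_exp.mpr (mul_le_mul_of_nonneg_left ?_ hlam)
      calc ∑ i ∈ Finset.range n, Y i ω ≤ ∑ _i ∈ Finset.range n, 2 * b :=
            Finset.sum_le_sum fun i _ => (le_abs_self _).trans (hYb i ω)
        _ = n * (2 * b) := by simp
  rw [hset]
  refine (measure_ge_le_exp_mul_mgf _ hlam hint).trans ?_
  rw [hYi.mgf_sum hYm, Real.exp_add]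
  have h2 : ∏ i ∈ Finset.range n, mgf (Y i) P lam ≤ Real.exp (n * (lam ^ 2 * v)) := by
    calc ∏ i ∈ Finset.range n, mgf (Y i) P lam
        ≤ ∏ _i ∈ Finset.range n, Real.exp (lam ^ 2 * v) :=
          Finset.prod_le_prod (fun i _ => mgf_nonneg) fun i _ => hmgf i
      _ = _ := by rw [Finset.prod_const, Finset.card_range, ← Real.exp_nat_mul]
  have h3 : -lam * (n * τ) = -(n * lam * τ) := by ring
  rw [h3]
  gcongr

lemma bernstein (hXm : ∀ i, Measurable (X i)) (hXi : iIndepFun X P)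
    (hXl : ∀ i, P.map (X i) = μ) {φ : E → ℝ} (hφ : Measurable φ) {b v lam τ : ℝ}
    (hb : ∀ y, |φ y| ≤ b) (hv : ∫ y, φ y ^ 2 ∂μ ≤ v) (hlam : 0 ≤ lam) (hlb : 2 * b * lam ≤ 1)
    {n : ℕ} (hn : 0 < n) :
    P.real {ω | τ ≤ |empDev μ X φ n ω|} ≤ 2 * Real.exp (-(n * lam * τ) + n * (lam ^ 2 * v)) := by
  have h1 := bernstein_upper (τ := τ) hXm hXi hXl hφ hb hv hlam hlb hn
  have h2 := bernstein_upper (τ := τ) (φ := fun y => -φ y) hXm hXi hXl hφ.neg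
    (by simpa using hb) (by simpa using hv) hlam hlb hn
  have hneg : ∀ ω, empDev μ X (fun y => -φ y) n ω = -empDev μ X φ n ω := fun ω => by
    simp only [empDev, Finset.sum_neg_distrib, integral_neg]; ring
  simp_rw [hneg] at h2
  have hsub : {ω | τ ≤ |empDev μ X φ n ω|}
      ⊆ {ω | τ ≤ empDev μ X φ n ω} ∪ {ω | τ ≤ -empDev μ X φ n ω} := fun ω hω => by
    rcases le_abs.mp (show τ ≤ |empDev μ X φ n ω| from hω) with h | h
    · exact Or.inl h
    · exact Or.inr h
  have := (measureReal_mono hsub (measure_ne_top P _)).trans (measureReal_union_le _ _)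
  linarith

/-- Bounded subsets of `ℝ² × ℝ` have nets of polynomial size. -/
lemma exists_net {S : Set (Plane × ℝ)} (hS : Bornology.IsBounded S) :
    ∃ C : ℝ, 0 < C ∧ ∀ m : ℕ, 1 ≤ m → ∃ T : Finset (Plane × ℝ), ↑T ⊆ S ∧
      (T.card : ℝ) ≤ C * m ^ 3 ∧ ∀ p ∈ S, ∃ q ∈ T, ‖p - q‖ ≤ 2 / m := by
  classical
  obtain ⟨R₀, hR₀⟩ := hS.subset_closedBall 0
  obtain ⟨R, hR⟩ := exists_nat_ge (max R₀ 1)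
  have hR1 : (1 : ℝ) ≤ R := (le_max_right _ _).trans hR
  refine ⟨27 * (R : ℝ) ^ 3, by positivity, fun m hm => ?_⟩
  have hm1 : (1 : ℝ) ≤ m := by exact_mod_cast hm
  have hm0 : (0 : ℝ) < m := by linarith
  -- Points are sorted into cells of side 1/m. Two points of one cell differ by at most 1/m in each
  -- coordinate, hence by at most 2/m in norm.
  set κ : Plane × ℝ → ℤ × ℤ × ℤ := fun p => (⌊m * p.1 0⌋, ⌊m * p.1 1⌋, ⌊m * p.2⌋) with hκ
  set N : ℤ := R * m with hN
  have hfloor : ∀ x : ℝ, |x| ≤ R → ⌊m * x⌋ ∈ Finset.Icc (-N) N := by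
    intro x hx
    rw [abs_le] at hx
    rw [Finset.mem_Icc]
    constructor
    · rw [Int.le_floor]
      push_cast [hN]
      nlinarith [hx.1]
    · have h1 : (m : ℝ) * x ≤ (N : ℝ) := by push_cast [hN]; nlinarith [hx.2]
      exact_mod_cast (Int.floor_le _).trans h1
  set I : Finset (ℤ × ℤ × ℤ) := Finset.Icc (-N) N ×ˢ (Finset.Icc (-N) N ×ˢ Finset.Icc (-N) N)
  have hmem : ∀ p ∈ S, κ p ∈ I := by
    intro p hp
    have h1 : ‖p‖ ≤ R := by
      have := hR₀ hp
      rw [mem_closedBall_zero_iff] at this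
      exact this.trans ((le_max_left _ _).trans hR)
    have h2 : ‖p.1‖ ≤ R := (norm_fst_le p).trans h1
    have h3 : |p.2| ≤ R := (norm_snd_le p).trans h1
    simp only [I, Finset.mem_product]
    exact ⟨hfloor _ ((abs_apply_le_norm_plane _ _).trans h2),
      hfloor _ ((abs_apply_le_norm_plane _ _).trans h2), hfloor _ h3⟩
  -- Each occupied cell is represented by a point of S itself, since the bounds on the functions
  -- will be known on S only.
  set σ : ℤ × ℤ × ℤ → Plane × ℝ := fun k =>
    if hk : ∃ p ∈ S, κ p = k then hk.choose else 0 with hσ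
  have hσS : ∀ p ∈ S, σ (κ p) ∈ S ∧ κ (σ (κ p)) = κ p := by
    intro p hp
    have hk : ∃ q ∈ S, κ q = κ p := ⟨p, hp, rfl⟩
    simp only [hσ]
    rw [dif_pos hk]
    exact hk.choose_spec
  refine ⟨(I.filter fun k => ∃ p ∈ S, κ p = k).image σ, ?_, ?_, ?_⟩
  · intro q hq
    rw [Finset.mem_coe, Finset.mem_image] at hq
    obtain ⟨k, hk, rfl⟩ := hq
    obtain ⟨p, hp, rfl⟩ := (Finset.mem_filter.mp hk).2
    exact (hσS p hp).1
  · have hcard : I.card = (2 * (R * m) + 1) ^ 3 := by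
      simp only [I, Finset.card_product, Int.card_Icc]
      have : (N + 1 - -N).toNat = 2 * (R * m) + 1 := by
        have h1 : N = ((R * m : ℕ) : ℤ) := by simp [hN]
        rw [h1]; omega
      rw [this]; ring
    have h1 := (Finset.card_image_le (s := I.filter fun k => ∃ p ∈ S, κ p = k) (f := σ)).trans
      (Finset.card_filter_le _ _)
    rw [hcard] at h1
    calc ((Finset.image σ _).card : ℝ) ≤ (((2 * (R * m) + 1) ^ 3 : ℕ) : ℝ) := by exact_mod_cast h1
      _ = (2 * (R * m : ℝ) + 1) ^ 3 := by push_cast; ring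
      _ ≤ (3 * (R * m : ℝ)) ^ 3 := by
          gcongr
          nlinarith
      _ = _ := by ring
  · intro p hp
    obtain ⟨h1, h2⟩ := hσS p hp
    refine ⟨σ (κ p), Finset.mem_image.mpr ⟨κ p, Finset.mem_filter.mpr ⟨hmem p hp, p, hp, rfl⟩,
      rfl⟩, ?_⟩
    set q := σ (κ p)
    have hdiff : ∀ x y : ℝ, ⌊m * y⌋ = ⌊m * x⌋ → |x - y| ≤ 1 / m := by
      intro x y hxy
      have := Int.abs_sub_lt_one_of_floor_eq_floor hxy.symm
      rw [← mul_sub, abs_mul, abs_of_pos hm0] at this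
      rw [le_div_iff₀ hm0]
      linarith
    simp only [hκ, Prod.mk.injEq] at h2
    have h3 := hdiff _ _ h2.1
    have h4 := hdiff _ _ h2.2.1
    have h5 := hdiff _ _ h2.2.2
    have h6 : 0 < 1 / (m : ℝ) := by positivity
    have h7 : (2 : ℝ) / m = 2 * (1 / m) := by ring
    rw [Prod.norm_def, h7]
    refine max_le ?_ ?_
    · refine norm_plane_le_of_forall fun i => ?_
      fin_cases i
      · exact h3
      · exact h4
    · rw [Real.norm_eq_abs]
      refine le_trans h5 (by linarith)

lemma abs_empDev_sub_le [IsProbabilityMeasure μ] {φ ψ : E → ℝ} (hφ : Integrable φ μ)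
    (hψ : Integrable ψ μ) {c : ℝ} (hc : ∀ y, |φ y - ψ y| ≤ c) (n : ℕ) (ω : Ω) :
    |empDev μ X φ n ω - empDev μ X ψ n ω| ≤ 2 * c := by
  have hc0 : 0 ≤ c := by
    have : Nonempty E := by
      by_contra h
      rw [not_nonempty_iff] at h
      have h1 := measure_univ (μ := μ)
      simp [Set.univ_eq_empty_iff.mpr h] at h1
    exact (abs_nonneg _).trans (hc (Classical.arbitrary E))
  have h1 : empDev μ X φ n ω - empDev μ X ψ n ω
      = (n : ℝ)⁻¹ * ∑ i ∈ Finset.range n, (φ (X i ω) - ψ (X i ω)) - ∫ y, (φ y - ψ y) ∂μ := by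
    rw [integral_sub hφ hψ, Finset.sum_sub_distrib]
    simp only [empDev]; ring
  rw [h1]
  refine (abs_sub _ _).trans ?_
  have h2 := abs_integral_le_of_abs_le (μ := μ) hc
  have h3 : |(n : ℝ)⁻¹ * ∑ i ∈ Finset.range n, (φ (X i ω) - ψ (X i ω))| ≤ c := by
    rw [abs_mul, abs_inv, Nat.abs_cast]
    rcases Nat.eq_zero_or_pos n with rfl | hn
    · simpa using hc0
    rw [inv_mul_le_iff₀ (by exact_mod_cast hn)]
    calc _ ≤ ∑ i ∈ Finset.range n, |φ (X i ω) - ψ (X i ω)| := Finset.abs_sum_le_sum_abs _ _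
      _ ≤ ∑ _i ∈ Finset.range n, c := Finset.sum_le_sum fun i _ => hc _
      _ = _ := by simp
  linarith

/-- Uniform deviation bound over a class of bounded functions with a parameter in `ℝ² × ℝ`. -/
theorem tendsto_measure_exists_empDev (hXm : ∀ i, Measurable (X i)) (hXi : iIndepFun X P)
    (hXl : ∀ i, P.map (X i) = μ) {S : Set (Plane × ℝ)} (hS : Bornology.IsBounded S)
    {φ : ℕ → Plane × ℝ → E → ℝ} {b v ℓ : ℕ → ℝ}
    (hφ : ∀ᶠ n in atTop, ∀ p ∈ S, Measurable (φ n p))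
    (hb : ∀ᶠ n in atTop, ∀ p ∈ S, ∀ y, |φ n p y| ≤ b n)
    (hv : ∀ᶠ n in atTop, ∀ p ∈ S, ∫ y, φ n p y ^ 2 ∂μ ≤ v n)
    (hℓ : ∀ᶠ n in atTop, ∀ p ∈ S, ∀ q ∈ S, ∀ y, |φ n p y - φ n q y| ≤ ℓ n * ‖p - q‖)
    (hv0 : ∀ᶠ n in atTop, 0 < v n)
    (hbv : ∀ᶠ n : ℕ in atTop, (2 * b n) ^ 2 * Real.log n ≤ n * v n)
    (hℓv : ∀ᶠ n : ℕ in atTop, ℓ n ≤ n * √(v n)) :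
    Tendsto (fun n => P {ω | ∃ p ∈ S, 12 * √(v n * Real.log n / n) < |empDev μ X (φ n p) n ω|})
      atTop (𝓝 0) := by
  have : IsProbabilityMeasure μ := by
    rw [← hXl 0]; exact Measure.isProbabilityMeasure_map (hXm 0).aemeasurable
  obtain ⟨C, hC, hnet⟩ := exists_net hS
  have hlim : Tendsto (fun n : ℕ => ENNReal.ofReal (2 * C / n)) atTop (𝓝 0) := by
    rw [← ENNReal.ofReal_zero]
    exact ENNReal.tendsto_ofReal (tendsto_const_div_atTop_nhds_zero_nat _)
  refine tendsto_of_tendsto_of_tendsto_of_le_of_le' tendsto_const_nhds hlim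
    (Eventually.of_forall fun _ => zero_le) ?_
  filter_upwards [hφ, hb, hv, hℓ, hv0, hbv, hℓv, eventually_ge_atTop 3] with
    n hφ hb hv hℓ hv0 hbv hℓv hn3
  have hn : (3 : ℝ) ≤ n := by exact_mod_cast hn3
  have hn0 : (0 : ℝ) < n := by linarith
  have hlog : 1 ≤ Real.log n := by
    rw [Real.le_log_iff_exp_le hn0]
    exact (Real.exp_one_lt_d9.le.trans (by norm_num)).trans hn
  set lg := Real.log n with hlg
  -- This λ balances the two terms of the exponent: nλr = log n and nλ²v = log n.
  set lam := √(lg / (n * v n)) with hlam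
  set r := √(v n * lg / n) with hr
  have hlr : n * lam * r = lg := by
    have h1 : lam * r = lg / n := by
      rw [hlam, hr, ← Real.sqrt_mul (by positivity)]
      rw [show lg / (n * v n) * (v n * lg / n) = (lg / n) ^ 2 by field_simp]
      exact Real.sqrt_sq (by positivity)
    rw [mul_assoc, h1]; field_simp
  have hl2 : n * (lam ^ 2 * v n) = lg := by
    rw [hlam, Real.sq_sqrt (by positivity)]; field_simp
  have hr0 : 0 ≤ r := Real.sqrt_nonneg _
  -- Mesh 2/n² makes the discretization negligible and costs at most a constant times n⁶ points.
  obtain ⟨T, hTS, hTc, hT⟩ := hnet (n ^ 2) (by nlinarith)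
  have hprob : ∀ q ∈ T, P.real {ω | 8 * r ≤ |empDev μ X (φ n q) n ω|} ≤ 2 * ((n : ℝ) ^ 7)⁻¹ := by
    intro q hq
    have hb' := hb q (hTS hq)
    have hlb : 2 * b n * lam ≤ 1 := by
      have h1 : (2 * b n * lam) ^ 2 ≤ 1 := by
        rw [mul_pow, hlam, Real.sq_sqrt (by positivity), ← mul_div_assoc]
        exact div_le_one_of_le₀ hbv (by positivity)
      nlinarith
    have := bernstein (τ := 8 * r) hXm hXi hXl (hφ q (hTS hq)) hb' (hv q (hTS hq))
      (Real.sqrt_nonneg _) hlb (by omega : 0 < n)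
    refine this.trans (le_of_eq ?_)
    -- With deviation 8r the exponent is −8 log n + log n, so each net point fails with probability
    -- at most 2n⁻⁷, which beats the n⁶ points.
    have h2 : -(n * lam * (8 * r)) + n * (lam ^ 2 * v n) = -((7 : ℕ) * lg) := by
      rw [hl2, show (n : ℝ) * lam * (8 * r) = 8 * (n * lam * r) by ring, hlr]; push_cast; ring
    rw [h2, Real.exp_neg, Real.exp_nat_mul, hlg, Real.exp_log hn0]
  have hsub : {ω | ∃ p ∈ S, 12 * r < |empDev μ X (φ n p) n ω|}
      ⊆ ⋃ q ∈ T, {ω | 8 * r ≤ |empDev μ X (φ n q) n ω|} := by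
    rintro ω ⟨p, hp, hpω⟩
    obtain ⟨q, hq, hpq⟩ := hT p hp
    refine Set.mem_biUnion hq ?_
    have h1 := abs_empDev_sub_le (X := X) (integrable_of_abs_le (μ := μ) (hφ p hp) (hb p hp))
      (integrable_of_abs_le (μ := μ) (hφ q (hTS hq)) (hb q (hTS hq)))
      (hℓ p hp q (hTS hq)) n ω
    -- Passing to the nearest net point costs at most 2 · n√v · 2/n² ≤ 4r, which explains 12 = 8 +
    -- 4.
    have h2 : 2 * (ℓ n * ‖p - q‖) ≤ 4 * r := by
      have h3 : ℓ n * ‖p - q‖ ≤ (n * √(v n)) * (2 / ((n ^ 2 : ℕ) : ℝ)) := by gcongr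
      have h4 : (n * √(v n)) * (2 / ((n ^ 2 : ℕ) : ℝ)) = 2 * (√(v n) / n) := by
        push_cast; field_simp
      have h5 : √(v n) / n ≤ r := by
        rw [hr, ← Real.sqrt_sq hn0.le, ← Real.sqrt_div hv0.le, Real.sqrt_sq hn0.le]
        apply Real.sqrt_le_sqrt
        rw [div_le_div_iff₀ (by positivity) hn0]
        have : 1 * 1 ≤ lg * n := by gcongr; linarith
        have h6 : 0 < v n * n := by positivity
        nlinarith
      linarith
    have h6 := abs_sub_abs_le_abs_sub (empDev μ X (φ n p) n ω) (empDev μ X (φ n q) n ω)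
    change 8 * r ≤ |empDev μ X (φ n q) n ω|
    linarith
  have hreal : P.real {ω | ∃ p ∈ S, 12 * r < |empDev μ X (φ n p) n ω|} ≤ 2 * C / n := by
    calc _ ≤ P.real (⋃ q ∈ T, {ω | 8 * r ≤ |empDev μ X (φ n q) n ω|}) :=
          measureReal_mono hsub (measure_ne_top P _)
      _ ≤ ∑ q ∈ T, P.real {ω | 8 * r ≤ |empDev μ X (φ n q) n ω|} :=
          measureReal_biUnion_finset_le _ _
      _ ≤ ∑ _q ∈ T, 2 * ((n : ℝ) ^ 7)⁻¹ := Finset.sum_le_sum hprob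
      _ = T.card * (2 * ((n : ℝ) ^ 7)⁻¹) := by rw [Finset.sum_const, nsmul_eq_mul]
      _ ≤ (C * ((n ^ 2 : ℕ) : ℝ) ^ 3) * (2 * ((n : ℝ) ^ 7)⁻¹) := by gcongr
      _ = 2 * C / n := by push_cast; field_simp
  rw [← ENNReal.ofReal_toReal (measure_ne_top P _)]
  exact ENNReal.ofReal_le_ofReal hreal

end Deviations

/-! ### Derivatives of the kernel and of the kernel estimator -/

/-- A bounded Lipschitz function which vanishes outside the unit ball. -/
structure Bump (κ : Plane → ℝ) (C : ℝ) : Prop where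
  one_le : 1 ≤ C
  abs_le : ∀ u, |κ u| ≤ C
  lip : ∀ u u', |κ u - κ u'| ≤ C * ‖u - u'‖
  zero : ∀ u, 1 < ‖u‖ → κ u = 0

lemma Bump.continuous {κ : Plane → ℝ} {C : ℝ} (hκ : Bump κ C) : Continuous κ :=
  (LipschitzWith.of_dist_le' (K := C) fun x y => by
    rw [Real.dist_eq, dist_eq_norm]; exact hκ.lip x y).continuous

lemma tsupport_pderivs_subset (l : List (Fin 2)) (g : Plane → ℝ) :
    tsupport (pderivs l g) ⊆ tsupport g := by
  induction l with
  | nil => exact subset_rfl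
  | cons i l ih =>
    refine subset_trans ?_ ih
    refine closure_minimal (fun x hx => ?_) (isClosed_tsupport _)
    refine support_fderiv_subset ℝ (f := pderivs l g) fun h => hx ?_
    simp [pderivs, pderiv, h]

namespace IsKernel

variable {K : Plane → ℝ}

lemma differentiable_iteratedFDeriv (hK : IsKernel K) {k : ℕ} (hk : k ≤ 3) :
    Differentiable ℝ (iteratedFDeriv ℝ k K) := by
  rcases Nat.lt_or_eq_of_le hk with h | rfl
  · exact hK.contDiff.differentiable_iteratedFDeriv (by exact_mod_cast h)
  · exact hK.differentiable

lemma pderivs_eq_zero (hK : IsKernel K) (l : List (Fin 2)) {u : Plane} (hu : 1 < ‖u‖) :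
    pderivs l K u = 0 := by
  by_contra h
  have h1 := tsupport_pderivs_subset l K (subset_tsupport _ (Function.mem_support.mpr h))
  rw [hK.support_eq, mem_closedBall_zero_iff] at h1
  linarith

/-- The bounded derivative of order k + 1 serves as Lipschitz constant for order k. Fourth
derivatives are needed only for this, at k = 3. -/
lemma exists_bump (hK : IsKernel K) :
    ∃ C, ∀ l : List (Fin 2), 1 ≤ l.length → l.length ≤ 3 → Bump (pderivs l K) C := by
  obtain ⟨C1, h1⟩ := hK.bounded 1 (by norm_num) (by norm_num)
  obtain ⟨C2, h2⟩ := hK.bounded 2 (by norm_num) (by norm_num)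
  obtain ⟨C3, h3⟩ := hK.bounded 3 (by norm_num) (by norm_num)
  obtain ⟨C4, h4⟩ := hK.bounded 4 (by norm_num) (by norm_num)
  set C := max 1 (max (max C1 C2) (max C3 C4)) with hC
  have hb : ∀ k : ℕ, 1 ≤ k → k ≤ 4 → ∀ x, ‖iteratedFDeriv ℝ k K x‖ ≤ C := by
    intro k hk1 hk4 x
    interval_cases k
    · exact (h1 x).trans (by simp [hC])
    · exact (h2 x).trans (by simp [hC])
    · exact (h3 x).trans (by simp [hC])
    · exact (h4 x).trans (by simp [hC])
  refine ⟨C, fun l hl1 hl3 => ⟨le_max_left _ _, fun u => ?_, fun u u' => ?_, fun u hu =>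
    hK.pderivs_eq_zero l hu⟩⟩
  · exact (abs_pderivs_le l (fun k hk => hK.differentiable_iteratedFDeriv (by omega)) u).trans
      (hb _ hl1 (by omega) u)
  · exact abs_pderivs_sub_le l (fun k hk => hK.differentiable_iteratedFDeriv (by omega))
      (fun z => hb _ (by omega) (by omega) z) u u'

lemma contDiff_pderivs (hK : IsKernel K) (l : List (Fin 2)) {k : ℕ} (hl : k + l.length ≤ 3) :
    ContDiff ℝ k (pderivs l K) :=
  Filament.contDiff_pderivs l (hK.contDiff.of_le (by exact_mod_cast hl))

end IsKernel

lemma pderivs_translates {φ : Plane → ℝ} (l : List (Fin 2))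
    (hφ : ∀ l' : List (Fin 2), l'.length < l.length → Differentiable ℝ (pderivs l' φ))
    (c h : ℝ) (n : ℕ) (x : ℕ → Plane) (z : Plane) :
    pderivs l (fun z => c * ∑ i ∈ Finset.range n, φ (h⁻¹ • (z - x i))) z
      = c * h⁻¹ ^ l.length * ∑ i ∈ Finset.range n, pderivs l φ (h⁻¹ • (z - x i)) := by
  induction l generalizing z with
  | nil => simp [pderivs]
  | cons j l ih =>
    have h1 : pderivs l (fun z => c * ∑ i ∈ Finset.range n, φ (h⁻¹ • (z - x i)))
        = fun z => c * h⁻¹ ^ l.length * ∑ i ∈ Finset.range n, pderivs l φ (h⁻¹ • (z - x i)) :=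
      funext fun z => ih (fun l' hl' => hφ l' (by simp; omega)) z
    have hd := hφ l (by simp)
    have h2 : ∀ i, HasFDerivAt (fun z => pderivs l φ (h⁻¹ • (z - x i)))
        (h⁻¹ • fderiv ℝ (pderivs l φ) (h⁻¹ • (z - x i))) z := by
      intro i
      have h3 : HasFDerivAt (fun z : Plane => h⁻¹ • (z - x i))
          (h⁻¹ • ContinuousLinearMap.id ℝ Plane) z :=
        ((hasFDerivAt_id z).sub_const (x i)).const_smul h⁻¹
      refine ((hd _).hasFDerivAt.comp z h3).congr_fderiv ?_
      ext v; simp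
    have h4 := (HasFDerivAt.fun_sum (u := Finset.range n) fun i _ => h2 i).const_mul
      (c * h⁻¹ ^ l.length)
    rw [pderivs, h1, pderiv, h4.fderiv]
    simp only [smul_apply, smul_eq_mul, sum_apply,
      List.length_cons, pow_succ, ← Finset.mul_sum]
    simp only [pderivs, pderiv]
    ring

/-- The common law of the observations. -/
def law (f : Plane → ℝ) : Measure Plane := volume.withDensity fun x => ENNReal.ofReal (f x)

/-- The rescaled kernel derivative, a function of the observation. -/
def kernelAt (K : Plane → ℝ) (h : ℝ) (l : List (Fin 2)) (x y : Plane) : ℝ :=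
  (h ^ (2 + l.length))⁻¹ * pderivs l K (h⁻¹ • (x - y))

/-- The expectation of an iterated partial derivative of the kernel estimator. -/
def kdeMean (f K : Plane → ℝ) (h : ℝ) (l : List (Fin 2)) (x : Plane) : ℝ :=
  ∫ y, kernelAt K h l x y ∂law f

/-! ### The estimator as an empirical mean of rescaled kernel derivatives -/

section Kde

variable {Ω : Type*} {f K : Plane → ℝ} {h : ℕ → ℝ} {X : ℕ → Ω → Plane}

lemma IsKernel.pderivs_fHat (hK : IsKernel K) (l : List (Fin 2)) (hl : l.length ≤ 3) (n : ℕ)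
    (ω : Ω) (x : Plane) :
    pderivs l (fHat K h X n ω) x
      = (n : ℝ)⁻¹ * ∑ i ∈ Finset.range n, kernelAt K (h n) l x (X i ω) := by
  have h1 := pderivs_translates (φ := K) l (fun l' hl' =>
    (hK.contDiff_pderivs l' (k := 1) (by omega)).differentiable (by norm_num))
    ((n : ℝ) * h n ^ 2)⁻¹ (h n) n (fun i => X i ω) x
  refine h1.trans ?_
  simp only [kernelAt, ← Finset.mul_sum]
  rw [pow_add, mul_inv, mul_inv, inv_pow]
  ring

lemma IsKernel.pderivs_fHat_sub (hK : IsKernel K) (l : List (Fin 2)) (hl : l.length ≤ 3) (n : ℕ)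
    (ω : Ω) (x : Plane) :
    pderivs l (fHat K h X n ω) x - kdeMean f K (h n) l x
      = empDev (law f) X (kernelAt K (h n) l x) n ω := by
  rw [hK.pderivs_fHat l hl]; rfl

lemma IsKernel.contDiff_fHat (hK : IsKernel K) (n : ℕ) (ω : Ω) :
    ContDiff ℝ 3 (fHat K h X n ω) := by
  have hK' := hK.contDiff
  unfold fHat kde
  refine contDiff_const.mul (ContDiff.sum fun i _ => hK'.comp ?_)
  exact (contDiff_id.sub contDiff_const).const_smul _

lemma Bump.abs_kernel_sub_le {κ : Plane → ℝ} {C : ℝ} (hκ : Bump κ C) {h : ℝ} (hh : 0 < h)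
    (x x' y : Plane) :
    |κ (h⁻¹ • (x - y)) - κ (h⁻¹ • (x' - y))| ≤ C * (h⁻¹ * ‖x - x'‖) := by
  refine (hκ.lip _ _).trans (le_of_eq ?_)
  rw [← smul_sub, norm_smul, Real.norm_eq_abs, abs_of_pos (inv_pos.mpr hh)]
  congr 3
  abel

lemma IsKernel.tame_fHat (hK : IsKernel K) (hh : ∀ n, 0 < h n) (n : ℕ) (ω : Ω) :
    Tame (fHat K h X n ω) := by
  obtain ⟨C, hC⟩ := hK.exists_bump
  have hB : ∀ j, Bump (pderivs (d2Index j) K) C := fun j =>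
    hC _ (by rw [length_d2Index]; norm_num) (by rw [length_d2Index]; norm_num)
  have hC1 := (hB 0).one_le
  set A : ℝ := (n : ℝ)⁻¹ * ∑ _i ∈ Finset.range n, (h n ^ (2 + 2))⁻¹ * C with hA
  have hhn := hh n
  have hA0 : 0 ≤ A := by
    refine mul_nonneg (by positivity) (Finset.sum_nonneg fun _ _ => by positivity)
  refine tame_of_pderivs (C := A + A * (h n)⁻¹) (fun j x => ?_) (fun j x y => ?_)
  · rw [hK.pderivs_fHat _ (by rw [length_d2Index]; norm_num), abs_mul, abs_inv, Nat.abs_cast]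
    have : 0 ≤ A * (h n)⁻¹ := by positivity
    refine le_trans ?_ (le_add_of_nonneg_right this)
    rw [hA]
    gcongr
    refine (Finset.abs_sum_le_sum_abs _ _).trans (Finset.sum_le_sum fun i _ => ?_)
    rw [kernelAt, abs_mul, length_d2Index, abs_of_pos (show 0 < (h n ^ (2 + 2))⁻¹ by positivity)]
    gcongr
    exact (hB j).abs_le _
  · rw [hK.pderivs_fHat _ (by rw [length_d2Index]; norm_num),
      hK.pderivs_fHat _ (by rw [length_d2Index]; norm_num), ← mul_sub, ← Finset.sum_sub_distrib,
      abs_mul, abs_inv, Nat.abs_cast]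
    have h1 : A * (h n)⁻¹ * ‖x - y‖ ≤ (A + A * (h n)⁻¹) * ‖x - y‖ := by gcongr; linarith
    refine le_trans ?_ h1
    rw [hA, mul_assoc, mul_assoc, Finset.sum_mul]
    gcongr
    refine (Finset.abs_sum_le_sum_abs _ _).trans (Finset.sum_le_sum fun i _ => ?_)
    rw [kernelAt, kernelAt, ← mul_sub, abs_mul, length_d2Index,
      abs_of_pos (show 0 < (h n ^ (2 + 2))⁻¹ by positivity), mul_assoc]
    gcongr
    exact (hB j).abs_kernel_sub_le hhn x y _

/-! ### The law of the observations -/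

lemma SmoothDensity.measurable_ofReal (hf : SmoothDensity f) :
    Measurable fun x => ENNReal.ofReal (f x) :=
  hf.contDiff.continuous.measurable.ennreal_ofReal

lemma SmoothDensity.isProbabilityMeasure_law (hf : SmoothDensity f) :
    IsProbabilityMeasure (law f) := by
  constructor
  rw [law, withDensity_apply _ MeasurableSet.univ, Measure.restrict_univ,
    ← ofReal_integral_eq_lintegral_ofReal hf.integrable (ae_of_all _ hf.nonneg),
    hf.integral_eq_one, ENNReal.ofReal_one]

lemma SmoothDensity.integral_law (hf : SmoothDensity f) (φ : Plane → ℝ) :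
    ∫ y, φ y ∂law f = ∫ y, φ y * f y := by
  rw [law, integral_withDensity_eq_integral_toReal_smul hf.measurable_ofReal
    (ae_of_all _ fun _ => ENNReal.ofReal_lt_top)]
  refine integral_congr_ae (ae_of_all _ fun y => ?_)
  simp only [ENNReal.toReal_ofReal (hf.nonneg y), smul_eq_mul]
  ring

/-- Small balls have small probability. -/
lemma SmoothDensity.exists_ball_bound (hf : SmoothDensity f) (R : ℝ) :
    ∃ F : ℝ, 0 < F ∧ ∀ x ∈ Metric.closedBall 0 R, ∀ h, 0 < h → h ≤ 1 →
      (law f).real (Metric.closedBall x h) ≤ F * h ^ 2 := by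
  obtain ⟨F, hF⟩ := (isCompact_closedBall (0 : Plane) (R + 1)).bddAbove_image
    hf.contDiff.continuous.continuousOn
  set F' := max F 1 with hF'
  refine ⟨F' * Real.pi, by positivity, fun x hx h hh hh1 => ?_⟩
  have hsub : ∀ y ∈ Metric.closedBall x h, f y ≤ F' := fun y hy => by
    refine (hF ⟨y, ?_, rfl⟩).trans (le_max_left _ _)
    rw [Metric.mem_closedBall] at *
    linarith [dist_triangle y x 0]
  have h1 : law f (Metric.closedBall x h) ≤ ENNReal.ofReal (F' * Real.pi * h ^ 2) := by
    rw [law, withDensity_apply _ Metric.isClosed_closedBall.measurableSet]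
    calc ∫⁻ y in Metric.closedBall x h, ENNReal.ofReal (f y)
        ≤ ∫⁻ _y in Metric.closedBall x h, ENNReal.ofReal F' :=
          setLIntegral_mono' Metric.isClosed_closedBall.measurableSet fun y hy =>
            ENNReal.ofReal_le_ofReal (hsub y hy)
      _ = ENNReal.ofReal F' * (ENNReal.ofReal h ^ 2 * ENNReal.ofReal Real.pi) := by
          rw [setLIntegral_const, EuclideanSpace.volume_closedBall_fin_two]
      _ = _ := by
          rw [← ENNReal.ofReal_pow hh.le, ← ENNReal.ofReal_mul (by positivity),
            ← ENNReal.ofReal_mul (by positivity)]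
          congr 1; ring
  exact ENNReal.toReal_le_of_le_ofReal (by positivity) h1

lemma Bump.kernel_eq_zero {κ : Plane → ℝ} {C : ℝ} (hκ : Bump κ C) {h : ℝ} (hh : 0 < h)
    {x y : Plane} (hxy : h < ‖x - y‖) : κ (h⁻¹ • (x - y)) = 0 := by
  refine hκ.zero _ ?_
  rw [norm_smul, Real.norm_eq_abs, abs_of_pos (inv_pos.mpr hh), ← div_eq_inv_mul, one_lt_div hh]
  exact hxy

/-- Integrals of functions which are bounded and supported in a small ball. -/
lemma integral_le_of_ball [IsFiniteMeasure (law f)] {ψ : Plane → ℝ} {B h : ℝ}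
    {x : Plane} (hB : ∀ y, |ψ y| ≤ B) (h0 : ∀ y, h < ‖x - y‖ → ψ y = 0) :
    ∫ y, ψ y ∂law f ≤ B * (law f).real (Metric.closedBall x h) := by
  have h1 : ∫ y, ψ y ∂law f = ∫ y in Metric.closedBall x h, ψ y ∂law f := by
    symm
    refine setIntegral_eq_integral_of_forall_compl_eq_zero fun y hy => h0 y ?_
    rw [Metric.mem_closedBall, dist_eq_norm, norm_sub_rev] at hy
    exact not_le.mp hy
  rw [h1]
  refine (le_abs_self _).trans ?_
  exact norm_setIntegral_le_of_norm_le_const (f := ψ) (measure_lt_top _ _) fun y _ => hB y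

lemma IsBandwidth.eventually_le_one (hh : IsBandwidth h) : ∀ᶠ n in atTop, h n ≤ 1 := by
  have := hh.tendsto_zero.eventually (gt_mem_nhds (show (0 : ℝ) < 1 by norm_num))
  filter_upwards [this] with n hn using hn.le

lemma eventually_one_le_log : ∀ᶠ n : ℕ in atTop, 1 ≤ Real.log n := by
  filter_upwards [eventually_ge_atTop 3] with n hn
  have hn' : (3 : ℝ) ≤ n := by exact_mod_cast hn
  rw [Real.le_log_iff_exp_le (by linarith)]
  exact (Real.exp_one_lt_d9.le.trans (by norm_num)).trans hn'

/-- `n h⁸` dominates any multiple of `log n`. -/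
lemma IsBandwidth.eventually_log_le (hh : IsBandwidth h) (A : ℝ) :
    ∀ᶠ n : ℕ in atTop, A * Real.log n ≤ n * h n ^ 8 := by
  filter_upwards [hh.tendsto_atTop.eventually_ge_atTop (max A 0), eventually_one_le_log]
    with n hn hlog
  rw [le_div_iff₀ (by positivity)] at hn
  have h2 : Real.log n ≤ Real.log n ^ 3 := le_self_pow₀ hlog (by norm_num)
  calc A * Real.log n ≤ max A 0 * Real.log n := by gcongr; exact le_max_left _ _
    _ ≤ max A 0 * Real.log n ^ 3 := by gcongr
    _ ≤ _ := hn

lemma IsBandwidth.eventually_log_le_pow (hh : IsBandwidth h) (A : ℝ) {k : ℕ} (hk : k ≤ 8) :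
    ∀ᶠ n : ℕ in atTop, A * Real.log n ≤ n * h n ^ k := by
  filter_upwards [hh.eventually_log_le A, hh.eventually_le_one] with n h1 h2
  refine h1.trans ?_
  gcongr ?_ * ?_
  exact pow_le_pow_of_le_one (hh.pos n).le h2 hk

variable [MeasurableSpace Ω] {P : Measure Ω} [IsProbabilityMeasure P]

/-- Uniform rates of the derivatives of the kernel estimator around their expectations. -/
theorem tendsto_measure_pderivs_fHat (hf : SmoothDensity f) (hK : IsKernel K) (hh : IsBandwidth h)
    (hX : IsSample P f X) (R : ℝ) (l : List (Fin 2)) (hl1 : 1 ≤ l.length) (hl3 : l.length ≤ 3) :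
    ∃ M : ℝ, 0 < M ∧ Tendsto (fun n : ℕ => P {ω | ∃ x ∈ Metric.closedBall (0 : Plane) R,
      M * √(Real.log n / (n * h n ^ (2 + 2 * l.length)))
        < |pderivs l (fHat K h X n ω) x - kdeMean f K (h n) l x|}) atTop (𝓝 0) := by
  have := hf.isProbabilityMeasure_law
  obtain ⟨C, hC⟩ := hK.exists_bump
  have hκ := hC l hl1 hl3
  have hC1 := hκ.one_le
  obtain ⟨F, hF0, hF⟩ := hf.exists_ball_bound R
  set k := l.length with hk
  -- The factor F gives the variance constant; the summand 1 ensures A ≥ C², used for the envelope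
  -- and for the Lipschitz condition.
  set A : ℝ := C ^ 2 * (F + 1) with hA
  have hA0 : 0 < A := by positivity
  have hCA : C ≤ √A := by
    apply Real.le_sqrt_of_sq_le
    rw [hA]
    nlinarith [sq_nonneg C]
  -- The parameter here is a point of the plane only; the second coordinate of the net is frozen at
  -- 0.
  set S : Set (Plane × ℝ) := Metric.closedBall (0 : Plane) R ×ˢ {0} with hS
  have hSb : Bornology.IsBounded S := Metric.isBounded_closedBall.prod Bornology.isBounded_singleton
  have hmeas : ∀ n x, Measurable (kernelAt K (h n) l x) := fun n x => by
    have := hκ.continuous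
    unfold kernelAt
    exact Continuous.measurable (by fun_prop)
  have key := tendsto_measure_exists_empDev (P := P) (μ := law f) hX.measurable hX.indep hX.law hSb
    (φ := fun n p y => kernelAt K (h n) l p.1 y)
    (b := fun n => (h n ^ (2 + k))⁻¹ * C)
    -- The squared envelope h^(−2(2+k)) is multiplied by the probability O(h²) of the support.
    (v := fun n => A * (h n ^ (2 + 2 * k))⁻¹)
    (ℓ := fun n => (h n ^ (2 + k))⁻¹ * (C * (h n)⁻¹))
    (Eventually.of_forall fun n p _ => hmeas n p.1)
    (Eventually.of_forall fun n p _ y => by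
      have := hh.pos n
      rw [kernelAt, abs_mul, abs_of_pos (show 0 < (h n ^ (2 + l.length))⁻¹ by positivity)]
      gcongr
      exact hκ.abs_le _)
    (by
      filter_upwards [hh.eventually_le_one] with n hn1 p hp
      have hn := hh.pos n
      have h1 := integral_le_of_ball (f := f) (h := h n) (x := p.1)
        (ψ := fun y => kernelAt K (h n) l p.1 y ^ 2)
        (B := ((h n ^ (2 + k))⁻¹ * C) ^ 2)
        (fun y => by
          rw [abs_pow, kernelAt, abs_mul,
            abs_of_pos (show 0 < (h n ^ (2 + l.length))⁻¹ by positivity)]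
          gcongr
          exact hκ.abs_le _)
        (fun y hy => by rw [kernelAt, hκ.kernel_eq_zero hn hy]; simp)
      refine h1.trans ?_
      calc _ ≤ ((h n ^ (2 + k))⁻¹ * C) ^ 2 * (F * h n ^ 2) := by
            gcongr
            exact hF p.1 hp.1 (h n) hn hn1
        _ = C ^ 2 * F * (h n ^ (2 + 2 * k))⁻¹ := by
            have h2 : h n ^ (2 + k) ≠ 0 := by positivity
            have h3 : h n ^ (2 + 2 * k) ≠ 0 := by positivity
            have h4 : (h n ^ (2 + k)) ^ 2 = h n ^ (2 + 2 * k) * h n ^ 2 := by ring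
            rw [mul_pow, inv_pow, h4]
            field_simp
        _ ≤ _ := by gcongr; rw [hA]; nlinarith [sq_nonneg C])
    (Eventually.of_forall fun n p hp q hq y => by
      have hn := hh.pos n
      have hpq : ‖p.1 - q.1‖ ≤ ‖p - q‖ := norm_fst_le (p - q)
      rw [kernelAt, kernelAt, ← mul_sub, abs_mul,
        abs_of_pos (show 0 < (h n ^ (2 + l.length))⁻¹ by positivity), mul_assoc]
      gcongr
      refine (hκ.abs_kernel_sub_le hn _ _ _).trans ?_
      rw [mul_assoc]
      gcongr)
    (Eventually.of_forall fun n => by have := hh.pos n; positivity)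
    (by
      filter_upwards [hh.eventually_log_le_pow 4 (show 2 ≤ 8 by norm_num)] with n hn
      have hn0 := hh.pos n
      have h4 : (h n ^ (2 + k)) ^ 2 = h n ^ (2 + 2 * k) * h n ^ 2 := by ring
      calc (2 * ((h n ^ (2 + k))⁻¹ * C)) ^ 2 * Real.log n
          = C ^ 2 * (h n ^ (2 + 2 * k))⁻¹ * ((4 * Real.log n) * (h n ^ 2)⁻¹) := by
            rw [mul_pow, mul_pow, inv_pow, h4]; field_simp; ring
        _ ≤ C ^ 2 * (h n ^ (2 + 2 * k))⁻¹ * ((n * h n ^ 2) * (h n ^ 2)⁻¹) := by gcongr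
        _ = n * (C ^ 2 * (h n ^ (2 + 2 * k))⁻¹) := by field_simp
        _ ≤ n * (A * (h n ^ (2 + 2 * k))⁻¹) := by
            gcongr; rw [hA]; nlinarith [sq_nonneg C])
    (by
      filter_upwards [hh.eventually_log_le_pow 1 (show 2 ≤ 8 by norm_num),
        eventually_one_le_log] with n hn hlog
      have hn0 := hh.pos n
      have h5 : h n ^ (2 + 2 * k) = (h n ^ (1 + k)) ^ 2 := by ring
      rw [Real.sqrt_mul hA0.le, h5, Real.sqrt_inv, Real.sqrt_sq (by positivity)]
      have h6 : 1 ≤ n * h n ^ 2 := by linarith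
      calc (h n ^ (2 + k))⁻¹ * (C * (h n)⁻¹) = C * ((h n ^ 2)⁻¹ * (h n ^ (1 + k))⁻¹) * 1 := by
            rw [pow_add, pow_add]; field_simp
        _ ≤ √A * ((h n ^ 2)⁻¹ * (h n ^ (1 + k))⁻¹) * (n * h n ^ 2) := by gcongr
        _ = _ := by field_simp)
  refine ⟨12 * √A, by positivity, ?_⟩
  refine tendsto_of_tendsto_of_tendsto_of_le_of_le tendsto_const_nhds key (fun _ => zero_le)
    fun n => measure_mono ?_
  rintro ω ⟨x, hx, hxω⟩
  refine ⟨(x, 0), ⟨hx, rfl⟩, ?_⟩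
  rw [hK.pderivs_fHat_sub l hl3] at hxω
  refine lt_of_eq_of_lt ?_ hxω
  have hn0 := hh.pos n
  rw [mul_assoc (12 : ℝ) (√A), ← Real.sqrt_mul hA0.le]
  congr 2
  field_simp

end Kde

/-! ### The bias of the derivatives of the kernel estimator -/

lemma pderivs_pderiv {g : Plane → ℝ} (l : List (Fin 2)) (i : Fin 2)
    (hg : ContDiff ℝ (l.length + 1 : ℕ) g) :
    pderivs l (pderiv i g) = pderiv i (pderivs l g) := by
  induction l with
  | nil => rfl
  | cons j l ih =>
    have h1 : ContDiff ℝ (l.length + 1 : ℕ) g := hg.of_le (by simp)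
    have h2 : ContDiff ℝ (2 : ℕ) (pderivs l g) :=
      contDiff_pderivs l (by convert hg using 2; simp; ring)
    funext x
    rw [pderivs, ih h1, pderivs]
    exact pderiv_comm h2 x j i

/-- Integration by parts, one derivative at a time. Compact support removes boundary terms, and the
sign cancels against that of the derivative of u ↦ g(x − hu), leaving a factor h. -/
lemma integral_pderivs_mul {φ g : Plane → ℝ} (l : List (Fin 2)) (hc : HasCompactSupport φ)
    (hφ : ContDiff ℝ l.length φ) (hg : ContDiff ℝ l.length g) (x : Plane) (h : ℝ) :
    ∫ u, pderivs l φ u * g (x - h • u) = h ^ l.length * ∫ u, φ u * pderivs l g (x - h • u) := by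
  induction l generalizing g with
  | nil => simp [pderivs]
  | cons i l ih =>
    have hφ1 : ContDiff ℝ (1 : ℕ) (pderivs l φ) :=
      contDiff_pderivs l (by convert hφ using 2; simp; ring)
    have hg' : ContDiff ℝ (l.length + 1 : ℕ) g := by simpa using hg
    have hgi : ContDiff ℝ l.length (pderiv i g) := contDiff_pderiv hg' i
    have hg1 : Differentiable ℝ g := hg'.differentiable (by norm_cast)
    have hd : ∀ u, HasFDerivAt (fun u => g (x - h • u))
        (-(h • fderiv ℝ g (x - h • u))) u := fun u => by
      have h1 : HasFDerivAt (fun u : Plane => x - h • u)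
          (-(h • ContinuousLinearMap.id ℝ Plane)) u :=
        ((hasFDerivAt_id u).const_smul h).const_sub x
      refine ((hg1 _).hasFDerivAt.comp u h1).congr_fderiv ?_
      ext v; simp
    have hcl : HasCompactSupport (pderivs l φ) := hc.mono'
      ((subset_tsupport _).trans (tsupport_pderivs_subset l φ))
    have hcl' : HasCompactSupport (pderivs (i :: l) φ) := hc.mono'
      ((subset_tsupport _).trans (tsupport_pderivs_subset (i :: l) φ))
    have hcont : Continuous (pderivs (i :: l) φ) := by
      have : ContDiff ℝ (0 : ℕ) (pderivs (i :: l) φ) := contDiff_pderiv (by simpa using hφ1) i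
      exact this.continuous
    have hφc := hφ1.continuous
    have hgc := hg1.continuous
    have hgic := hgi.continuous
    have hv : ∀ u, fderiv ℝ (fun u => g (x - h • u)) u (EuclideanSpace.single i 1)
        = -(h * pderiv i g (x - h • u)) := fun u => by
      rw [(hd u).fderiv]; simp [pderiv]
    have ibp := integral_mul_fderiv_eq_neg_fderiv_mul_of_integrable (μ := (volume : Measure Plane))
      (f := pderivs l φ) (g := fun u => g (x - h • u)) (v := EuclideanSpace.single i (1 : ℝ))
      (Continuous.integrable_of_hasCompactSupport
        (f := fun u => pderivs (i :: l) φ u * g (x - h • u)) (by fun_prop) hcl'.mul_right)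
      (by
        simp only [hv]
        exact Continuous.integrable_of_hasCompactSupport (by fun_prop) hcl.mul_right)
      (Continuous.integrable_of_hasCompactSupport (by fun_prop) hcl.mul_right)
      (fun u _ => hφ1.differentiable (by norm_num) u) (fun u _ => (hd u).differentiableAt)
    simp only [hv] at ibp
    have h3 : ∫ u, pderivs (i :: l) φ u * g (x - h • u)
        = h * ∫ u, pderivs l φ u * pderiv i g (x - h • u) := by
      rw [← integral_const_mul]
      refine (neg_inj.mp (ibp.symm.trans ?_))
      rw [← integral_neg]
      congr 1; funext u; ring
    rw [h3, ih (hφ.of_le (by simp)) hgi, pderivs_pderiv l i hg', List.length_cons, pow_succ]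
    simp only [pderivs]
    ring

section Bias

variable {f K : Plane → ℝ} {h : ℝ}

lemma IsKernel.hasCompactSupport (hK : IsKernel K) : HasCompactSupport K := by
  rw [HasCompactSupport, hK.support_eq]
  exact isCompact_closedBall _ _

/-- The prefactor h^(−(2+|l|)) is used up exactly: h² by the substitution y = x − hu and one h for
each derivative moved from K to f. -/
lemma kdeMean_eq (hf : SmoothDensity f) (hK : IsKernel K) (hh : 0 < h) (l : List (Fin 2))
    (hl : l.length ≤ 3) (x : Plane) :
    kdeMean f K h l x = ∫ u, K u * pderivs l f (x - h • u) := by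
  have h1 := integral_pderivs_mul l hK.hasCompactSupport (hK.contDiff.of_le (by exact_mod_cast hl))
    (hf.contDiff.of_le (by exact_mod_cast (by omega : l.length ≤ 4))) x h
  have h2 : ∫ y, pderivs l K (h⁻¹ • (x - y)) * f y
      = h ^ 2 * ∫ u, pderivs l K u * f (x - h • u) := by
    have h3 := Measure.integral_comp_inv_smul (volume : Measure Plane)
      (fun u => pderivs l K u * f (x - h • u)) h
    rw [finrank_euclideanSpace_fin, abs_of_pos (by positivity), smul_eq_mul] at h3
    rw [← h3, ← integral_sub_left_eq_self _ volume x]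
    congr 1; funext y
    rw [smul_inv_smul₀ hh.ne']
    rw [sub_sub_cancel]
  rw [kdeMean, hf.integral_law]
  simp only [kernelAt, mul_assoc]
  rw [integral_const_mul, h2, h1, pow_add]
  field_simp

lemma IsKernel.integrable_mul (hK : IsKernel K) {g : Plane → ℝ} (hg : Continuous g) :
    Integrable fun u => K u * g u := by
  have := hK.contDiff.continuous
  exact Continuous.integrable_of_hasCompactSupport (by fun_prop) hK.hasCompactSupport.mul_right

lemma IsKernel.abs_integral_mul_le (hK : IsKernel K) {g : Plane → ℝ} (hg : Continuous g) {c : ℝ}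
    (hc : ∀ u, ‖u‖ ≤ 1 → |g u| ≤ c) : |∫ u, K u * g u| ≤ c := by
  have h1 : ∀ u, |K u * g u| ≤ c * K u := fun u => by
    rcases le_or_gt ‖u‖ 1 with hu | hu
    · rw [abs_mul, abs_of_nonneg (hK.nonneg u), mul_comm]
      exact mul_le_mul_of_nonneg_right (hc u hu) (hK.nonneg u)
    · have : K u = 0 := hK.pderivs_eq_zero [] hu
      simp [this]
  calc |∫ u, K u * g u| ≤ ∫ u, |K u * g u| := abs_integral_le_integral_abs
    _ ≤ ∫ u, c * K u := integral_mono (hK.integrable_mul hg).abs (hK.integrable.const_mul c) h1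
    _ = c := by rw [integral_const_mul, hK.integral_eq_one, mul_one]

/-- Averaging over u and −u replaces first differences of g by second differences, which eliminates
the linear part of the bias. -/
lemma IsKernel.abs_smooth_sub_le_of_symm (hK : IsKernel K) {g : Plane → ℝ} (hg : Continuous g)
    {c : ℝ} (x : Plane) (hc : ∀ u, ‖u‖ ≤ 1 → |g (x - h • u) + g (x + h • u) - 2 * g x| ≤ 2 * c) :
    |(∫ u, K u * g (x - h • u)) - g x| ≤ c := by
  have h1 : ∫ u, K u * g (x + h • u) = ∫ u, K u * g (x - h • u) := by
    rw [← integral_neg_eq_self]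
    congr 1; funext u
    rw [hK.symm, smul_neg, sub_eq_add_neg]
  have h2 : 2 * ((∫ u, K u * g (x - h • u)) - g x)
      = ∫ u, K u * (g (x - h • u) + g (x + h • u) - 2 * g x) := by
    have i1 : Integrable fun u => K u * g (x - h • u) := hK.integrable_mul (by fun_prop)
    have i2 : Integrable fun u => K u * g (x + h • u) := hK.integrable_mul (by fun_prop)
    simp only [mul_sub, mul_add]
    rw [integral_sub (f := fun u => K u * g (x - h • u) + K u * g (x + h • u)) (i1.add i2)
      (hK.integrable.mul_const _), integral_add i1 i2, h1, integral_mul_const, hK.integral_eq_one]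
    ring
  have h3 := hK.abs_integral_mul_le (by fun_prop) hc
  rw [← h2, abs_mul, abs_two] at h3
  linarith

end Bias

/-- The function t ↦ g(x − tv) + g(x + tv) has derivative at most 2Ct‖v‖² in modulus, so a Lipschitz
gradient suffices and no second derivative is needed. -/
lemma abs_symm_diff_le {g : Plane → ℝ} {C : ℝ} (hg : Differentiable ℝ g)
    (hC : ∀ x y, ‖fderiv ℝ g x - fderiv ℝ g y‖ ≤ C * ‖x - y‖) (x v : Plane) :
    |g (x - v) + g (x + v) - 2 * g x| ≤ 2 * C * ‖v‖ ^ 2 := by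
  have hd : ∀ t : ℝ, HasDerivAt (fun t : ℝ => g (x - t • v) + g (x + t • v))
      (-(fderiv ℝ g (x - t • v) v) + fderiv ℝ g (x + t • v) v) t := fun t => by
    have h1 : HasDerivAt (fun t : ℝ => t • v) v t := by
      simpa using (hasDerivAt_id t).smul_const v
    have h2 := (hg (x - t • v)).hasFDerivAt.comp_hasDerivAt t (h1.const_sub x)
    have h3 := (hg (x + t • v)).hasFDerivAt.comp_hasDerivAt t (h1.const_add x)
    rw [map_neg] at h2
    exact h2.add h3
  have hC0 : 0 ≤ C * ‖v‖ := by
    have := (norm_nonneg _).trans (hC v 0)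
    simpa using this
  have hb : ∀ t ∈ Set.Ico (0 : ℝ) 1,
      ‖-(fderiv ℝ g (x - t • v) v) + fderiv ℝ g (x + t • v) v‖ ≤ 2 * C * ‖v‖ ^ 2 := by
    intro t ht
    rw [neg_add_eq_sub, ← sub_apply]
    refine (ContinuousLinearMap.le_opNorm _ _).trans ?_
    have h1 := hC (x + t • v) (x - t • v)
    have h2 : x + t • v - (x - t • v) = (2 * t) • v := by rw [mul_smul, two_smul]; abel
    rw [h2, norm_smul, Real.norm_eq_abs, abs_of_nonneg (by linarith [ht.1])] at h1
    have h3 : C * (2 * t * ‖v‖) ≤ 2 * (C * ‖v‖) := by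
      have := mul_le_mul_of_nonneg_left ht.2.le hC0
      linarith
    calc _ ≤ (2 * (C * ‖v‖)) * ‖v‖ := by gcongr; exact h1.trans h3
      _ = _ := by ring
  have := norm_image_sub_le_of_norm_deriv_le_segment_01' (fun t _ => (hd t).hasDerivWithinAt) hb
  simp only [one_smul, zero_smul, sub_zero, add_zero] at this
  rw [Real.norm_eq_abs] at this
  convert this using 2
  ring

/-- The bias of the derivatives of the kernel estimator, and a cruder bound for the third
derivatives. -/
theorem exists_bias {f K : Plane → ℝ} (hf : SmoothDensity f) (hK : IsKernel K) :
    ∃ C : ℝ, 0 < C ∧ ∀ h, 0 < h → ∀ l : List (Fin 2), 1 ≤ l.length → ∀ x,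
      (l.length ≤ 2 → |kdeMean f K h l x - pderivs l f x| ≤ C * h ^ 2) ∧
      (l.length ≤ 3 → |kdeMean f K h l x - pderivs l f x| ≤ C * h) := by
  obtain ⟨C, hC0, hC⟩ := hf.exists_bound
  refine ⟨2 * C, by positivity, fun h hh l hl1 x => ⟨fun hl => ?_, fun hl => ?_⟩⟩
  · rw [kdeMean_eq hf hK hh l (by omega)]
    have hs : ContDiff ℝ (1 : ℕ) (pderivs l f) := contDiff_pderivs l
      (hf.contDiff.of_le (by exact_mod_cast (by omega : 1 + l.length ≤ 4)))
    refine hK.abs_smooth_sub_le_of_symm hs.continuous x fun u hu => ?_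
    -- For orders one and two, derivatives of f up to order four make the gradient of the
    -- differentiated density Lipschitz, with constant 2C from its two components.
    have h1 := abs_symm_diff_le (C := 2 * C) (hs.differentiable (by norm_num)) (fun x y => by
      have : ∀ i, ‖(fderiv ℝ (pderivs l f) x - fderiv ℝ (pderivs l f) y)
          (EuclideanSpace.single i 1)‖ ≤ C * ‖x - y‖ := fun i =>
        abs_pderivs_sub_le (i :: l) (fun k hk => hf.differentiable_iteratedFDeriv
          (by simp at hk; omega)) (fun z => hC _ (by simp) (by simp; omega) z) x y
      refine (norm_clm_plane_le _ this).trans (le_of_eq (by ring))) x (h • u)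
    refine h1.trans ?_
    have h2 : ‖h • u‖ ≤ h := by
      rw [norm_smul, Real.norm_eq_abs, abs_of_pos hh]
      nlinarith [norm_nonneg u]
    rw [mul_assoc 2 (2 * C)]
    gcongr
  · rw [kdeMean_eq hf hK hh l hl]
    have hs : ContDiff ℝ (1 : ℕ) (pderivs l f) := contDiff_pderivs l
      (hf.contDiff.of_le (by exact_mod_cast (by omega : 1 + l.length ≤ 4)))
    -- Third derivatives are merely Lipschitz, so symmetry cannot help and the bias is of order h.
    have hlip : ∀ v : Plane, ‖v‖ ≤ h → |pderivs l f (x + v) - pderivs l f x| ≤ C * h := by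
      intro v hv
      have := abs_pderivs_sub_le l (fun k hk => hf.differentiable_iteratedFDeriv (by omega))
        (fun z => hC _ (by simp) (by omega) z) (x + v) x
      rw [add_sub_cancel_left] at this
      exact this.trans (by gcongr)
    refine hK.abs_smooth_sub_le_of_symm hs.continuous x fun u hu => ?_
    have h2 : ‖h • u‖ ≤ h := by
      rw [norm_smul, Real.norm_eq_abs, abs_of_pos hh]
      nlinarith [norm_nonneg u]
    have h3 := hlip (h • u) h2
    have h4 := hlip (-(h • u)) (by rwa [norm_neg])
    rw [← sub_eq_add_neg] at h4
    rw [abs_le] at *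
    constructor <;> nlinarith [h3.1, h3.2, h4.1, h4.2]

/-! ### Expectations of the kernel estimator -/

section Means

variable {Ω : Type*} {f K : Plane → ℝ} {h : ℕ → ℝ} {X : ℕ → Ω → Plane}

lemma IsKernel.continuous_pderivs (hK : IsKernel K) {l : List (Fin 2)} (hl : l.length ≤ 3) :
    Continuous (pderivs l K) :=
  (hK.contDiff_pderivs l (k := 0) (by omega)).continuous

lemma IsKernel.continuous_kernelAt (hK : IsKernel K) {l : List (Fin 2)} (hl : l.length ≤ 3)
    (η : ℝ) : Continuous fun p : Plane × Plane => kernelAt K η l p.1 p.2 := by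
  have := hK.continuous_pderivs hl
  unfold kernelAt
  fun_prop

lemma Bump.abs_kernelAt_le {l : List (Fin 2)} {C : ℝ} (hκ : Bump (pderivs l K) C) {η : ℝ}
    (hη : 0 < η) (x y : Plane) : |kernelAt K η l x y| ≤ (η ^ (2 + l.length))⁻¹ * C := by
  rw [kernelAt, abs_mul, abs_of_pos (show 0 < (η ^ (2 + l.length))⁻¹ by positivity)]
  gcongr
  exact hκ.abs_le _

lemma Bump.kernelAt_eq_zero {l : List (Fin 2)} {C : ℝ} (hκ : Bump (pderivs l K) C) {η : ℝ}
    (hη : 0 < η) {x y : Plane} (hxy : η < ‖x - y‖) : kernelAt K η l x y = 0 := by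
  rw [kernelAt, hκ.kernel_eq_zero hη hxy, mul_zero]

lemma Bump.abs_kernelAt_sub_le {l : List (Fin 2)} {C : ℝ} (hκ : Bump (pderivs l K) C) {η : ℝ}
    (hη : 0 < η) (x x' y : Plane) :
    |kernelAt K η l x y - kernelAt K η l x' y| ≤ (η ^ (2 + l.length))⁻¹ * (C * (η⁻¹ * ‖x - x'‖)) := by
  rw [kernelAt, kernelAt, ← mul_sub, abs_mul,
    abs_of_pos (show 0 < (η ^ (2 + l.length))⁻¹ by positivity)]
  gcongr
  exact hκ.abs_kernel_sub_le hη _ _ _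

lemma Bump.continuous_kdeMean [IsFiniteMeasure (law f)] {l : List (Fin 2)} {C : ℝ}
    (hκ : Bump (pderivs l K) C) {η : ℝ} (hη : 0 < η) : Continuous (kdeMean f K η l) := by
  have := hκ.continuous
  refine continuous_of_dominated (bound := fun _ => (η ^ (2 + l.length))⁻¹ * C) (fun x => ?_)
    (fun x => ae_of_all _ fun y => hκ.abs_kernelAt_le hη x y) (integrable_const _)
    (ae_of_all _ fun y => ?_)
  · refine Continuous.aestronglyMeasurable ?_
    unfold kernelAt
    fun_prop
  · unfold kernelAt
    fun_prop

variable [MeasurableSpace Ω] {P : Measure Ω} [IsProbabilityMeasure P]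

lemma integral_pderivs_fHat (hf : SmoothDensity f) (hK : IsKernel K) (hh : ∀ n, 0 < h n)
    (hX : IsSample P f X) {l : List (Fin 2)} (hl1 : 1 ≤ l.length) (hl : l.length ≤ 3) {n : ℕ}
    (hn : n ≠ 0) (x : Plane) :
    Integrable (fun ω => pderivs l (fHat K h X n ω) x) P ∧
      ∫ ω, pderivs l (fHat K h X n ω) x ∂P = kdeMean f K (h n) l x := by
  obtain ⟨C, hC⟩ := hK.exists_bump
  have hκ := hC l hl1 hl
  have := hf.isProbabilityMeasure_law
  have hmeas : Measurable (kernelAt K (h n) l x) :=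
    ((hK.continuous_kernelAt hl (h n)).comp (Continuous.prodMk_right x)).measurable
  have hint : ∀ i, Integrable (fun ω => kernelAt K (h n) l x (X i ω)) P := fun i =>
    integrable_of_abs_le (hmeas.comp (hX.measurable i)) fun ω => hκ.abs_kernelAt_le (hh n) x _
  have hval : ∀ i, ∫ ω, kernelAt K (h n) l x (X i ω) ∂P = kdeMean f K (h n) l x := fun i => by
    rw [kdeMean, law, ← hX.law i,
      integral_map (hX.measurable i).aemeasurable hmeas.aestronglyMeasurable]
  simp only [hK.pderivs_fHat l hl]
  refine ⟨(integrable_finsetSum _ fun i _ => hint i).const_mul _, ?_⟩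
  rw [integral_const_mul, integral_finsetSum _ fun i _ => hint i]
  simp only [hval, Finset.sum_const, Finset.card_range, nsmul_eq_mul]
  field_simp

lemma meanD2_apply (hf : SmoothDensity f) (hK : IsKernel K) (hh : ∀ n, 0 < h n)
    (hX : IsSample P f X) {n : ℕ} (hn : n ≠ 0) (x : Plane) (j : Fin 3) :
    meanD2 P K h X n x j = kdeMean f K (h n) (d2Index j) x := by
  have key := fun j => integral_pderivs_fHat (l := d2Index j) hf hK hh hX
    (by rw [length_d2Index]; norm_num) (by rw [length_d2Index]; norm_num) hn x
  rw [meanD2, eval_integral_piLp fun j => by simpa only [d2_apply] using (key j).1]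
  simpa only [d2_apply] using (key j).2

lemma meanGrad_apply (hf : SmoothDensity f) (hK : IsKernel K) (hh : ∀ n, 0 < h n)
    (hX : IsSample P f X) {n : ℕ} (hn : n ≠ 0) (x : Plane) (i : Fin 2) :
    meanGrad P K h X n x i = kdeMean f K (h n) [i] x := by
  have key := fun i => integral_pderivs_fHat (l := [i]) hf hK hh hX (by simp) (by simp) hn x
  rw [meanGrad, eval_integral_piLp fun i => by simpa only [gradient_apply] using (key i).1]
  simpa only [gradient_apply] using (key i).2

end Means

/-! ### Integrals of the estimation error along the integral curves -/

/-- The weighted integral of the rescaled kernel derivative along an integral curve. -/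
def pathKernel (f K w : Plane → ℝ) (η : ℝ) (l : List (Fin 2)) (z : Plane) (u : ℝ) (y : Plane) :
    ℝ :=
  ∫ r in 0..u, w (path f z r) * kernelAt K η l (path f z r) y

/-- The average of V over [s, t] is the chord divided by t − s, so nondegenerate averages mean that
the curves neither close up nor return close to themselves. -/
lemma exists_speed {f : Plane → ℝ} {H L : Set Plane} {a C : ℝ} (hs : Setup f H L a C) :
    ∃ γ : ℝ, 0 < γ ∧ ∀ z ∈ L, ∀ s t : ℝ, |s| ≤ a → |t| ≤ a →
      γ * |t - s| ≤ ‖path f z t - path f z s‖ := by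
  obtain ⟨γ, hγ, h⟩ := hs.average
  have key : ∀ z ∈ L, ∀ s t : ℝ, |s| ≤ a → |t| ≤ a → s < t →
      γ * |t - s| ≤ ‖path f z t - path f z s‖ := by
    intro z hz s t hsa hta hst
    have h1 := h z hz s t (abs_le.mp hsa).1 hst (abs_le.mp hta).2
    have h2 : ∫ r in s..t, eigvec f (path f z r) = path f z t - path f z s :=
      intervalIntegral.integral_eq_sub_of_hasDerivAt (fun r _ => hs.tame.hasDerivAt_path z r)
        ((hs.tame.continuous_eigvec.comp (hs.tame.continuous_path z)).intervalIntegrable _ _)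
    have h0 : 0 < t - s := sub_pos.mpr hst
    rw [h2, norm_smul, norm_inv, Real.norm_eq_abs, abs_of_pos h0, ← div_eq_inv_mul,
      le_div_iff₀ h0] at h1
    rwa [abs_of_pos h0]
  refine ⟨γ, hγ, fun z hz s t hsa hta => ?_⟩
  rcases lt_trichotomy s t with hst | rfl | hst
  · exact key z hz s t hsa hta hst
  · simp
  · rw [abs_sub_comm, norm_sub_rev]; exact key z hz t s hta hsa hst

instance isFiniteMeasure_restrict_uIoc (s t : ℝ) :
    IsFiniteMeasure ((volume : Measure ℝ).restrict (Set.uIoc s t)) :=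
  ⟨by rw [Measure.restrict_apply_univ, Real.volume_uIoc]; exact ENNReal.ofReal_lt_top⟩

section PathKernel

variable {f K w : Plane → ℝ} {l : List (Fin 2)} {C₀ W η : ℝ} {z : Plane}

lemma abs_integrand_le (hκ : Bump (pderivs l K) C₀) (hη : 0 < η) (hw : ∀ x, |w x| ≤ W)
    (x y : Plane) : |w x * kernelAt K η l x y| ≤ W * ((η ^ (2 + l.length))⁻¹ * C₀) := by
  rw [abs_mul]
  exact mul_le_mul (hw x) (hκ.abs_kernelAt_le hη x y) (abs_nonneg _) ((abs_nonneg _).trans (hw x))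

lemma measurable_integrand (hf : Tame f) (hκ : Bump (pderivs l K) C₀) (hwm : Measurable w) :
    Measurable (Function.uncurry fun (r : ℝ) (y : Plane) =>
      w (path f z r) * kernelAt K η l (path f z r) y) := by
  have h1 := hf.continuous_path z
  have h2 := hκ.continuous
  refine (hwm.comp (h1.measurable.comp measurable_fst)).mul (Continuous.measurable ?_)
  unfold kernelAt
  fun_prop

lemma intervalIntegrable_integrand (hf : Tame f) (hκ : Bump (pderivs l K) C₀) (hη : 0 < η)
    (hwm : Measurable w) (hw : ∀ x, |w x| ≤ W) (y : Plane) (s t : ℝ) :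
    IntervalIntegrable (fun r => w (path f z r) * kernelAt K η l (path f z r) y) volume s t := by
  have h := (measurable_integrand (η := η) (z := z) hf hκ hwm).comp
    (measurable_id.prodMk (measurable_const (a := y)))
  rw [intervalIntegrable_iff]
  exact integrable_of_abs_le h fun r => abs_integrand_le hκ hη hw _ y

lemma integrable_integrand (hf : Tame f) (hκ : Bump (pderivs l K) C₀) (hη : 0 < η)
    (hwm : Measurable w) (hw : ∀ x, |w x| ≤ W) (μ : Measure Plane) [IsFiniteMeasure μ] (u : ℝ) :
    Integrable (Function.uncurry fun (r : ℝ) (y : Plane) =>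
      w (path f z r) * kernelAt K η l (path f z r) y)
      ((volume.restrict (Set.uIoc 0 u)).prod μ) := by
  exact integrable_of_abs_le (measurable_integrand hf hκ hwm) fun p => abs_integrand_le hκ hη hw _ _

lemma measurable_pathKernel (hf : Tame f) (hκ : Bump (pderivs l K) C₀) (hwm : Measurable w)
    (u : ℝ) : Measurable (pathKernel f K w η l z u) := by
  have h := (measurable_integrand (η := η) (z := z) hf hκ hwm).stronglyMeasurable.integral_prod_left'
    (μ := volume.restrict (Set.uIoc 0 u))
  unfold pathKernel
  simp only [intervalIntegral.intervalIntegral_eq_integral_uIoc]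
  exact h.measurable.const_mul (if 0 ≤ u then (1 : ℝ) else -1)

/-- The integral curve spends little time in a small ball. -/
lemma abs_pathKernel_le (hκ : Bump (pderivs l K) C₀) (hη : 0 < η) (hW : 0 ≤ W)
    (hw : ∀ x, |w x| ≤ W) {a γ : ℝ} (hγ : 0 < γ)
    (hsp : ∀ s t : ℝ, |s| ≤ a → |t| ≤ a → γ * |t - s| ≤ ‖path f z t - path f z s‖) {u : ℝ}
    (hu : |u| ≤ a) (y : Plane) :
    |pathKernel f K w η l z u y| ≤ W * ((η ^ (2 + l.length))⁻¹ * C₀) * (4 * η / γ) := by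
  have hC := hκ.one_le
  unfold pathKernel
  rw [← Real.norm_eq_abs, intervalIntegral.norm_integral_eq_norm_integral_uIoc]
  have hz : ∀ r, η < ‖path f z r - y‖ → w (path f z r) * kernelAt K η l (path f z r) y = 0 :=
    fun r hr => by rw [hκ.kernelAt_eq_zero hη hr, mul_zero]
  by_cases hex : ∃ r₀, |r₀| ≤ a ∧ ‖path f z r₀ - y‖ ≤ η
  · obtain ⟨r₀, hr₀, hr₀y⟩ := hex
    -- If the curve is within η of y at time r₀, then at distance more than 2η/γ in time it is
    -- farther than η from y. The integrand lives on an interval of length 4η/γ.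
    set I := Set.Icc (r₀ - 2 * η / γ) (r₀ + 2 * η / γ) with hI
    have h1 : ∫ r in Set.uIoc 0 u, w (path f z r) * kernelAt K η l (path f z r) y
        = ∫ r in Set.uIoc 0 u ∩ I, w (path f z r) * kernelAt K η l (path f z r) y := by
      refine setIntegral_eq_of_subset_of_forall_sdiff_eq_zero measurableSet_uIoc
        Set.inter_subset_left fun r hr => hz r ?_
      by_contra hle
      refine hr.2 ⟨hr.1, ?_⟩
      have h2 := hsp r₀ r hr₀ (Setup.abs_le_of_mem_uIoc hu hr.1)
      have h3 := norm_sub_le_norm_sub_add_norm_sub (path f z r) y (path f z r₀)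
      rw [norm_sub_rev y] at h3
      have h4 : |r - r₀| ≤ 2 * η / γ := by
        rw [le_div_iff₀ hγ]; linarith [not_lt.mp hle]
      rw [abs_le] at h4
      constructor <;> linarith [h4.1, h4.2]
    rw [h1]
    have hvol : volume.real (Set.uIoc 0 u ∩ I) ≤ 4 * η / γ := by
      refine (measureReal_mono Set.inter_subset_right
        (by rw [hI, Real.volume_Icc]; exact ENNReal.ofReal_ne_top)).trans ?_
      rw [hI, Real.volume_real_Icc_of_le (by
        have : 0 < 2 * η / γ := by positivity
        linarith)]
      exact le_of_eq (by ring)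
    refine (norm_setIntegral_le_of_norm_le_const (C := W * ((η ^ (2 + l.length))⁻¹ * C₀)) ?_
      fun r _ => abs_integrand_le hκ hη hw _ y).trans ?_
    · refine (measure_mono Set.inter_subset_right).trans_lt ?_
      rw [hI, Real.volume_Icc]; exact ENNReal.ofReal_lt_top
    · gcongr
  · push Not at hex
    rw [setIntegral_eq_zero_of_forall_eq_zero fun r hr =>
      hz r (hex r (Setup.abs_le_of_mem_uIoc hu hr)), norm_zero]
    positivity

/-- The second moment is at most the supremum times the first absolute moment, and Fubini reduces
the latter to probabilities of balls. For second derivatives this is h⁻³ · (h⁻⁴ · h²) = h⁻⁵, a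
factor h better than the pointwise variance. -/
lemma integral_pathKernel_sq_le [IsFiniteMeasure (law f)] (hf : Tame f)
    (hκ : Bump (pderivs l K) C₀) (hη : 0 < η) (hwm : Measurable w) (hW : 0 ≤ W)
    (hw : ∀ x, |w x| ≤ W) {a F b : ℝ} {u : ℝ} (hu : |u| ≤ a)
    (hF : ∀ r, |r| ≤ a → (law f).real (Metric.closedBall (path f z r) η) ≤ F)
    (hb : ∀ y, |pathKernel f K w η l z u y| ≤ b) :
    ∫ y, pathKernel f K w η l z u y ^ 2 ∂law f
      ≤ b * (W * ((η ^ (2 + l.length))⁻¹ * C₀) * F * a) := by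
  have hC := hκ.one_le
  have hb0 : 0 ≤ b := (abs_nonneg _).trans (hb 0)
  have hm := measurable_pathKernel (η := η) (z := z) hf hκ hwm u
  have hi : Integrable (pathKernel f K w η l z u) (law f) := integrable_of_abs_le hm hb
  have hi2 : Integrable (fun y => pathKernel f K w η l z u y ^ 2) (law f) := by
    refine integrable_of_abs_le (b := b ^ 2) (hm.pow_const 2) fun y => ?_
    rw [abs_pow]
    gcongr
    exact hb y
  set Φ : ℝ → Plane → ℝ := fun r y => w (path f z r) * kernelAt K η l (path f z r) y with hΦ
  have hΦi := integrable_integrand (z := z) hf hκ hη hwm hw (law f) u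
  have hΦn : Integrable (Function.uncurry fun y r => |Φ r y|)
      ((law f).prod (volume.restrict (Set.uIoc 0 u))) := hΦi.abs.swap
  calc ∫ y, pathKernel f K w η l z u y ^ 2 ∂law f
      ≤ ∫ y, b * |pathKernel f K w η l z u y| ∂law f := by
        refine integral_mono hi2 (hi.abs.const_mul b) fun y => ?_
        simp only
        rw [← sq_abs, sq]
        gcongr
        exact hb y
    _ = b * ∫ y, |pathKernel f K w η l z u y| ∂law f := integral_const_mul _ _
    _ ≤ b * ∫ y, (∫ r in Set.uIoc 0 u, |Φ r y|) ∂law f := by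
        refine mul_le_mul_of_nonneg_left ?_ hb0
        refine integral_mono (f := fun y => |pathKernel f K w η l z u y|)
          (g := fun y => ∫ r in Set.uIoc 0 u, |Φ r y|) hi.abs hΦn.integral_prod_left fun y => ?_
        exact intervalIntegral.norm_integral_le_integral_norm_uIoc (f := fun r => Φ r y)
          (a := 0) (b := u) (μ := volume)
    _ = b * ∫ r in Set.uIoc 0 u, (∫ y, |Φ r y| ∂law f) := by
        rw [integral_integral_swap hΦn]
    _ ≤ b * (W * ((η ^ (2 + l.length))⁻¹ * C₀) * F * a) := by
        gcongr
        have h1 : ∀ r ∈ Set.uIoc 0 u,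
            ‖∫ y, |Φ r y| ∂law f‖ ≤ W * ((η ^ (2 + l.length))⁻¹ * C₀) * F := fun r hr => by
          rw [Real.norm_eq_abs, abs_of_nonneg (integral_nonneg fun _ => abs_nonneg _)]
          refine (integral_le_of_ball (h := η) (x := path f z r)
            (B := W * ((η ^ (2 + l.length))⁻¹ * C₀)) (fun y => ?_) fun y hy => ?_).trans ?_
          · rw [abs_abs]; exact abs_integrand_le hκ hη hw _ y
          · rw [hΦ]
            simp only [hκ.kernelAt_eq_zero hη hy, mul_zero, abs_zero]
          · gcongr
            exact hF r (Setup.abs_le_of_mem_uIoc hu hr)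
        have h0 : |(0 : ℝ)| ≤ a := by rw [abs_zero]; exact (abs_nonneg _).trans hu
        have hF0 : 0 ≤ F := measureReal_nonneg.trans (hF 0 h0)
        have h2 := norm_setIntegral_le_of_norm_le_const (μ := volume) (s := Set.uIoc 0 u)
          (by rw [Real.volume_uIoc]; exact ENNReal.ofReal_lt_top) h1
        have h3 : volume.real (Set.uIoc 0 u) = |u| := by
          rw [measureReal_def, Real.volume_uIoc, sub_zero, ENNReal.toReal_ofReal (abs_nonneg _)]
        rw [h3] at h2
        refine (le_abs_self _).trans (h2.trans ?_)
        gcongr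

/-- The change of the end time and the change of the starting point are separated. Only the net
argument uses the bound, so the crude power of η is harmless. -/
lemma abs_pathKernel_sub_le (hf : Tame f) (hκ : Bump (pderivs l K) C₀) (hη : 0 < η) (hη1 : η ≤ 1)
    (hwm : Measurable w) (hW : 0 ≤ W) (hw : ∀ x, |w x| ≤ W) {H : Set Plane}
    (hwl : ∀ x ∈ H, ∀ x' ∈ H, |w x - w x'| ≤ W * ‖x - x'‖) {a M : ℝ} {z' : Plane}
    (hz : ∀ r, |r| ≤ a → path f z r ∈ H) (hz' : ∀ r, |r| ≤ a → path f z' r ∈ H)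
    (hM : ∀ r, |r| ≤ a → ‖path f z r - path f z' r‖ ≤ M * ‖z - z'‖) {u u' : ℝ}
    (hu' : |u'| ≤ a) (y : Plane) :
    |pathKernel f K w η l z u y - pathKernel f K w η l z' u' y|
      ≤ W * ((η ^ (2 + l.length))⁻¹ * C₀) * |u - u'|
        + 2 * W * ((η ^ (2 + l.length))⁻¹ * C₀) * η⁻¹ * (M * ‖z - z'‖) * a := by
  have hC := hκ.one_le
  have i1 := intervalIntegrable_integrand (z := z) hf hκ hη hwm hw y
  have i2 := intervalIntegrable_integrand (z := z') hf hκ hη hwm hw y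
  have e1 : pathKernel f K w η l z u y - pathKernel f K w η l z' u' y
      = (∫ r in u'..u, w (path f z r) * kernelAt K η l (path f z r) y)
        + ∫ r in 0..u', (w (path f z r) * kernelAt K η l (path f z r) y
          - w (path f z' r) * kernelAt K η l (path f z' r) y) := by
    rw [intervalIntegral.integral_sub (i1 _ _) (i2 _ _), pathKernel, pathKernel,
      ← intervalIntegral.integral_add_adjacent_intervals (i1 0 u') (i1 u' u)]
    ring
  rw [e1]
  refine (abs_add_le _ _).trans (add_le_add ?_ ?_)
  · rw [← Real.norm_eq_abs]
    refine intervalIntegral.norm_integral_le_of_norm_le_const fun r _ => ?_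
    exact abs_integrand_le hκ hη hw _ y
  · rw [← Real.norm_eq_abs]
    refine (intervalIntegral.norm_integral_le_of_norm_le_const
      (C := 2 * W * ((η ^ (2 + l.length))⁻¹ * C₀) * η⁻¹ * (M * ‖z - z'‖)) fun r hr => ?_).trans ?_
    · have hr' := Setup.abs_le_of_mem_uIoc hu' hr
      set x := path f z r
      set x' := path f z' r
      have e2 : w x * kernelAt K η l x y - w x' * kernelAt K η l x' y
          = (w x - w x') * kernelAt K η l x y + w x' * (kernelAt K η l x y - kernelAt K η l x' y) := by
        ring
      have hη' : 1 ≤ η⁻¹ := (one_le_inv₀ hη).mpr hη1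
      have hxx := hM r hr'
      rw [Real.norm_eq_abs, e2]
      calc _ ≤ |w x - w x'| * |kernelAt K η l x y|
            + |w x'| * |kernelAt K η l x y - kernelAt K η l x' y| := by
              rw [← abs_mul, ← abs_mul]; exact abs_add_le _ _
        _ ≤ W * ‖x - x'‖ * ((η ^ (2 + l.length))⁻¹ * C₀)
            + W * ((η ^ (2 + l.length))⁻¹ * (C₀ * (η⁻¹ * ‖x - x'‖))) := by
            gcongr
            · exact hwl x (hz r hr') x' (hz' r hr')
            · exact hκ.abs_kernelAt_le hη _ _
            · exact hw x'
            · exact hκ.abs_kernelAt_sub_le hη _ _ _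
        _ ≤ W * ‖x - x'‖ * ((η ^ (2 + l.length))⁻¹ * C₀) * η⁻¹
            + W * ((η ^ (2 + l.length))⁻¹ * (C₀ * (η⁻¹ * ‖x - x'‖))) := by
            refine add_le_add_left (le_mul_of_one_le_right (by positivity) hη') _
        _ = 2 * W * ((η ^ (2 + l.length))⁻¹ * C₀) * η⁻¹ * ‖x - x'‖ := by ring
        _ ≤ _ := by gcongr
    · have hM0 : 0 ≤ M * ‖z - z'‖ :=
        (norm_nonneg _).trans (hM 0 (by rw [abs_zero]; exact (abs_nonneg _).trans hu'))
      rw [sub_zero]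
      gcongr

/-- By Fubini the integrated fluctuation along a fixed curve is the deviation of one empirical mean,
with the path integral of the kernel as summand. -/
lemma empDev_pathKernel [IsFiniteMeasure (law f)] {Ω : Type*} {h : ℕ → ℝ} {X : ℕ → Ω → Plane}
    (hf : Tame f) (hK : IsKernel K) (hl : l.length ≤ 3) (hκ : Bump (pderivs l K) C₀) {n : ℕ}
    (hη : 0 < h n) (hwm : Measurable w) (hw : ∀ x, |w x| ≤ W) (u : ℝ) (ω : Ω) :
    empDev (law f) X (pathKernel f K w (h n) l z u) n ω
      = ∫ r in 0..u, w (path f z r) * (pderivs l (fHat K h X n ω) (path f z r)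
          - kdeMean f K (h n) l (path f z r)) := by
  have i1 := fun y => intervalIntegrable_integrand (z := z) hf hκ hη hwm hw y 0 u
  have i3 := integrable_integrand (z := z) hf hκ hη hwm hw (law f) u
  have e1 : ∫ y, pathKernel f K w (h n) l z u y ∂law f
      = ∫ r in 0..u, w (path f z r) * kdeMean f K (h n) l (path f z r) := by
    unfold pathKernel kdeMean
    rw [← intervalIntegral_integral_swap i3]
    simp only [integral_const_mul]
  have e2 : (n : ℝ)⁻¹ * ∑ i ∈ Finset.range n, pathKernel f K w (h n) l z u (X i ω)
      = ∫ r in 0..u, w (path f z r) * pderivs l (fHat K h X n ω) (path f z r) := by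
    unfold pathKernel
    rw [← intervalIntegral.integral_finsetSum fun i _ => i1 (X i ω),
      ← intervalIntegral.integral_const_mul]
    congr 1; funext r
    rw [hK.pderivs_fHat l hl, ← Finset.mul_sum]
    ring
  have i4 : IntervalIntegrable (fun r => w (path f z r) * pderivs l (fHat K h X n ω) (path f z r))
      volume 0 u := by
    have : (fun r => w (path f z r) * pderivs l (fHat K h X n ω) (path f z r))
        = fun r => (n : ℝ)⁻¹ * ∑ i ∈ Finset.range n,
          w (path f z r) * kernelAt K (h n) l (path f z r) (X i ω) := by
      funext r
      rw [hK.pderivs_fHat l hl, ← Finset.mul_sum]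
      ring
    rw [this]
    have h6 := (IntervalIntegrable.sum (Finset.range n) fun i _ => i1 (X i ω)).const_mul (n : ℝ)⁻¹
    simpa only [Finset.sum_apply] using h6
  have i5 : IntervalIntegrable (fun r => w (path f z r) * kdeMean f K (h n) l (path f z r))
      volume 0 u := by
    rw [intervalIntegrable_iff]
    have := i3.integral_prod_left
    simp only [Function.uncurry, integral_const_mul] at this
    exact this
  rw [empDev, e1, e2, ← intervalIntegral.integral_sub i4 i5]
  simp only [mul_sub]

end PathKernel

/-! ### Uniform rate of the integrated fluctuations -/

section PathRate

variable {Ω : Type*} [MeasurableSpace Ω] {P : Measure Ω} [IsProbabilityMeasure P]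
  {f K : Plane → ℝ} {h : ℕ → ℝ} {X : ℕ → Ω → Plane} {H L : Set Plane} {a C : ℝ}

lemma Setup.exists_path_lipschitz (hs : Setup f H L a C) :
    ∃ M, 1 ≤ M ∧ ∀ z ∈ L, ∀ z', ∀ r, |r| ≤ a → ‖path f z r - path f z' r‖ ≤ M * ‖z - z'‖ := by
  obtain ⟨R, -, hR⟩ := exists_confining hs.bounds hs.filament.isCompact.isBounded
    hs.filament.pos.le
  obtain ⟨M, hM, h⟩ := exists_path_stability hs.bounds hs.filament.pos.le hR
  refine ⟨M, hM, fun z hz z' r hr => ?_⟩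
  simpa using h f hs.tame 0 zero_le_one (by simp) z' z hz r hr

/-- Uniform rates of integrals of the second derivatives of the kernel estimator along integral
curves. -/
theorem tendsto_measure_pathIntegral (hs : Setup f H L a C) (hf : SmoothDensity f)
    (hK : IsKernel K) (hh : IsBandwidth h) (hX : IsSample P f X) {w : Plane → ℝ} {W : ℝ}
    (hW : 0 ≤ W) (hwm : Measurable w) (hw : ∀ x, |w x| ≤ W)
    (hwl : ∀ x ∈ H, ∀ x' ∈ H, |w x - w x'| ≤ W * ‖x - x'‖) {l : List (Fin 2)}
    (hl : l.length = 2) :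
    ∃ M : ℝ, 0 < M ∧ Tendsto (fun n : ℕ => P {ω | ∃ z ∈ L, ∃ u, |u| ≤ a ∧
      M * √(Real.log n / (n * h n ^ 5)) < |∫ r in 0..u, w (path f z r) *
        (pderivs l (fHat K h X n ω) (path f z r) - kdeMean f K (h n) l (path f z r))|})
      atTop (𝓝 0) := by
  have := hf.isProbabilityMeasure_law
  obtain ⟨C₀, hC₀⟩ := hK.exists_bump
  have hκ := hC₀ l (by omega) (by omega)
  have hC1 := hκ.one_le
  obtain ⟨γ, hγ, hsp⟩ := exists_speed hs
  obtain ⟨M, hM1, hM⟩ := hs.exists_path_lipschitz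
  obtain ⟨R, -, hR⟩ := exists_confining hs.bounds hs.filament.isCompact.isBounded
    hs.filament.pos.le
  obtain ⟨F, hF0, hF⟩ := hf.exists_ball_bound R
  have ha := hs.filament.pos
  have hball : ∀ z ∈ L, ∀ r, |r| ≤ a → path f z r ∈ Metric.closedBall 0 R := fun z hz r hr =>
    hR f hs.tame (by simp) z hz r hr
  set B₁ : ℝ := 4 * W * C₀ / γ with hB₁
  set B₂ : ℝ := W * C₀ * (1 + 2 * M * a) with hB₂
  have hB₁0 : 0 ≤ B₁ := by positivity
  have hB₂0 : 0 ≤ B₂ := by positivity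
  -- The summands serve, in order, the variance bound, the Bernstein condition on the envelope, the
  -- Lipschitz condition of the net, and positivity.
  set A : ℝ := B₁ * (W * C₀ * F * a) + B₁ ^ 2 + B₂ ^ 2 + 1 with hA
  have h00 : 0 ≤ B₁ * (W * C₀ * F * a) := by positivity
  have hA0 : 0 < A := by positivity
  have hA1 : B₁ * (W * C₀ * F * a) ≤ A := by
    rw [hA]; linarith [sq_nonneg B₁, sq_nonneg B₂]
  have hA2 : B₁ ^ 2 ≤ A := by rw [hA]; linarith [sq_nonneg B₂]
  have hA3 : B₂ ≤ √A := Real.le_sqrt_of_sq_le (by rw [hA]; linarith [sq_nonneg B₁])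
  set S : Set (Plane × ℝ) := L ×ˢ Set.Icc (-a) a with hS
  have hSb : Bornology.IsBounded S :=
    hs.filament.isCompact.isBounded.prod (Metric.isBounded_Icc _ _)
  have hS2 : ∀ p ∈ S, |p.2| ≤ a := fun p hp => abs_le.mpr hp.2
  have hbound : ∀ n, ∀ p ∈ S, ∀ y, |pathKernel f K w (h n) l p.1 p.2 y| ≤ B₁ * (h n ^ 3)⁻¹ := by
    intro n p hp y
    have hn := hh.pos n
    refine (abs_pathKernel_le hκ hn hW hw hγ (hsp p.1 hp.1) (hS2 p hp) y).trans (le_of_eq ?_)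
    rw [hl, hB₁]; field_simp
  have key := tendsto_measure_exists_empDev (P := P) (μ := law f) hX.measurable hX.indep hX.law hSb
    (φ := fun n p y => pathKernel f K w (h n) l p.1 p.2 y)
    -- The envelope is h⁻⁴ from the kernel times the occupation time O(h).
    (b := fun n => B₁ * (h n ^ 3)⁻¹) (v := fun n => A * (h n ^ 5)⁻¹)
    (ℓ := fun n => B₂ * (h n ^ 5)⁻¹)
    (Eventually.of_forall fun n p _ => measurable_pathKernel hs.tame hκ hwm p.2)
    (Eventually.of_forall hbound)
    (by
      filter_upwards [hh.eventually_le_one] with n hn1 p hp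
      have hn := hh.pos n
      refine (integral_pathKernel_sq_le (F := F * h n ^ 2) hs.tame hκ hn hwm hW hw (hS2 p hp)
        (fun r hr => hF _ (hball p.1 hp.1 r hr) _ hn hn1) (hbound n p hp)).trans ?_
      calc _ = B₁ * (W * C₀ * F * a) * (h n ^ 5)⁻¹ := by rw [hl]; field_simp; ring
        _ ≤ _ := by gcongr)
    (by
      filter_upwards [hh.eventually_le_one] with n hn1 p hp q hq y
      have hn := hh.pos n
      refine (abs_pathKernel_sub_le hs.tame hκ hn hn1 hwm hW hw hwl
        (fun r hr => hs.path_mem_region hp.1 hr) (fun r hr => hs.path_mem_region hq.1 hr)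
        (fun r hr => hM p.1 hp.1 q.1 r hr) (hS2 q hq) y).trans ?_
      have h1 : ‖p.1 - q.1‖ ≤ ‖p - q‖ := norm_fst_le (p - q)
      have h2 : |p.2 - q.2| ≤ ‖p - q‖ := norm_snd_le (p - q)
      have h3 : (h n ^ 4)⁻¹ ≤ (h n ^ 5)⁻¹ :=
        inv_anti₀ (by positivity) (pow_le_pow_of_le_one hn.le hn1 (by norm_num))
      rw [hl]
      calc _ ≤ W * ((h n ^ 5)⁻¹ * C₀) * ‖p - q‖
            + 2 * W * ((h n ^ (2 + 2))⁻¹ * C₀) * (h n)⁻¹ * (M * ‖p - q‖) * a := by gcongr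
        _ = _ := by rw [hB₂]; field_simp; ring)
    (Eventually.of_forall fun n => by have := hh.pos n; positivity)
    (by
      filter_upwards [hh.eventually_log_le_pow 4 (show 1 ≤ 8 by norm_num),
        eventually_one_le_log] with n hn hlog
      have hn0 := hh.pos n
      calc (2 * (B₁ * (h n ^ 3)⁻¹)) ^ 2 * Real.log n
          = B₁ ^ 2 * (h n ^ 6)⁻¹ * (4 * Real.log n) := by field_simp; ring
        _ ≤ A * (h n ^ 6)⁻¹ * (n * h n ^ 1) := by gcongr
        _ = n * (A * (h n ^ 5)⁻¹) := by field_simp)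
    (by
      filter_upwards [hh.eventually_log_le_pow 1 (show 3 ≤ 8 by norm_num),
        eventually_one_le_log, hh.eventually_le_one] with n hn hlog hn1
      have hn0 := hh.pos n
      have h6 : 1 ≤ n * h n ^ 3 := by linarith
      have h5 : √((h n ^ 4)⁻¹) ≤ √((h n ^ 5)⁻¹) := Real.sqrt_le_sqrt
        (inv_anti₀ (by positivity) (pow_le_pow_of_le_one hn0.le hn1 (by norm_num)))
      rw [show h n ^ 4 = (h n ^ 2) ^ 2 by ring, Real.sqrt_inv, Real.sqrt_sq (by positivity)] at h5
      rw [Real.sqrt_mul hA0.le]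
      calc B₂ * (h n ^ 5)⁻¹ = B₂ * (h n ^ 5)⁻¹ * 1 := by ring
        _ ≤ √A * (h n ^ 5)⁻¹ * (n * h n ^ 3) := by gcongr
        _ = n * (√A * (h n ^ 2)⁻¹) := by field_simp
        _ ≤ _ := by gcongr)
  refine ⟨12 * √A, by positivity, ?_⟩
  refine tendsto_of_tendsto_of_tendsto_of_le_of_le tendsto_const_nhds key (fun _ => zero_le)
    fun n => measure_mono ?_
  rintro ω ⟨z, hz, u, hu, hω⟩
  refine ⟨(z, u), ⟨hz, abs_le.mp hu⟩, ?_⟩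
  have hn0 := hh.pos n
  have e1 := empDev_pathKernel (X := X) (z := z) hs.tame hK (by omega) hκ hn0 hwm hw u ω
  change _ < |empDev (law f) X (pathKernel f K w (h n) l z u) n ω|
  rw [e1]
  refine lt_of_eq_of_lt ?_ hω
  rw [mul_assoc (12 : ℝ) (√A), ← Real.sqrt_mul hA0.le]
  congr 2
  field_simp

end PathRate

/-! ### Events of high probability -/

/-- The outer probability that `p n` fails tends to zero. -/
def HighProb {Ω : Type*} [MeasurableSpace Ω] (P : Measure Ω) (p : ℕ → Ω → Prop) : Prop :=
  Tendsto (fun n => P {ω | ¬ p n ω}) atTop (𝓝 0)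

section HighProb

variable {Ω : Type*} [MeasurableSpace Ω] {P : Measure Ω} {p q : ℕ → Ω → Prop}

lemma HighProb.mono (hp : HighProb P p) (h : ∀ᶠ n in atTop, ∀ ω, p n ω → q n ω) :
    HighProb P q := by
  refine tendsto_of_tendsto_of_tendsto_of_le_of_le' tendsto_const_nhds hp
    (Eventually.of_forall fun _ => zero_le) ?_
  filter_upwards [h] with n hn
  exact measure_mono fun ω hω hpω => hω (hn ω hpω)

lemma HighProb.and (hp : HighProb P p) (hq : HighProb P q) :
    HighProb P fun n ω => p n ω ∧ q n ω := by
  have h := Tendsto.add hp hq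
  rw [add_zero] at h
  refine tendsto_of_tendsto_of_tendsto_of_le_of_le tendsto_const_nhds h (fun _ => zero_le)
    fun n => (measure_mono fun ω hω => ?_).trans (measure_union_le _ _)
  by_cases h1 : p n ω
  · exact Or.inr fun h2 => hω ⟨h1, h2⟩
  · exact Or.inl h1

lemma HighProb.forall {ι : Type*} [Fintype ι] {p : ι → ℕ → Ω → Prop}
    (hp : ∀ i, HighProb P (p i)) : HighProb P fun n ω => ∀ i, p i n ω := by
  have h : Tendsto (fun n => ∑ i, P {ω | ¬ p i n ω}) atTop (𝓝 (∑ _i : ι, 0)) :=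
    tendsto_finsetSum _ fun i _ => hp i
  rw [Finset.sum_const_zero] at h
  refine tendsto_of_tendsto_of_tendsto_of_le_of_le tendsto_const_nhds h (fun _ => zero_le)
    fun n => (measure_mono fun ω hω => ?_).trans (measure_iUnion_fintype_le P _)
  obtain ⟨i, hi⟩ := not_forall.mp hω
  exact Set.mem_iUnion.mpr ⟨i, hi⟩

end HighProb

/-! ### Rate of the linearized error along the curves -/

section Rates

variable {Ω : Type*} [MeasurableSpace Ω] {P : Measure Ω} [IsProbabilityMeasure P]
  {f K : Plane → ℝ} {h : ℕ → ℝ} {X : ℕ → Ω → Plane} {H L : Set Plane} {a C : ℝ}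

lemma highProb_pderivs_fHat (hf : SmoothDensity f) (hK : IsKernel K) (hh : IsBandwidth h)
    (hX : IsSample P f X) (R : ℝ) (l : List (Fin 2)) (hl1 : 1 ≤ l.length) (hl3 : l.length ≤ 3) :
    ∃ M : ℝ, 0 < M ∧ HighProb P fun n ω => ∀ x ∈ Metric.closedBall (0 : Plane) R,
      |pderivs l (fHat K h X n ω) x - kdeMean f K (h n) l x|
        ≤ M * √(Real.log n / (n * h n ^ (2 + 2 * l.length))) := by
  obtain ⟨M, hM, hlim⟩ := tendsto_measure_pderivs_fHat hf hK hh hX R l hl1 hl3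
  refine ⟨M, hM, ?_⟩
  simpa [HighProb] using hlim

/-- The entries of the derivative of `G` along the Hessian of `f`. -/
def eigvecEntry (f : Plane → ℝ) (i : Fin 2) (j : Fin 3) (x : Plane) : ℝ :=
  eigvecDeriv (d2 f x) (EuclideanSpace.single j 1) i

lemma eigvecDeriv_apply_eq_sum (f : Plane → ℝ) (x : Plane) (v : Space3) (i : Fin 2) :
    eigvecDeriv (d2 f x) v i = ∑ j, eigvecEntry f i j x * v j := by
  have h1 : v = ∑ j, v j • EuclideanSpace.single j (1 : ℝ) := by
    ext k; fin_cases k <;> simp [Fin.sum_univ_three]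
  conv_lhs => rw [h1]
  rw [map_sum]
  simp only [map_smul, WithLp.ofLp_sum, Finset.sum_apply, PiLp.smul_apply, smul_eq_mul,
    eigvecEntry]
  exact Finset.sum_congr rfl fun j _ => mul_comm _ _

lemma abs_eigvecEntry_le (f : Plane → ℝ) (i : Fin 2) (j : Fin 3) (x : Plane) :
    |eigvecEntry f i j x| ≤ 12 := by
  refine (abs_apply_le_norm_plane _ i).trans ((norm_eigvecDeriv_apply_le _ _).trans ?_)
  simp

/-- The weights are continuous on H only, but measurability is needed on the whole plane. The
explicit formula gives it, zero gap included. -/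
lemma measurable_eigvecEntry (hf : Tame f) (i : Fin 2) (j : Fin 3) :
    Measurable (eigvecEntry f i j) := by
  have h1 : Continuous fun x => gapMap (d2 f x) := gapMap.continuous.comp hf.continuous_d2
  have h2 : eigvecEntry f i j = fun x => linPart (EuclideanSpace.single j 1) i
      - (‖gapMap (d2 f x)‖⁻¹ * inner ℝ (gapMap (d2 f x)) (gapMap (EuclideanSpace.single j 1)))
        * dirVec i := by
    funext x
    rw [eigvecEntry, eigvecDeriv_apply]
    simp
  rw [h2]
  refine measurable_const.sub (((h1.norm.measurable.inv).mul ?_).mul_const _)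
  exact (h1.inner continuous_const).measurable

lemma Setup.continuousOn_eigvecEntry (hs : Setup f H L a C) (i : Fin 2) (j : Fin 3) :
    ContinuousOn (eigvecEntry f i j) H := by
  have h1 : ContinuousOn (fun x => eigvecDeriv (d2 f x) (EuclideanSpace.single j 1)) H :=
    hs.continuousOn_eigvecDeriv.clm_apply continuousOn_const
  exact (EuclideanSpace.proj (𝕜 := ℝ) i).continuous.comp_continuousOn h1

lemma Setup.exists_eigvecEntry_lipschitz (hs : Setup f H L a C) :
    ∃ W, 12 ≤ W ∧ ∀ i j, ∀ x ∈ H, ∀ x' ∈ H,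
      |eigvecEntry f i j x - eigvecEntry f i j x'| ≤ W * ‖x - x'‖ := by
  obtain ⟨c, hc, hgap⟩ := hs.exists_gap_lower
  have hC := hs.bounds.one_le
  refine ⟨max 12 (24 / c * C), le_max_left _ _, fun i j x hx x' hx' => ?_⟩
  have h1 := norm_eigvecDeriv_sub_le_mul hc (hgap x hx) (hs.gap_ne_zero hx')
  have h2 := (eigvecDeriv (d2 f x) - eigvecDeriv (d2 f x')).le_opNorm
    (EuclideanSpace.single j 1)
  have h3 := abs_apply_le_norm_plane
    ((eigvecDeriv (d2 f x) - eigvecDeriv (d2 f x')) (EuclideanSpace.single j 1)) i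
  have h4 : (eigvecDeriv (d2 f x) - eigvecDeriv (d2 f x')) (EuclideanSpace.single j 1) i
      = eigvecEntry f i j x - eigvecEntry f i j x' := by
    simp [eigvecEntry]
  rw [h4] at h3
  rw [show ‖(EuclideanSpace.single j 1 : Space3)‖ = 1 by simp, mul_one] at h2
  refine h3.trans (h2.trans (h1.trans ?_))
  calc 24 / c * ‖d2 f x - d2 f x'‖ ≤ 24 / c * (C * ‖x - x'‖) := by
        gcongr; exact hs.bounds.d2_sub_le _ _
    _ = 24 / c * C * ‖x - x'‖ := by ring
    _ ≤ _ := by gcongr; exact le_max_right _ _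

/-- The linearized error of the estimated integral curves. -/
theorem highProb_integral_eigvecDeriv (hs : Setup f H L a C) (hf : SmoothDensity f)
    (hK : IsKernel K) (hh : IsBandwidth h) (hX : IsSample P f X) :
    ∃ B : ℝ, 0 < B ∧ HighProb P fun n ω => ∀ z ∈ L, ∀ u, |u| ≤ a →
      ‖∫ r in 0..u, eigvecDeriv (d2 f (path f z r))
        (d2 (fHat K h X n ω) (path f z r) - d2 f (path f z r))‖
        ≤ B * (√(Real.log n / (n * h n ^ 5)) + h n ^ 2) := by
  have := hf.isProbabilityMeasure_law
  obtain ⟨W, hW, hWl⟩ := hs.exists_eigvecEntry_lipschitz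
  obtain ⟨C₀, hC₀⟩ := hK.exists_bump
  obtain ⟨B₀, hB₀, hbias⟩ := exists_bias hf hK
  have ha := hs.filament.pos
  have key : ∀ p : Fin 2 × Fin 3, ∃ M : ℝ, 0 < M ∧ HighProb P fun n ω => ∀ z ∈ L, ∀ u, |u| ≤ a →
      |∫ r in 0..u, eigvecEntry f p.1 p.2 (path f z r) *
        (pderivs (d2Index p.2) (fHat K h X n ω) (path f z r)
          - kdeMean f K (h n) (d2Index p.2) (path f z r))|
        ≤ M * √(Real.log n / (n * h n ^ 5)) := fun p => by
    obtain ⟨M, hM, hlim⟩ := tendsto_measure_pathIntegral (P := P) (W := W) hs hf hK hh hX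
      (by linarith) (measurable_eigvecEntry hs.tame p.1 p.2)
      (fun x => (abs_eigvecEntry_le f p.1 p.2 x).trans hW) (hWl p.1 p.2) (length_d2Index p.2)
    refine ⟨M, hM, ?_⟩
    simpa [HighProb] using hlim
  choose M hM hlim using key
  set M' : ℝ := ∑ p, M p with hM'
  have hMle : ∀ p, M p ≤ M' := fun p =>
    Finset.single_le_sum (fun p _ => (hM p).le) (Finset.mem_univ p)
  have hM'0 : 0 < M' := (hM (0, 0)).trans_le (hMle _)
  -- The factor 6 sums three entries in each of two coordinates; 12 bounds an entry and a the length
  -- of the time interval over which the bias is integrated.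
  refine ⟨6 * (M' + 12 * B₀ * a), by positivity, (HighProb.forall hlim).mono
    (Eventually.of_forall fun n ω hω z hz u hu => ?_)⟩
  have hn := hh.pos n
  set s : ℝ := √(Real.log n / (n * h n ^ 5)) with hs'
  have hs0 : 0 ≤ s := Real.sqrt_nonneg _
  have hmem : ∀ r ∈ Set.uIcc 0 u, path f z r ∈ H := fun r hr =>
    hs.path_mem_region hz (Setup.abs_le_of_mem_uIcc hu hr)
  have hpath : ContinuousOn (path f z) (Set.uIcc 0 u) := (hs.tame.continuous_path z).continuousOn
  have hkde : ∀ j, Continuous fun x => pderivs (d2Index j) (fHat K h X n ω) x := fun j => by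
    have : ContDiff ℝ (0 : ℕ) (pderivs (d2Index j) (fHat K h X n ω)) := contDiff_pderivs _
      ((hK.contDiff_fHat n ω).of_le (by rw [length_d2Index]; norm_num))
    exact this.continuous
  have hfd : ∀ j, Continuous fun x => pderivs (d2Index j) f x := fun j => by
    have : ContDiff ℝ (0 : ℕ) (pderivs (d2Index j) f) := contDiff_pderivs _
      (hf.contDiff.of_le (by rw [length_d2Index]; norm_num))
    exact this.continuous
  have hmean : ∀ j, Continuous (kdeMean f K (h n) (d2Index j)) := fun j =>
    (hC₀ (d2Index j) (by rw [length_d2Index]; norm_num)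
      (by rw [length_d2Index]; norm_num)).continuous_kdeMean hn
  have hent : ∀ i j, ContinuousOn (fun r => eigvecEntry f i j (path f z r)) (Set.uIcc 0 u) :=
    fun i j => (hs.continuousOn_eigvecEntry i j).comp hpath hmem
  have i1 : IntervalIntegrable (fun r => eigvecDeriv (d2 f (path f z r))
      (d2 (fHat K h X n ω) (path f z r) - d2 f (path f z r))) volume 0 u := by
    refine ContinuousOn.intervalIntegrable ?_
    have h2 : ContinuousOn (fun r => d2 (fHat K h X n ω) (path f z r) - d2 f (path f z r))
        (Set.uIcc 0 u) :=
      (((hK.tame_fHat hh.pos n ω).continuous_d2.sub hs.tame.continuous_d2).comp_continuousOn hpath)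
    exact (hs.continuousOn_eigvecDeriv.comp hpath hmem).clm_apply h2
  have hcomp : ∀ i, |(∫ r in 0..u, eigvecDeriv (d2 f (path f z r))
      (d2 (fHat K h X n ω) (path f z r) - d2 f (path f z r))) i|
      ≤ 3 * (M' * s + 12 * (B₀ * h n ^ 2) * a) := by
    intro i
    have e1 : (∫ r in 0..u, eigvecDeriv (d2 f (path f z r))
        (d2 (fHat K h X n ω) (path f z r) - d2 f (path f z r))) i
        = ∫ r in 0..u, eigvecDeriv (d2 f (path f z r))
          (d2 (fHat K h X n ω) (path f z r) - d2 f (path f z r)) i :=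
      ((EuclideanSpace.proj (𝕜 := ℝ) i).intervalIntegral_comp_comm i1).symm
    rw [e1]
    have i2 : ∀ j, IntervalIntegrable (fun r => eigvecEntry f i j (path f z r) *
        (pderivs (d2Index j) (fHat K h X n ω) (path f z r)
          - kdeMean f K (h n) (d2Index j) (path f z r))) volume 0 u := fun j =>
      ((hent i j).mul (((hkde j).sub (hmean j)).comp_continuousOn hpath)).intervalIntegrable
    have i3 : ∀ j, IntervalIntegrable (fun r => eigvecEntry f i j (path f z r) *
        (kdeMean f K (h n) (d2Index j) (path f z r)
          - pderivs (d2Index j) f (path f z r))) volume 0 u := fun j =>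
      ((hent i j).mul (((hmean j).sub (hfd j)).comp_continuousOn hpath)).intervalIntegrable
    -- The error is split into fluctuation and bias, entry by entry. Only the fluctuation profits
    -- from integration along the curve.
    have e2 : ∀ r, eigvecDeriv (d2 f (path f z r))
        (d2 (fHat K h X n ω) (path f z r) - d2 f (path f z r)) i
        = ∑ j, (eigvecEntry f i j (path f z r) *
            (pderivs (d2Index j) (fHat K h X n ω) (path f z r)
              - kdeMean f K (h n) (d2Index j) (path f z r))
          + eigvecEntry f i j (path f z r) *
            (kdeMean f K (h n) (d2Index j) (path f z r)
              - pderivs (d2Index j) f (path f z r))) := fun r => by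
      rw [eigvecDeriv_apply_eq_sum]
      refine Finset.sum_congr rfl fun j _ => ?_
      rw [PiLp.sub_apply, d2_apply, d2_apply]
      ring
    simp only [e2]
    rw [intervalIntegral.integral_finsetSum fun j _ => (i2 j).add (i3 j)]
    refine (Finset.abs_sum_le_sum_abs _ _).trans ?_
    have hj : ∀ j ∈ (Finset.univ : Finset (Fin 3)), |∫ r in 0..u,
        (eigvecEntry f i j (path f z r) *
            (pderivs (d2Index j) (fHat K h X n ω) (path f z r)
              - kdeMean f K (h n) (d2Index j) (path f z r))
          + eigvecEntry f i j (path f z r) *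
            (kdeMean f K (h n) (d2Index j) (path f z r)
              - pderivs (d2Index j) f (path f z r)))| ≤ M' * s + 12 * (B₀ * h n ^ 2) * a := by
      intro j _
      rw [intervalIntegral.integral_add (i2 j) (i3 j)]
      refine (abs_add_le _ _).trans (add_le_add ?_ ?_)
      · exact (hω (i, j) z hz u hu).trans (by gcongr; exact hMle _)
      · rw [← Real.norm_eq_abs]
        refine (intervalIntegral.norm_integral_le_of_norm_le_const
          (C := 12 * (B₀ * h n ^ 2)) fun r _ => ?_).trans ?_
        · rw [norm_mul]
          have h5 := (hbias (h n) hn (d2Index j) (by rw [length_d2Index]; norm_num)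
            (path f z r)).1 (by rw [length_d2Index])
          have h6 := abs_eigvecEntry_le f i j (path f z r)
          exact mul_le_mul h6 h5 (abs_nonneg _) (by norm_num)
        · rw [sub_zero]; gcongr
    refine (Finset.sum_le_sum hj).trans ?_
    simp [mul_add]
  refine (norm_plane_le_of_forall hcomp).trans ?_
  have h7 : 0 ≤ M' * h n ^ 2 + 12 * B₀ * a * s := by positivity
  linarith

end Rates

/-! ### Uniform errors of the first three derivatives -/

section Approximation

variable {Ω : Type*} [MeasurableSpace Ω] {P : Measure Ω} [IsProbabilityMeasure P]
  {f K : Plane → ℝ} {h : ℕ → ℝ} {X : ℕ → Ω → Plane}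

/-- Uniform rates of the first three derivatives of the kernel estimator. -/
theorem exists_rates (hf : SmoothDensity f) (hK : IsKernel K) (hh : IsBandwidth h)
    (hX : IsSample P f X) (R : ℝ) :
    ∃ B : ℝ, 0 < B ∧
      (∀ n ≠ 0, ∀ x, ‖meanD2 P K h X n x - d2 f x‖ ≤ B * h n ^ 2 ∧
        ‖meanGrad P K h X n x - gradient f x‖ ≤ B * h n ^ 2) ∧
      HighProb P fun n ω =>
        Approx f R (B * (√(Real.log n / (n * h n ^ 4)) + h n ^ 2))
          (B * (√(Real.log n / (n * h n ^ 6)) + h n ^ 2))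
          (B * (√(Real.log n / (n * h n ^ 8)) + h n)) (fHat K h X n ω) ∧
        ∀ x ∈ Metric.closedBall 0 R, ‖gradient (fHat K h X n ω) x - meanGrad P K h X n x‖
          ≤ B * √(Real.log n / (n * h n ^ 4)) := by
  obtain ⟨B₀, hB₀, hbias⟩ := exists_bias hf hK
  choose M₁ hM₁ hl₁ using fun i : Fin 2 =>
    highProb_pderivs_fHat (P := P) hf hK hh hX R [i] (by simp) (by simp)
  choose M₂ hM₂ hl₂ using fun j : Fin 3 =>
    highProb_pderivs_fHat (P := P) hf hK hh hX R (d2Index j)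
      (by rw [length_d2Index]; norm_num) (by rw [length_d2Index]; norm_num)
  choose M₃ hM₃ hl₃ using fun p : Fin 2 × Fin 3 =>
    highProb_pderivs_fHat (P := P) hf hK hh hX R (p.1 :: d2Index p.2)
      (by simp) (by simp [length_d2Index])
  simp only [List.length_cons, List.length_nil, length_d2Index, Nat.reduceMul, Nat.reduceAdd] at hl₁ hl₂ hl₃
  set M : ℝ := (∑ i, M₁ i) + (∑ j, M₂ j) + (∑ p, M₃ p) + B₀ with hM
  have s₁ : 0 ≤ ∑ i, M₁ i := Finset.sum_nonneg fun i _ => (hM₁ i).le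
  have s₂ : 0 ≤ ∑ i, M₂ i := Finset.sum_nonneg fun i _ => (hM₂ i).le
  have s₃ : 0 ≤ ∑ i, M₃ i := Finset.sum_nonneg fun i _ => (hM₃ i).le
  have le₀ : B₀ ≤ M := by linarith
  have le₁ : ∀ i, M₁ i ≤ M := fun i => by
    have := Finset.single_le_sum (fun p _ => (hM₁ p).le) (Finset.mem_univ i)
    linarith
  have le₂ : ∀ i, M₂ i ≤ M := fun i => by
    have := Finset.single_le_sum (fun p _ => (hM₂ p).le) (Finset.mem_univ i)
    linarith
  have le₃ : ∀ i, M₃ i ≤ M := fun i => by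
    have := Finset.single_le_sum (fun p _ => (hM₃ p).le) (Finset.mem_univ i)
    linarith
  have hM0 : 0 < M := hB₀.trans_le le₀
  -- Triangle inequality through the mean v: fluctuation plus bias, under the common constant M.
  have step : ∀ {u v w m s t : ℝ}, |u - v| ≤ m * s → |v - w| ≤ B₀ * t → m ≤ M → 0 ≤ s → 0 ≤ t →
      |u - w| ≤ M * (s + t) := by
    intro u v w m s t h1 h2 hm hs ht
    have h3 := abs_sub_le u v w
    have h4 : m * s ≤ M * s := by gcongr
    have h5 : B₀ * t ≤ M * t := by gcongr
    linarith
  refine ⟨6 * M, by positivity, fun n hn x => ⟨?_, ?_⟩, ?_⟩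
  · have hn0 := hh.pos n
    have := norm_space3_le_of_forall (v := meanD2 P K h X n x - d2 f x) (c := M * h n ^ 2)
      fun j => by
        rw [PiLp.sub_apply, meanD2_apply hf hK hh.pos hX hn, d2_apply]
        refine ((hbias (h n) hn0 (d2Index j) (by rw [length_d2Index]; norm_num) x).1
          (by rw [length_d2Index])).trans ?_
        gcongr
    have h1 : 0 ≤ M * h n ^ 2 := by positivity
    linarith
  · have hn0 := hh.pos n
    have := norm_plane_le_of_forall (v := meanGrad P K h X n x - gradient f x)
      (c := M * h n ^ 2) fun i => by
        rw [PiLp.sub_apply, meanGrad_apply hf hK hh.pos hX hn, gradient_apply]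
        refine ((hbias (h n) hn0 [i] (by simp) x).1 (by simp)).trans ?_
        gcongr
    have h1 : 0 ≤ M * h n ^ 2 := by positivity
    linarith
  · refine ((HighProb.forall hl₁).and ((HighProb.forall hl₂).and (HighProb.forall hl₃))).mono ?_
    filter_upwards [eventually_ne_atTop 0] with n hn ω hω
    obtain ⟨h1, h2, h3⟩ := hω
    have hn0 := hh.pos n
    have d1 : ∀ x ∈ Metric.closedBall 0 R, ∀ i,
        |pderivs [i] (fHat K h X n ω) x - pderivs [i] f x|
          ≤ M * (√(Real.log n / (n * h n ^ 4)) + h n ^ 2) := fun x hx i =>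
      step (h1 i x (by simpa using hx)) ((hbias (h n) hn0 [i] (by simp) x).1 (by simp)) (le₁ i)
        (Real.sqrt_nonneg _) (by positivity)
    have d2' : ∀ x ∈ Metric.closedBall 0 R, ∀ j,
        |pderivs (d2Index j) (fHat K h X n ω) x - pderivs (d2Index j) f x|
          ≤ M * (√(Real.log n / (n * h n ^ 6)) + h n ^ 2) := fun x hx j =>
      step (h2 j x (by simpa using hx)) ((hbias (h n) hn0 (d2Index j)
        (by rw [length_d2Index]; norm_num) x).1 (by rw [length_d2Index])) (le₂ j)
        (Real.sqrt_nonneg _) (by positivity)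
    have d3 : ∀ x ∈ Metric.closedBall 0 R, ∀ i j,
        |pderivs (i :: d2Index j) (fHat K h X n ω) x - pderivs (i :: d2Index j) f x|
          ≤ M * (√(Real.log n / (n * h n ^ 8)) + h n) := fun x hx i j =>
      step (h3 (i, j) x (by simpa using hx)) ((hbias (h n) hn0 (i :: d2Index j)
        (by simp) x).2 (by simp [length_d2Index])) (le₃ (i, j))
        (Real.sqrt_nonneg _) hn0.le
    refine ⟨⟨hK.tame_fHat hh.pos n ω, hK.contDiff_fHat n ω, fun x hx => ?_, fun x hx => ?_,
      fun x hx => ?_⟩, fun x hx => ?_⟩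
    · have := norm_plane_le_of_forall (v := gradient (fHat K h X n ω) x - gradient f x) fun i => by
        rw [PiLp.sub_apply, gradient_apply, gradient_apply]
        exact d1 x hx i
      have h4 : 0 ≤ M * (√(Real.log n / (n * h n ^ 4)) + h n ^ 2) := by positivity
      linarith
    · have := norm_space3_le_of_forall (v := d2 (fHat K h X n ω) x - d2 f x) fun j => by
        rw [PiLp.sub_apply, d2_apply, d2_apply]
        exact d2' x hx j
      have h4 : 0 ≤ M * (√(Real.log n / (n * h n ^ 6)) + h n ^ 2) := by positivity
      linarith
    · have := norm_fderiv_d2_sub_le (hf.contDiff.of_le (by norm_num)) (hK.contDiff_fHat n ω)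
        (d3 x hx)
      linarith
    · have := norm_plane_le_of_forall (v := gradient (fHat K h X n ω) x - meanGrad P K h X n x)
        (c := M * √(Real.log n / (n * h n ^ 4))) fun i => by
          rw [PiLp.sub_apply, gradient_apply, meanGrad_apply hf hK hh.pos hX hn]
          refine (h1 i x (by simpa using hx)).trans ?_
          gcongr
          exact le₁ i
      have h4 : 0 ≤ M * √(Real.log n / (n * h n ^ 4)) := by positivity
      linarith

end Approximation

/-! ### Comparison of the rates -/

/-- As the failure probability tends to zero, a single constant M serves every ε. -/
lemma HighProb.isBigOp {Ω : Type*} [MeasurableSpace Ω] {P : Measure Ω} {Z : ℕ → Ω → ℝ≥0∞}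
    {r : ℕ → ℝ} {M : ℝ} (hM : 0 < M)
    (h : HighProb P fun n ω => Z n ω ≤ ENNReal.ofReal (M * r n)) : IsBigOp P Z r := by
  intro ε hε
  refine ⟨M, hM, ?_⟩
  have h1 := h.eventually_le_const (ENNReal.ofReal_pos.mpr hε)
  filter_upwards [h1] with n hn
  simpa only [not_le] using hn

/-- With c² = h, all fluctuation rates become A times a power of c. The half power gained by path
integration is the reason for working with √h. -/
lemma sqrt_rate {x y c : ℝ} (hc : 0 < c) {m k : ℕ} (hmk : m + k = 8) :
    √(x / (y * (c ^ 2) ^ m)) = √(x / (y * (c ^ 2) ^ 8)) * c ^ k := by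
  have h1 : x / (y * (c ^ 2) ^ m) = x / (y * (c ^ 2) ^ 8) * (c ^ k) ^ 2 := by
    rw [← hmk, pow_add, ← pow_mul c k 2, mul_comm k 2, pow_mul c 2 k]
    field_simp
  rw [h1, Real.sqrt_mul' _ (by positivity), Real.sqrt_sq (by positivity)]

lemma IsBandwidth.eventually_rate_le {h : ℕ → ℝ} (hh : IsBandwidth h) {δ : ℝ} (hδ : 0 < δ) :
    ∀ᶠ n : ℕ in atTop, √(Real.log n / (n * h n ^ 8)) ≤ δ := by
  filter_upwards [hh.eventually_log_le (δ ^ 2)⁻¹, eventually_gt_atTop 0] with n hn hn0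
  have h0 := hh.pos n
  have hn0' : (0 : ℝ) < n := by exact_mod_cast hn0
  rw [Real.sqrt_le_left hδ.le, div_le_iff₀ (by positivity)]
  rwa [inv_mul_le_iff₀ (by positivity)] at hn

/-- Boundedness of n h⁹ together with log n ≥ 1 gives h ≤ (β + 1) log n / (n h⁸), hence c = O(A).
Biases, which are powers of c, can thus be traded for powers of A. -/
lemma IsBandwidth.exists_sqrt_le {h : ℕ → ℝ} (hh : IsBandwidth h) :
    ∃ q : ℝ, 1 ≤ q ∧ ∀ᶠ n : ℕ in atTop, √(h n) ≤ q * √(Real.log n / (n * h n ^ 8)) := by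
  obtain ⟨β, hβ, hlim⟩ := hh.tendsto_beta
  refine ⟨√(β + 1), Real.one_le_sqrt.mpr (by linarith), ?_⟩
  filter_upwards [hlim.eventually_le_const (show β < β + 1 by linarith), eventually_one_le_log,
    eventually_gt_atTop 0] with n hn hlog hn0
  have h0 := hh.pos n
  have hn0' : (0 : ℝ) < n := by exact_mod_cast hn0
  rw [← Real.sqrt_mul (by linarith)]
  refine Real.sqrt_le_sqrt ?_
  rw [← mul_div_assoc, le_div_iff₀ (by positivity)]
  calc h n * (n * h n ^ 8) = n * h n ^ 9 * 1 := by ring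
    _ ≤ (β + 1) * Real.log n := by gcongr

/-- The left side is I + e₁ + b + e₂² + e₂e₃ in terms of A and c. The product e₂e₃ has order A²c²
already; the terms Ac³ and c⁴ reach it by exchanging factors c for A. -/
lemma general_rate {A B c q : ℝ} (hB : 0 ≤ B) (hc : 0 ≤ c) (hc1 : c ≤ 1) (hA : 0 ≤ A)
    (hA1 : A ≤ 1) (hq : 1 ≤ q) (hcA : c ≤ q * A) :
    B * (A * c ^ 3 + c ^ 4) + B * (A * c ^ 4 + c ^ 4) + B * c ^ 4
        + (B * (A * c ^ 2 + c ^ 4)) ^ 2 + B * (A * c ^ 2 + c ^ 4) * (B * (A + c ^ 2))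
      ≤ (5 * B * q ^ 2 + 2 * (2 * B * q) ^ 2) * (A ^ 2 * c ^ 2) := by
  have hAq : A ≤ q * A := le_mul_of_one_le_left hA hq
  have hc2 : c ^ 2 ≤ q * A := (pow_le_of_le_one hc hc1 two_ne_zero).trans hcA
  have h1 : A * c ^ 3 ≤ q ^ 2 * (A ^ 2 * c ^ 2) := by
    calc A * c ^ 3 = A * c * c ^ 2 := by ring
      _ ≤ (q * A) * (q * A) * c ^ 2 := by gcongr
      _ = _ := by ring
  have h2 : c ^ 4 ≤ q ^ 2 * (A ^ 2 * c ^ 2) := by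
    calc c ^ 4 = c * c * c ^ 2 := by ring
      _ ≤ (q * A) * (q * A) * c ^ 2 := by gcongr
      _ = _ := by ring
  have h3 : A * c ^ 4 ≤ q ^ 2 * (A ^ 2 * c ^ 2) :=
    (mul_le_of_le_one_left (by positivity) hA1).trans h2
  have h4 : A * c ^ 2 + c ^ 4 ≤ 2 * q * A * c ^ 2 := by
    calc A * c ^ 2 + c ^ 4 = (A + c ^ 2) * c ^ 2 := by ring
      _ ≤ (q * A + q * A) * c ^ 2 := by gcongr
      _ = _ := by ring
  have h5 : A + c ^ 2 ≤ 2 * q * A := by linarith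
  have h6 : (B * (A * c ^ 2 + c ^ 4)) ^ 2 ≤ (2 * B * q) ^ 2 * (A ^ 2 * c ^ 2) := by
    calc _ ≤ (B * (2 * q * A * c ^ 2)) ^ 2 := by gcongr
      _ = (2 * B * q) ^ 2 * (A ^ 2 * c ^ 2) * c ^ 2 := by ring
      _ ≤ _ := mul_le_of_le_one_right (by positivity) (pow_le_one₀ hc hc1)
  have h7 : B * (A * c ^ 2 + c ^ 4) * (B * (A + c ^ 2)) ≤ (2 * B * q) ^ 2 * (A ^ 2 * c ^ 2) := by
    calc _ ≤ B * (2 * q * A * c ^ 2) * (B * (2 * q * A)) := by gcongr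
      _ = _ := by ring
  have h8 := mul_le_mul_of_nonneg_left (add_le_add (add_le_add h1 h2) (add_le_add (add_le_add h3 h2) h2)) hB
  linarith

/-- The gradient fluctuation Ac⁴ becomes A²c³ on exchanging one c for A. The sum s is O(Ac³), led by
the integrated error, and the crude bound O(A) for the other factor of the product suffices. -/
lemma critical_rate {A B c q : ℝ} (hB : 0 ≤ B) (hc : 0 ≤ c) (hc1 : c ≤ 1) (hA : 0 ≤ A)
    (hA1 : A ≤ 1) (hq : 1 ≤ q) (hcA : c ≤ q * A) {s : ℝ}
    (hs : s = B * (A * c ^ 4) + B * c ^ 4 + B * (A * c ^ 3 + c ^ 4)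
      + (B * (A * c ^ 2 + c ^ 4)) ^ 2) :
    B * (A * c ^ 4) + s * (s + B * (A * c ^ 2 + c ^ 4))
      ≤ (B * q + (4 * B * q + (2 * B * q) ^ 2) * (4 * B * q + (2 * B * q) ^ 2 + 2 * B * q))
        * (A ^ 2 * c ^ 3) := by
  have hAq : A ≤ q * A := le_mul_of_one_le_left hA hq
  have hc2 : c ^ 2 ≤ q * A := (pow_le_of_le_one hc hc1 two_ne_zero).trans hcA
  have h0 : A * c ^ 4 ≤ q * (A ^ 2 * c ^ 3) := by
    calc A * c ^ 4 = A * c ^ 3 * c := by ring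
      _ ≤ A * c ^ 3 * (q * A) := by gcongr
      _ = _ := by ring
  have h1 : A * c ^ 3 ≤ q * (A * c ^ 3) := le_mul_of_one_le_left (by positivity) hq
  have h2 : c ^ 4 ≤ q * (A * c ^ 3) := by
    calc c ^ 4 = c * c ^ 3 := by ring
      _ ≤ q * A * c ^ 3 := by gcongr
      _ = _ := by ring
  have h3 : A * c ^ 4 ≤ q * (A * c ^ 3) :=
    (mul_le_of_le_one_left (by positivity) hA1).trans h2
  have h4 : A * c ^ 2 + c ^ 4 ≤ 2 * q * A * c ^ 2 := by
    calc A * c ^ 2 + c ^ 4 = (A + c ^ 2) * c ^ 2 := by ring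
      _ ≤ (q * A + q * A) * c ^ 2 := by gcongr
      _ = _ := by ring
  have h6 : (B * (A * c ^ 2 + c ^ 4)) ^ 2 ≤ (2 * B * q) ^ 2 * (A * c ^ 3) := by
    calc _ ≤ (B * (2 * q * A * c ^ 2)) ^ 2 := by gcongr
      _ = (2 * B * q) ^ 2 * (A * c ^ 3) * (A * c) := by ring
      _ ≤ _ := mul_le_of_le_one_right (by positivity) (mul_le_one₀ hA1 hc hc1)
  have hsle : s ≤ (4 * B * q + (2 * B * q) ^ 2) * (A * c ^ 3) := by
    have h8 := mul_le_mul_of_nonneg_left (add_le_add (add_le_add h3 h2) (add_le_add h1 h2)) hB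
    rw [hs]
    linarith
  have hs0 : 0 ≤ s := by rw [hs]; positivity
  have h9 : s + B * (A * c ^ 2 + c ^ 4)
      ≤ (4 * B * q + (2 * B * q) ^ 2 + 2 * B * q) * A := by
    have e1 : A * c ^ 3 ≤ A := mul_le_of_le_one_right hA (pow_le_one₀ hc hc1)
    have e2 : A * c ^ 2 ≤ A := mul_le_of_le_one_right hA (pow_le_one₀ hc hc1)
    have e3 : (4 * B * q + (2 * B * q) ^ 2) * (A * c ^ 3) ≤ (4 * B * q + (2 * B * q) ^ 2) * A := by
      gcongr
    have e4 : B * (A * c ^ 2 + c ^ 4) ≤ 2 * B * q * A := by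
      calc _ ≤ B * (2 * q * A * c ^ 2) := by gcongr
        _ = 2 * B * q * (A * c ^ 2) := by ring
        _ ≤ _ := by gcongr
    linarith
  have h10 := mul_le_mul_of_nonneg_left h0 hB
  have h11 : s * (s + B * (A * c ^ 2 + c ^ 4)) ≤ (4 * B * q + (2 * B * q) ^ 2) * (A * c ^ 3)
      * ((4 * B * q + (2 * B * q) ^ 2 + 2 * B * q) * A) := by
    gcongr
  linarith

/-! ### Stochastic expansion of the estimated hitting times -/

lemma Approx.mono {f g : Plane → ℝ} {R e₁ e₂ e₃ e₁' e₂' e₃' : ℝ} (hg : Approx f R e₁ e₂ e₃ g)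
    (h₁ : e₁ ≤ e₁') (h₂ : e₂ ≤ e₂') (h₃ : e₃ ≤ e₃') : Approx f R e₁' e₂' e₃' g :=
  ⟨hg.tame, hg.contDiff, fun x hx => (hg.grad x hx).trans h₁, fun x hx => (hg.d2 x hx).trans h₂,
    fun x hx => (hg.d3 x hx).trans h₃⟩

section Expansion

variable {Ω : Type*} [MeasurableSpace Ω] {P : Measure Ω} [IsProbabilityMeasure P]
  {f K : Plane → ℝ} {h : ℕ → ℝ} {X : ℕ → Ω → Plane} {H L : Set Plane} {a C : ℝ}

/-- The behaviour of the kernel estimator which determines that of the hitting times. Here `A` is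
the rate of the third derivatives, and `c` is the square root of the bandwidth. -/
structure GoodEvent (f : Plane → ℝ) (L : Set Plane) (a R B A c : ℝ) (m : Plane → Space3)
    (M : Plane → Plane) (g : Plane → ℝ) : Prop where
  approx : Approx f R (B * (A * c ^ 4) + B * c ^ 4) (B * (A * c ^ 2 + c ^ 4)) (B * (A + c ^ 2)) g
  grad : ∀ x ∈ Metric.closedBall 0 R, ‖gradient g x - M x‖ ≤ B * (A * c ^ 4)
  integral : ∀ z ∈ L, ∀ u, |u| ≤ a → ‖∫ r in (0 : ℝ)..u, eigvecDeriv (d2 f (path f z r))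
    (d2 g (path f z r) - d2 f (path f z r))‖ ≤ B * (A * c ^ 3 + c ^ 4)
  mean_d2 : ∀ x, ‖m x - Filament.d2 f x‖ ≤ B * c ^ 4
  mean_grad : ∀ x, ‖M x - gradient f x‖ ≤ B * c ^ 4

lemma Setup.exists_goodEvent (hs : Setup f H L a C) (hf : SmoothDensity f) (hK : IsKernel K)
    (hh : IsBandwidth h) (hX : IsSample P f X) (R : ℝ) :
    ∃ B : ℝ, 0 < B ∧ HighProb P fun n ω =>
      GoodEvent f L a R B (√(Real.log n / (n * h n ^ 8))) (√(h n)) (meanD2 P K h X n)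
        (meanGrad P K h X n) (fHat K h X n ω) := by
  obtain ⟨B₁, hB₁, hmean, happ⟩ := exists_rates (P := P) hf hK hh hX R
  obtain ⟨B₂, hB₂, hint⟩ := highProb_integral_eigvecDeriv (P := P) hs hf hK hh hX
  refine ⟨max B₁ B₂, lt_max_of_lt_left hB₁, (happ.and hint).mono ?_⟩
  filter_upwards [eventually_ne_atTop 0] with n hn ω hω
  obtain ⟨⟨h1, h2⟩, h3⟩ := hω
  have hn0 := hh.pos n
  have hc0 : 0 < √(h n) := Real.sqrt_pos.mpr hn0
  have hc2 : h n = √(h n) ^ 2 := (Real.sq_sqrt hn0.le).symm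
  have hm := hmean n hn
  set c := √(h n) with hc
  rw [hc2] at h1 h2 h3 hm
  rw [hc2]
  rw [sqrt_rate hc0 (show 4 + 4 = 8 by norm_num),
    sqrt_rate hc0 (show 6 + 2 = 8 by norm_num)] at h1
  rw [sqrt_rate hc0 (show 4 + 4 = 8 by norm_num)] at h2
  rw [sqrt_rate hc0 (show 5 + 3 = 8 by norm_num)] at h3
  have e4 : (c ^ 2) ^ 2 = c ^ 4 := by ring
  rw [e4] at h1 h3 hm
  set A := √(Real.log n / (n * (c ^ 2) ^ 8)) with hA
  have hA0 : 0 ≤ A := Real.sqrt_nonneg _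
  have l1 := le_max_left B₁ B₂
  have l2 := le_max_right B₁ B₂
  refine ⟨h1.mono ?_ ?_ ?_, fun x hx => (h2 x hx).trans ?_, fun z hz u hu =>
    (h3 z hz u hu).trans ?_, fun x => (hm x).1.trans ?_, fun x => (hm x).2.trans ?_⟩
  · rw [← mul_add]; gcongr
  all_goals gcongr

/-- On the good event the deterministic expansions apply as soon as all errors lie below their
thresholds. That holds for large n because A and c tend to zero, and it yields both rates with one
constant. -/
theorem Setup.expansion (hs : Setup f H L a C) (hf : SmoothDensity f) (hK : IsKernel K)
    (hh : IsBandwidth h) (hX : IsSample P f X) (θhat : ℕ → Ω → Plane → ℝ)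
    (hθ : ∀ n ω, ∀ x₀ ∈ startSet f L a, IsHitTime (fHat K h X n ω) x₀ (θhat n ω x₀)) :
    ∃ M : ℝ, 0 < M ∧ HighProb P fun n ω => ∀ x₀ ∈ startSet f L a,
      |θhat n ω x₀ - hitTime f x₀ + phi1 P f K h X n ω (hitPoint f x₀)|
          ≤ M * (√(Real.log n / (n * h n ^ 8)) ^ 2 * √(h n) ^ 2) ∧
      (gradient f (hitPoint f x₀) = 0 →
        |θhat n ω x₀ - hitTime f x₀ + phi2 P f K h X n ω x₀ (hitPoint f x₀)|
          ≤ M * (√(Real.log n / (n * h n ^ 8)) ^ 2 * √(h n) ^ 3)) := by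
  have ha := hs.filament.pos
  obtain ⟨R, -, hR⟩ := exists_confining hs.bounds hs.isCompact_startSet.isBounded
    (show 0 ≤ a + 1 by linarith)
  obtain ⟨B, hB, hgood⟩ := hs.exists_goodEvent (P := P) hf hK hh hX R
  obtain ⟨η₁, D₁, hη₁, hD₁, hexp₁⟩ := hs.hitTime_expansion hR
  obtain ⟨η₂, D₂, hη₂, hD₂, hexp₂⟩ := hs.hitTime_expansion_critical hR
  obtain ⟨q, hq, hcq⟩ := hh.exists_sqrt_le
  set η : ℝ := min 1 (min η₁ η₂) with hη
  have hη0 : 0 < η := by positivity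
  -- Every error in the good event is at most B(s + t) with s ≤ A and t ≤ c, so A, c ≤ η/(2B) makes
  -- it at most η. The bound on c follows from c ≤ qA and A ≤ δ/q.
  set δ : ℝ := min 1 (η / (2 * B)) with hδ
  have hδ0 : 0 < δ := by positivity
  set k₁ : ℝ := 5 * B * q ^ 2 + 2 * (2 * B * q) ^ 2 with hk₁
  set k₂ : ℝ := B * q + (4 * B * q + (2 * B * q) ^ 2) * (4 * B * q + (2 * B * q) ^ 2 + 2 * B * q)
    with hk₂
  refine ⟨D₁ * k₁ + D₂ * k₂, by positivity, hgood.mono ?_⟩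
  filter_upwards [hcq, hh.eventually_rate_le hδ0, hh.eventually_le_one,
    hh.eventually_rate_le (show 0 < δ / q by positivity)] with n hcqn hAδ hn1 hAq ω hω x₀ hx₀
  have hn0 := hh.pos n
  set c := √(h n) with hc
  set A := √(Real.log n / (n * h n ^ 8)) with hA
  set g := fHat K h X n ω with hg
  have hc0 : 0 < c := Real.sqrt_pos.mpr hn0
  have hA0 : 0 ≤ A := Real.sqrt_nonneg _
  have hc1 : c ≤ 1 := Real.sqrt_le_one.mpr hn1
  have hA1 : A ≤ 1 := hAδ.trans (min_le_left _ _)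
  have hcδ : c ≤ δ := hcqn.trans (by rwa [le_div_iff₀ (by linarith), mul_comm] at hAq)
  have hsmall : ∀ {s t : ℝ}, s ≤ A → t ≤ c → B * (s + t) ≤ η := fun {s t} hs ht => by
    have h1 : s + t ≤ 2 * (η / (2 * B)) := by
      have := min_le_right 1 (η / (2 * B))
      linarith
    calc B * (s + t) ≤ B * (2 * (η / (2 * B))) := by gcongr
      _ = η := by field_simp
  have pA : ∀ k : ℕ, A * c ^ k ≤ A := fun k =>
    mul_le_of_le_one_right hA0 (pow_le_one₀ hc0.le hc1)
  have pc : ∀ k : ℕ, k ≠ 0 → c ^ k ≤ c := fun k hk => pow_le_of_le_one hc0.le hc1 hk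
  have b1 : B * (A * c ^ 4) + B * c ^ 4 ≤ η := by
    rw [← mul_add]; exact hsmall (pA 4) (pc 4 (by norm_num))
  have b2 : B * (A * c ^ 2 + c ^ 4) ≤ η := hsmall (pA 2) (pc 4 (by norm_num))
  have b3 : B * (A + c ^ 2) ≤ η := hsmall le_rfl (pc 2 (by norm_num))
  have b4 : B * (A * c ^ 3 + c ^ 4) ≤ η := hsmall (pA 3) (pc 4 (by norm_num))
  have l0 : η ≤ 1 := min_le_left _ _
  have l1 : η ≤ η₁ := (min_le_right _ _).trans (min_le_left _ _)
  have l2 : η ≤ η₂ := (min_le_right _ _).trans (min_le_right _ _)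
  have hk₁0 : 0 ≤ k₁ := by positivity
  have hk₂0 : 0 ≤ k₂ := by positivity
  constructor
  · have h1 := hexp₁ g _ _ _ hω.approx (b1.trans l1) (b2.trans l1) (b3.trans l1) _ _
      (b4.trans l0) hω.integral x₀ hx₀ _ (hω.mean_d2 _) _ (hθ n ω x₀ hx₀)
    have h2 := general_rate hB.le hc0.le hc1 hA0 hA1 hq hcqn
    refine (le_of_eq rfl).trans (h1.trans ?_)
    calc _ ≤ D₁ * (k₁ * (A ^ 2 * c ^ 2)) := by
          refine mul_le_mul_of_nonneg_left ?_ hD₁.le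
          rw [mul_add B (A * c ^ 4)] at h2
          exact h2
      _ = D₁ * k₁ * (A ^ 2 * c ^ 2) := by ring
      _ ≤ _ := by gcongr; linarith [mul_nonneg hD₂.le hk₂0]
  · intro hcrit
    have h1 := hexp₂ g _ _ _ hω.approx (b1.trans l2) (b2.trans l2) (b3.trans l2) _ _ _
      le_rfl hω.integral (meanGrad P K h X n)
      (fun y hy => ⟨hω.mean_grad y, hω.grad y hy⟩) x₀ hx₀ hcrit _ (hθ n ω x₀ hx₀)
    have h2 := critical_rate hB.le hc0.le hc1 hA0 hA1 hq hcqn rfl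
    refine (le_of_eq rfl).trans (h1.trans ?_)
    calc _ ≤ D₂ * (k₂ * (A ^ 2 * c ^ 3)) := mul_le_mul_of_nonneg_left h2 hD₂.le
      _ = D₂ * k₂ * (A ^ 2 * c ^ 3) := by ring
      _ ≤ _ := by gcongr; linarith [mul_nonneg hD₁.le hk₁0]

lemma rate_mul_sqrt_sq {x y η : ℝ} (hη : 0 < η) (hxy : 0 ≤ x / (y * η ^ 8)) :
    √(x / (y * η ^ 8)) ^ 2 * √η ^ 2 = x / (y * η ^ 7) := by
  rw [Real.sq_sqrt hxy, Real.sq_sqrt hη.le]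
  field_simp

/-- In powers of √η the exponents are 16 − 3 = 13, which explains 13/2. -/
lemma rate_mul_sqrt_cube {x y η : ℝ} (hη : 0 < η) (hxy : 0 ≤ x / (y * η ^ 8)) :
    √(x / (y * η ^ 8)) ^ 2 * √η ^ 3 = x / (y * η ^ (13 / 2 : ℝ)) := by
  have h1 : η ^ (13 / 2 : ℝ) = √η ^ 13 := by
    rw [Real.sqrt_eq_rpow, ← Real.rpow_natCast, ← Real.rpow_mul hη.le]
    norm_num
  have h2 : 0 < √η := Real.sqrt_pos.mpr hη
  have h3 : η ^ 8 = √η ^ 16 := by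
    rw [show √η ^ 16 = (√η ^ 2) ^ 8 by ring, Real.sq_sqrt hη.le]
  rw [Real.sq_sqrt hxy, h1, h3]
  field_simp

end Expansion

end Filament

end

theorem lemma3p1 {Ω : Type*} [MeasurableSpace Ω] (P : Measure Ω) [IsProbabilityMeasure P]
    (f K : Filament.Plane → ℝ) (H L : Set Filament.Plane) (a : ℝ) (h : ℕ → ℝ)
    (X : ℕ → Ω → Filament.Plane)
    (hf : Filament.SmoothDensity f)
    (hH : Filament.RegularRegion f H)
    (hL : Filament.IsFilament f H L a)
    (hV : Filament.AverageNondegenerate f L a)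
    (hT : Filament.Transversal f L)
    (hD : Filament.NoDegenerate f H)
    (hDs : Filament.NoDegenerate f (Filament.searchedSet f L a))
    (hK : Filament.IsKernel K)
    (hR : Filament.FiniteRoughness K)
    (hh : Filament.IsBandwidth h)
    (hX : Filament.IsSample P f X)
    (θhat : ℕ → Ω → Filament.Plane → ℝ)
    (hθ : ∀ n ω, ∀ x₀ ∈ Filament.startSet f L a,
      Filament.IsHitTime (Filament.fHat K h X n ω) x₀ (θhat n ω x₀)) :
    Filament.IsBigOp P
      (fun n ω => ⨆ x₀ ∈ Filament.startSet f L a,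
        ENNReal.ofReal |(θhat n ω x₀ - Filament.hitTime f x₀)
          + Filament.phi1 P f K h X n ω (Filament.hitPoint f x₀)|)
      (fun n => Real.log n / (n * h n ^ 7)) ∧
    ((∀ x₀ ∈ Filament.startSet f L a, gradient f (Filament.hitPoint f x₀) = 0) →
      Filament.IsBigOp P
        (fun n ω => ⨆ x₀ ∈ Filament.startSet f L a,
          ENNReal.ofReal |(θhat n ω x₀ - Filament.hitTime f x₀)
            + Filament.phi2 P f K h X n ω x₀ (Filament.hitPoint f x₀)|)
        (fun n => Real.log n / (n * h n ^ (13 / 2 : ℝ)))) := by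
  obtain ⟨C, hC⟩ := hf.derivBounds
  have hs : Filament.Setup f H L a C := ⟨hC, hH, hL, hV, hT, hDs⟩
  obtain ⟨M, hM, hexp⟩ := hs.expansion (P := P) hf hK hh hX θhat hθ
  have hrate : ∀ n : ℕ, 0 ≤ Real.log n / (n * h n ^ 8) := fun n => by
    have := hh.pos n
    exact div_nonneg (Real.log_natCast_nonneg n) (by positivity)
  refine ⟨Filament.HighProb.isBigOp hM (hexp.mono (Eventually.of_forall fun n ω hω => ?_)),
    fun hcrit => Filament.HighProb.isBigOp hM
      (hexp.mono (Eventually.of_forall fun n ω hω => ?_))⟩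
  · refine iSup₂_le fun x₀ hx₀ => ENNReal.ofReal_le_ofReal ?_
    rw [← Filament.rate_mul_sqrt_sq (hh.pos n) (hrate n)]
    exact (hω x₀ hx₀).1
  · refine iSup₂_le fun x₀ hx₀ => ENNReal.ofReal_le_ofReal ?_
    rw [← Filament.rate_mul_sqrt_cube (hh.pos n) (hrate n)]
    exact (hω x₀ hx₀).2 (hcrit x₀ hx₀)
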